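/- **Setting.** Powers and logarithms use the branch $-\pi<\arg z\le\pi$. Let $\Gamma\le \mathrm{SL}_2(\mathbb Z)$ be a subgroup of finite index, let $r>0$ be real, and let $f\neq 0$ be a modular form of weight $r$ for $\Gamma$ with a multiplier system: $f$ is analytic on the upper half-plane $\mathbb H$, satisfies $f(\gamma z)=\mu_\gamma (cz+d)^r f(z)$ with $|\mu_\gamma|=1$ for every $\gamma=\begin{pmatrix}a&b\\c&d\end{pmatrix}\in\Gamma$, and $|f(z)|\le C(\Im z)^{-K}$ for some constants $C,K$ and all $z$ with $\Im z$ small enough. For a cusp $\mathfrak a\in\mathbb Q\cup\{\infty\}$ choose $\gamma\in\mathrm{SL}_2(\mathbb Z)$ with bottom row $(c,d)$ and $\gamma(\infty)=\mathfrak a$, and let $m_{\mathfrak a}$ be the width of $\mathfrak a$, i.e. the least $m\ge1$ such that $\gamma\begin{pmatrix}1&m\\0&1\end{pmatrix}\gamma^{-1}\in\pm\Gamma$. There is an expansion $$m_{\mathfrak a}^{r/2}\,\frac{f(\gamma(m_{\mathfrak a}z))}{(c\,m_{\mathfrak a}z+d)^r}=\sum_{n\ge0}a_n^{\mathfrak a}e^{2\pi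 i(n+\kappa_{\mathfrak a})z}\qquad(z\in\mathbb H),\qquad 0\le\kappa_{\mathfrak a}<1 .$$ Assume that $\kappa_{\mathfrak a}\in\mathbb Q$ for every cusp $\mathfrak a$. The cusp $\mathfrak a$ is *cuspidal for $f$* if $\kappa_{\mathfrak a}>0$ or $a_0^{\mathfrak a}=0$, and $f$ is a *cusp form* if every cusp is cuspidal for $f$. Put $\alpha_0=r/2$ if $f$ is a cusp form and $\alpha_0=r$ otherwise, and let $\alpha>\alpha_0$. Writing $m=m_\infty$, $\kappa=\kappa_\infty$ and $f(mz)=\sum_{n\ge0}a_ne^{2\pi i(n+\kappa)z}$, let $$f_\alpha(mx)=\sum_{n+\kappa>0}\frac{a_n}{(n+\kappa)^\alpha}e^{2\pi i(n+\kappa)x},$$ the limit of the partial sums in the order of increasing $n$ (this limit exists for every real $x$). **Hölder exponents.** For a continuous $g:\mathbb R\to\mathbb C$: - $g\in\mathcal C^s(x_0)$ ($s\ge0$) if there is a polynomial $P$ of degree less than $s$ (so $P=0$ when $s=0$) with $g(x)-P(x-x_0)=O(|x-x_0|^s)$ as $x\to x_0$. - $g\in\mathcal C^{k,s}(x_0)$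 ($k\ge0$ an integer, $0\le s\le1$) if $g^{(k)}$ exists and is continuous on an open interval containing $x_0$ and $g^{(k)}(x)-g^{(k)}(x_0)=O(|x-x_0|^s)$ as $x\to x_0$. - $g\in\mathcal C^{k,s}(I)$ ($I$ open) if $g^{(k)}$ exists on $I$ and, on every compact subset of $I$, is continuous and satisfies a uniform $s$-Hölder condition. Set $\beta(x_0)=\sup\{s: g\in\mathcal C^s(x_0)\}$, $\beta^*(x_0)=\sup\{k+s:g\in\mathcal C^{k,s}(x_0)\}$ and $\beta^{**}(x_0)=\lim_{I\to\{x_0\}}\sup\{k+s:g\in\mathcal C^{k,s}(I)\}$, the limit being taken along nested open intervals $I$ with intersection $\{x_0\}$. **Approximation exponent.** For real $x$ let $\tau_x\in[-\infty,\infty]$ be the supremum of the real numbers $\tau$ for which there is a constant $C$ such that $\left|x-\frac pq\right|\le C q^{-\tau}$ for infinitely many rationals $p/q$ (in lowest terms, $q>0$) that are not cuspidal for $f$. **Theorem.** Let $x$ be irrational and let $\beta,\beta^*,\beta^{**}$ be the Hölder exponents of any one of the functions $f_\alpha$, $\Re f_\alpha$, $\Im f_\alpha$. 1. If $f$ is a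 cusp form, then $\beta(x)=\beta^*(x)=\beta^{**}(x)=\alpha-r/2$. 2. If $f$ is not a cusp form, then, with the convention $1/\infty=0$, $$\beta(x)=\alpha-\Big(1-\frac1{\tau_x}\Big)r,\qquad \beta^{**}(x)=\alpha-r,$$ $$\beta^*(x)=\begin{cases}[\alpha-r]+\min\big(1,\{\alpha-r\}+r/\tau_x\big)&\text{if }\alpha-r\notin\mathbb Z,\\ \alpha-r&\text{if }\alpha-r\in\mathbb Z,\end{cases}$$ where $[s]$ and $\{s\}$ denote the integer and fractional parts of $s$. -/

import Mathlib

open scoped MatrixGroups Manifold Topology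

noncomputable section

namespace FracModular

/-! ### Hölder classes and Hölder exponents -/

/-- `f ∈ 𝒞^s(x₀)`: `f` is continuous and there is a polynomial `P` of degree less than `s`
(so `P = 0` when `s = 0`) with `f(x) - P(x - x₀) = O(|x - x₀|^s)` as `x → x₀`. -/
def MemPointwise (f : ℝ → ℂ) (s x₀ : ℝ) : Prop :=
  0 ≤ s ∧ Continuous f ∧ ∃ P : Polynomial ℂ, (∀ n ∈ P.support, (n : ℝ) < s) ∧
    (fun x : ℝ => f x - P.eval ((x - x₀ : ℝ) : ℂ)) =O[𝓝 x₀] fun x : ℝ => |x - x₀| ^ s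

/-- The derivatives `f', …, f^{(k)}` exist at every point of the open set `Ω`; the `k`-th one is
then `iteratedDeriv k f` on `Ω`. -/
def DifferentiableTimesOn (f : ℝ → ℂ) (k : ℕ) (Ω : Set ℝ) : Prop :=
  ∀ j < k, ∀ x ∈ Ω, DifferentiableAt ℝ (iteratedDeriv j f) x

/-- `f ∈ 𝒞^{k,s}(x₀)`, where `0 ≤ s ≤ 1`: `f` is continuous, `f^{(k)}` exists and is continuous in
an open interval containing `x₀`, and satisfies an `s`-Hölder condition at `x₀`. -/
def MemRestricted (f : ℝ → ℂ) (k : ℕ) (s x₀ : ℝ) : Prop :=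
  0 ≤ s ∧ s ≤ 1 ∧ Continuous f ∧
    (∃ a b : ℝ, a < x₀ ∧ x₀ < b ∧ DifferentiableTimesOn f k (Set.Ioo a b) ∧
      ContinuousOn (iteratedDeriv k f) (Set.Ioo a b)) ∧
    (fun x : ℝ => iteratedDeriv k f x - iteratedDeriv k f x₀) =O[𝓝 x₀] fun x : ℝ => |x - x₀| ^ s

/-- `f ∈ 𝒞^{k,s}(Ω)` for an open set `Ω`, where `0 ≤ s ≤ 1`: `f` is continuous, `f^{(k)}` exists
in `Ω` and on every compact subset of `Ω` it is continuous and uniformly `s`-Hölder. -/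
def MemLocal (f : ℝ → ℂ) (k : ℕ) (s : ℝ) (Ω : Set ℝ) : Prop :=
  0 ≤ s ∧ s ≤ 1 ∧ Continuous f ∧ DifferentiableTimesOn f k Ω ∧
    ∀ K : Set ℝ, IsCompact K → K ⊆ Ω → ContinuousOn (iteratedDeriv k f) K ∧
      ∃ C : ℝ, ∀ x ∈ K, ∀ y ∈ K,
        ‖iteratedDeriv k f x - iteratedDeriv k f y‖ ≤ C * |x - y| ^ s

/-- The pointwise Hölder exponent `β(x₀) = sup {s : f ∈ 𝒞^s(x₀)}`, with values in `[-∞, ∞]`. -/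
def holderExp (f : ℝ → ℂ) (x₀ : ℝ) : EReal :=
  ⨆ (s : ℝ) (_ : MemPointwise f s x₀), (s : EReal)

/-- The restricted local Hölder exponent `β*(x₀) = sup {k + s : f ∈ 𝒞^{k,s}(x₀)}`. -/
def holderExpStar (f : ℝ → ℂ) (x₀ : ℝ) : EReal :=
  ⨆ (k : ℕ) (s : ℝ) (_ : MemRestricted f k s x₀), ((k + s : ℝ) : EReal)

/-- `sup {k + s : f ∈ 𝒞^{k,s}(Ω)}`. -/
def holderExpOn (f : ℝ → ℂ) (Ω : Set ℝ) : EReal :=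
  ⨆ (k : ℕ) (s : ℝ) (_ : MemLocal f k s Ω), ((k + s : ℝ) : EReal)

/-- The local Hölder exponent `β**(x₀)`, the limit of `sup {k + s : f ∈ 𝒞^{k,s}(I)}` as the open
interval `I` shrinks to `{x₀}`. This quantity increases as `I` shrinks, so the limit is a
supremum; see `tendsto_holderExpOn`. -/
def holderExpStarStar (f : ℝ → ℂ) (x₀ : ℝ) : EReal :=
  ⨆ (a : ℝ) (b : ℝ) (_ : a < x₀) (_ : x₀ < b), holderExpOn f (Set.Ioo a b)

theorem holderExpOn_anti (f : ℝ → ℂ) {Ω Ω' : Set ℝ} (h : Ω ⊆ Ω') :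
    holderExpOn f Ω' ≤ holderExpOn f Ω := by
  refine iSup_mono fun k => iSup_mono fun s => iSup_mono' fun hf => ⟨?_, le_rfl⟩
  obtain ⟨h0, h1, hc, hd, hK⟩ := hf
  exact ⟨h0, h1, hc, fun j hj x hx => hd j hj x (h hx), fun K hKc hKΩ => hK K hKc (hKΩ.trans h)⟩

/-- `β**(x₀)` is the limit of `sup {k + s : f ∈ 𝒞^{k,s}(I)}` along every sequence of nested open
intervals `I` whose intersection is `{x₀}`. -/
theorem tendsto_holderExpOn (f : ℝ → ℂ) (x₀ : ℝ) (a b : ℕ → ℝ)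
    (hnest : ∀ n, Set.Ioo (a (n + 1)) (b (n + 1)) ⊆ Set.Ioo (a n) (b n))
    (hinter : ⋂ n, Set.Ioo (a n) (b n) = {x₀}) :
    Filter.Tendsto (fun n => holderExpOn f (Set.Ioo (a n) (b n))) Filter.atTop
      (𝓝 (holderExpStarStar f x₀)) := by
  have hanti : Antitone fun n => Set.Ioo (a n) (b n) := antitone_nat_of_succ_le hnest
  have hmono : Monotone fun n => holderExpOn f (Set.Ioo (a n) (b n)) :=
    fun m n hmn => holderExpOn_anti f (hanti hmn)
  have hx : ∀ n, x₀ ∈ Set.Ioo (a n) (b n) := by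
    have : x₀ ∈ ⋂ n, Set.Ioo (a n) (b n) := by rw [hinter]; rfl
    exact fun n => Set.mem_iInter.1 this n
  have hsmall : ∀ c d : ℝ, c < x₀ → x₀ < d → ∃ n, Set.Ioo (a n) (b n) ⊆ Set.Ioo c d := by
    intro c d hc hd
    have h1 : (c + x₀) / 2 ∉ ⋂ n, Set.Ioo (a n) (b n) := by
      rw [hinter, Set.mem_singleton_iff]; intro h; linarith
    have h2 : (x₀ + d) / 2 ∉ ⋂ n, Set.Ioo (a n) (b n) := by
      rw [hinter, Set.mem_singleton_iff]; intro h; linarith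
    simp only [Set.mem_iInter, not_forall, Set.mem_Ioo, not_and, not_lt] at h1 h2
    obtain ⟨i, hi⟩ := h1
    obtain ⟨j, hj⟩ := h2
    have hca : c ≤ a i := by
      by_contra hlt
      have := hi (by linarith)
      linarith [(hx i).2]
    have hbd : b j ≤ d := by
      by_contra hlt
      have := hj (by linarith [(hx j).1])
      linarith
    refine ⟨max i j, fun y hy => ⟨?_, ?_⟩⟩
    · exact lt_of_le_of_lt hca (hanti (le_max_left i j) hy).1
    · exact lt_of_lt_of_le (hanti (le_max_right i j) hy).2 hbd
  have heq : holderExpStarStar f x₀ = ⨆ n, holderExpOn f (Set.Ioo (a n) (b n)) := by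
    apply le_antisymm
    · refine iSup_le fun c => iSup_le fun d => iSup_le fun hc => iSup_le fun hd => ?_
      obtain ⟨n, hn⟩ := hsmall c d hc hd
      exact (holderExpOn_anti f hn).trans
        (le_iSup (fun n => holderExpOn f (Set.Ioo (a n) (b n))) n)
    · refine iSup_le fun n => ?_
      exact le_iSup_of_le (a n) (le_iSup_of_le (b n)
        (le_iSup_of_le (hx n).1 (le_iSup_of_le (hx n).2 le_rfl)))
  rw [heq]
  exact tendsto_atTop_iSup hmono

/-! ### Modular forms of real weight with a multiplier system -/

/-- `f` is a modular form of real weight `r` for the group `Γ`, with some multiplier system `μ`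
(for nonzero `f` the numbers `μ γ`, `γ ∈ Γ`, are determined by `f`). Powers are taken with the
principal branch, `-π < arg ≤ π`. -/
structure IsModularForm (Γ : Subgroup SL(2, ℤ)) (r : ℝ) (f : UpperHalfPlane → ℂ) : Prop where
  /-- `f` is analytic in the upper half-plane. -/
  holo : MDifferentiable 𝓘(ℂ) 𝓘(ℂ) f
  /-- The transformation law, with unimodular multipliers. -/
  modular : ∃ μ : SL(2, ℤ) → ℂ, ∀ γ ∈ Γ, ‖μ γ‖ = 1 ∧ ∀ z : UpperHalfPlane,
    f (γ • z) = μ γ * ((γ 1 0 : ℂ) * (z : ℂ) + (γ 1 1 : ℂ)) ^ (r : ℂ) * f z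
  /-- At most polynomial growth as the imaginary part tends to `0`. -/
  growth : ∃ C K δ : ℝ, 0 < δ ∧ ∀ z : UpperHalfPlane, z.im < δ → ‖f z‖ ≤ C * z.im ^ (-K)

/-- The width of the cusp `γ(∞)`. The stabilizer of this cusp in `SL(2, ℤ)` consists of the
matrices `± γ T^n γ⁻¹` with `T = (1 1; 0 1)`, and the width is its order modulo `± Γ`. -/
def width (Γ : Subgroup SL(2, ℤ)) (γ : SL(2, ℤ)) : ℕ :=
  sInf {n : ℕ | 0 < n ∧
    (γ * ModularGroup.T ^ n * γ⁻¹ ∈ Γ ∨ -(γ * ModularGroup.T ^ n * γ⁻¹) ∈ Γ)}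

/-- The function `f|_σ` for the scaling matrix `σ = γ η` of the cusp `γ(∞)`, where `m` is the
width of this cusp and `η = (√m 0; 0 1/√m)`. Explicitly `f|_η(z) = m^{r/2} f(m z)`, so
`f|_σ(z) = m^{r/2} f(γ(m z)) (c m z + d)^{-r}` with `(c, d)` the bottom row of `γ`. -/
def scaledSlash (Γ : Subgroup SL(2, ℤ)) (r : ℝ) (f : UpperHalfPlane → ℂ) (γ : SL(2, ℤ)) :
    UpperHalfPlane → ℂ := fun z =>
  ((((width Γ γ : ℝ) ^ (r / 2) : ℝ)) : ℂ) *
    (f (γ • UpperHalfPlane.ofComplex ((width Γ γ : ℂ) * (z : ℂ))) /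
      ((γ 1 0 : ℂ) * ((width Γ γ : ℂ) * (z : ℂ)) + (γ 1 1 : ℂ)) ^ (r : ℂ))

/-- The parameter `κ` of a function `F` on the upper half-plane with
`F(z) = ∑_{n ≥ 0} a_n e^{2πi(n+κ)z}`: the number `0 ≤ κ < 1` with `F(z + 1) = e^{2πiκ} F(z)`,
which is unique for `F ≠ 0` (the set below is then a singleton). -/
def cuspParam (F : UpperHalfPlane → ℂ) : ℝ :=
  sInf {κ : ℝ | 0 ≤ κ ∧ κ < 1 ∧ ∀ z : UpperHalfPlane,
    F ((1 : ℝ) +ᵥ z) = Complex.exp (2 * Real.pi * Complex.I * κ) * F z}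

/-- The coefficient `a_n` in `F(z) = ∑_{n ≥ 0} a_n e^{2πi(n+κ)z}`, computed on the horocycle
`Im z = 1`. -/
def fourierCoef (F : UpperHalfPlane → ℂ) (n : ℕ) : ℂ :=
  ∫ t in (0 : ℝ)..1, F (t +ᵥ UpperHalfPlane.I) *
    Complex.exp (-(2 * Real.pi * Complex.I * ((n : ℂ) + (cuspParam F : ℂ)) *
      ((t : ℂ) + Complex.I)))

/-- `f` is cuspidal at the cusp `𝔞 ∈ ℚ ∪ {∞}`: either `κ_𝔞 > 0` or `a_0^𝔞 = 0`. This does not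
depend on the choice of `γ ∈ SL(2, ℤ)` with `γ(∞) = 𝔞`. -/
def IsCuspidalAt (Γ : Subgroup SL(2, ℤ)) (r : ℝ) (f : UpperHalfPlane → ℂ) (𝔞 : OnePoint ℚ) :
    Prop :=
  ∀ γ : SL(2, ℤ), Matrix.SpecialLinearGroup.mapGL ℚ γ • (OnePoint.infty : OnePoint ℚ) = 𝔞 →
    0 < cuspParam (scaledSlash Γ r f γ) ∨ fourierCoef (scaledSlash Γ r f γ) 0 = 0

/-- `f` is a cusp form: it is cuspidal at every cusp. -/
def IsCuspForm (Γ : Subgroup SL(2, ℤ)) (r : ℝ) (f : UpperHalfPlane → ℂ) : Prop :=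
  ∀ 𝔞 : OnePoint ℚ, IsCuspidalAt Γ r f 𝔞

/-- The cusp parameters `κ_𝔞` are rational for all cusps `𝔞`. -/
def RationalCuspParams (Γ : Subgroup SL(2, ℤ)) (r : ℝ) (f : UpperHalfPlane → ℂ) : Prop :=
  ∀ γ : SL(2, ℤ), ∃ q : ℚ, cuspParam (scaledSlash Γ r f γ) = (q : ℝ)

open Classical in
/-- The critical exponent `α₀`: `r / 2` if `f` is a cusp form and `r` otherwise. -/
def alphaZero (Γ : Subgroup SL(2, ℤ)) (r : ℝ) (f : UpperHalfPlane → ℂ) : ℝ :=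
  if IsCuspForm Γ r f then r / 2 else r

/-! ### Fractional integrals -/

/-- The function `z ↦ f(m z)`, where `m` is the width of the cusp `∞`. -/
def dilate (Γ : Subgroup SL(2, ℤ)) (f : UpperHalfPlane → ℂ) : UpperHalfPlane → ℂ := fun z =>
  f (UpperHalfPlane.ofComplex ((width Γ 1 : ℂ) * (z : ℂ)))

/-- The sum of the terms with `n < N` of the series
`f_α(x) = ∑_{n + κ > 0} a_n (n + κ)^{-α} e^{2πi(n+κ)x/m}`, where
`f(m z) = ∑_{n ≥ 0} a_n e^{2πi(n+κ)z}` is the expansion of `f` at `∞`. -/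
def fracPartialSum (Γ : Subgroup SL(2, ℤ)) (f : UpperHalfPlane → ℂ) (α : ℝ) (N : ℕ) (x : ℝ) : ℂ :=
  ∑ n ∈ Finset.range N,
    if 0 < (n : ℝ) + cuspParam (dilate Γ f) then
      fourierCoef (dilate Γ f) n / ((((n : ℝ) + cuspParam (dilate Γ f)) ^ α : ℝ) : ℂ) *
        Complex.exp (2 * Real.pi * Complex.I * ((n : ℂ) + (cuspParam (dilate Γ f) : ℂ)) *
          ((x : ℂ) / (width Γ 1 : ℂ)))
    else 0

/-- The `α`-fractional integral `f_α`, as the (possibly only conditional) sum of its series. -/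
def fracIntegral (Γ : Subgroup SL(2, ℤ)) (f : UpperHalfPlane → ℂ) (α : ℝ) (x : ℝ) : ℂ :=
  Filter.limUnder Filter.atTop fun N : ℕ => fracPartialSum Γ f α N x

/-! ### Approximation by non-cuspidal rationals -/

/-- `τ_x`, the supremum in `[-∞, ∞]` of the `τ` for which there is a constant `C` such that
`|x - p/q| ≤ C / q^τ` for infinitely many rationals `p/q` (in lowest terms) at which `f` is not
cuspidal. -/
def approxExp (Γ : Subgroup SL(2, ℤ)) (r : ℝ) (f : UpperHalfPlane → ℂ) (x : ℝ) : EReal :=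
  ⨆ (τ : ℝ) (_ : ∃ C : ℝ, {q : ℚ | ¬ IsCuspidalAt Γ r f (q : OnePoint ℚ) ∧
    |x - (q : ℝ)| ≤ C / (q.den : ℝ) ^ τ}.Infinite), (τ : EReal)

end FracModular

end

/-! Let F be f minus its constant term at ∞, and write y = Im z. Two analytic facts link F with f_α.
First, f_α(x) is a constant times the integral of u^{α-1} F(x+iu) over u > 0. If F(z) =
O(y^{-A}|z-x|^B) near x, expanding F along horizontal lines gives a polynomial approximation of f_α
at x of every order s < α-A+B (`ExpSeries.exists_norm_fracLim_sub_le`). Second, integrating f_α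
against dilates of (1+2πit)^{-α-1} returns v^α F(x+iv) up to a constant, while polynomials of degree
less than α and the conjugate of f_α integrate to 0. So smoothness at x forces F to be small near x,
also when only Re f_α or Im f_α is given, and |F| ≥ c v^{-ρ} along points tending to x inside a cone
forces β(x) ≤ α-ρ (`ExpSeries.le_of_memPointwise`).

The arithmetic enters through |f(z)| y^{r/2}, which is Γ-invariant. Every z is γw with Im w ≥ 1/2.
The invariant modulus at z is always O((Im w)^{r/2}); it is bounded if the cusp γ(∞) is cuspidal,
and of exact order (Im w)^{r/2} for large Im w if it is not. There are finitely many cosets of Γ, so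
all constants are uniform. Hence f = O(y^{-r}) near the real axis in general, and f = O(y^{-r/2})
for cusp forms. Matrices attached to Dirichlet approximations of an irrational x carry fixed points
into a cone at x, where the invariant modulus stays bounded below (`exists_recurrent`); so β(x) ≤
α-r/2 always, which settles cusp forms.

If f is not a cusp form, |f| is at least of order (qy)^{-r} above a non-cuspidal p/q at heights up
to a multiple of q^{-2}. At height |x-p/q|, when this is O(q^{-τ}) with τ > 2, the value is at least
of order y^{-(r-r/τ)}. Conversely, if |x-p/q| ≥ c q^{-τ} for all non-cuspidal p/q, then f(z) =
O(y^{-r}|z-x|^{r/τ}) near x (`exists_norm_le_near`). Together these give β(x). Non-cuspidal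
rationals accumulate at x, and at each of them the pointwise exponent is at most α-r; if α-r = k is
an integer, the k-th derivative is not continuous there. This limits β** and the number of
derivatives available in β*. Since the k-th derivative of f_α is a multiple of f_{α-k}, the
pointwise result for f_{α-k} supplies the fractional part of β*. -/

open scoped MatrixGroups Manifold Topology

noncomputable section

/-! ### Cusp parameters and Fourier expansions of functions with periodic modulus -/

section

namespace FracModular

open Complex Filter
open UpperHalfPlane hiding I

/-- Two holomorphic functions with the same modulus differ by a unimodular constant. -/
theorem exists_unimodular_of_norm_eq {u v : ℂ → ℂ} {U : Set ℂ} (hU : IsOpen U)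
    (hc : IsPreconnected U) (hu : DifferentiableOn ℂ u U) (hv : DifferentiableOn ℂ v U)
    (h : ∀ z ∈ U, ‖u z‖ = ‖v z‖) : ∃ ε : ℂ, ‖ε‖ = 1 ∧ ∀ z ∈ U, u z = ε * v z := by
  by_cases h0 : ∀ z ∈ U, v z = 0
  · refine ⟨1, by simp, fun z hz => ?_⟩
    have := h z hz
    rw [h0 z hz, norm_zero, norm_eq_zero] at this
    simp [this, h0 z hz]
  push Not at h0
  obtain ⟨z₀, hz₀, hv₀⟩ := h0
  have hnear : ∀ᶠ z in 𝓝 z₀, v z ≠ 0 ∧ z ∈ U :=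
    ((hv.continuousOn.continuousAt (hU.mem_nhds hz₀)).eventually_ne hv₀).and (hU.mem_nhds hz₀)
  -- The quotient has modulus 1 near `z₀`, so by the maximum principle it is constant there; the
  -- identity theorem then spreads the equality over `U`.
  have hmax : ∀ᶠ z in 𝓝 z₀, (fun z => u z / v z) z = (fun z => u z / v z) z₀ := by
    apply Complex.eventually_eq_of_isLocalMax_norm
    · filter_upwards [hnear] with z hz
      exact ((hu z hz.2).differentiableAt (hU.mem_nhds hz.2)).div
        ((hv z hz.2).differentiableAt (hU.mem_nhds hz.2)) hz.1
    · filter_upwards [hnear] with z hz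
      simp only [Function.comp, norm_div]
      rw [h z hz.2, h z₀ hz₀, div_self (norm_ne_zero_iff.2 hz.1), div_self (norm_ne_zero_iff.2 hv₀)]
  refine ⟨u z₀ / v z₀, by rw [norm_div, h z₀ hz₀, div_self (norm_ne_zero_iff.2 hv₀)], ?_⟩
  refine (hu.analyticOnNhd hU).eqOn_of_preconnected_of_eventuallyEq
    (g := fun z => u z₀ / v z₀ * v z) ((hv.const_mul _).analyticOnNhd hU) hc hz₀ ?_
  filter_upwards [hnear, hmax] with z hz hz'
  rw [← hz', div_mul_cancel₀ _ hz.1]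

theorem exists_eq_exp_of_norm_eq_one {ε : ℂ} (hε : ‖ε‖ = 1) :
    ∃ κ : ℝ, 0 ≤ κ ∧ κ < 1 ∧ ε = exp (2 * Real.pi * I * κ) := by
  have hpi := Real.pi_pos
  refine ⟨Int.fract (arg ε / (2 * Real.pi)), Int.fract_nonneg _, Int.fract_lt_one _, ?_⟩
  have h1 : ε = exp (arg ε * I) := by
    conv_lhs => rw [← norm_mul_exp_arg_mul_I ε, hε]
    simp
  rw [Int.fract]
  push_cast
  rw [show 2 * (Real.pi : ℂ) * I * (arg ε / (2 * Real.pi) - (⌊arg ε / (2 * Real.pi)⌋ : ℂ)) =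
    arg ε * I - (⌊arg ε / (2 * Real.pi)⌋ : ℤ) * (2 * Real.pi * I) by
      field_simp [ofReal_ne_zero.2 hpi.ne'], exp_periodic.sub_int_mul_eq]
  exact h1

/-- The factor `z ↦ e^{-2πiκz} H(z)`, which has period `1` when `κ` is the parameter of `H`. -/
def cuspPart (H : ℍ → ℂ) : ℍ → ℂ := fun z => H z * exp (-(2 * Real.pi * I * cuspParam H * z))

theorem differentiableOn_comp_ofComplex {H : ℍ → ℂ} (hH : MDifferentiable 𝓘(ℂ) 𝓘(ℂ) H) :
    DifferentiableOn ℂ (H ∘ ofComplex) {z | 0 < z.im} :=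
  UpperHalfPlane.mdifferentiable_iff.1 hH

/-- Since |H| has period 1, H(z+1) and H(z) differ by a unimodular constant e^{2πiκ}. As H ≠ 0, only
one κ in [0,1) fits, so the infimum defining `cuspParam` runs over a singleton. Only moduli are
compared, so neither the multiplier system nor the branch of the power has to be followed. -/
theorem cuspParam_mem {H : ℍ → ℂ} (hH : MDifferentiable 𝓘(ℂ) 𝓘(ℂ) H) (hH0 : H ≠ 0)
    (hper : ∀ z, ‖H ((1 : ℝ) +ᵥ z)‖ = ‖H z‖) :
    0 ≤ cuspParam H ∧ cuspParam H < 1 ∧ ∀ z : ℍ,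
      H ((1 : ℝ) +ᵥ z) = exp (2 * Real.pi * I * cuspParam H) * H z := by
  have hD := differentiableOn_comp_ofComplex hH
  have hshift : ∀ z ∈ {z : ℂ | 0 < z.im}, z + 1 ∈ {z : ℂ | 0 < z.im} := by
    intro z hz; simpa using hz
  obtain ⟨ε, hε, h1⟩ := exists_unimodular_of_norm_eq (u := fun z => (H ∘ ofComplex) (z + 1))
    (v := H ∘ ofComplex) (isOpen_lt continuous_const Complex.continuous_im)
    ((convex_halfSpace_im_gt 0).isPreconnected)
    (hD.comp ((differentiable_id.add_const 1).differentiableOn) hshift) hD (by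
      intro z hz
      have h2 := hper ⟨z, hz⟩
      have h3 : ((1 : ℝ) +ᵥ (⟨z, hz⟩ : ℍ)) = ⟨z + 1, hshift z hz⟩ := by
        ext; simp [add_comm]
      rw [h3] at h2
      simpa [Function.comp, ofComplex_apply_of_im_pos (hshift z hz), ofComplex_apply_of_im_pos hz]
        using h2)
  have h2 : ∀ z : ℍ, H ((1 : ℝ) +ᵥ z) = ε * H z := by
    intro z
    have := h1 z z.im_pos
    have h3 : ofComplex ((z : ℂ) + 1) = (1 : ℝ) +ᵥ z := by
      rw [ofComplex_apply_of_im_pos (hshift z z.im_pos)]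
      ext; simp [add_comm]
    simpa [Function.comp, h3, ofComplex_apply] using this
  obtain ⟨κ, hκ0, hκ1, rfl⟩ := exists_eq_exp_of_norm_eq_one hε
  have hset : {κ : ℝ | 0 ≤ κ ∧ κ < 1 ∧ ∀ z : UpperHalfPlane,
      H ((1 : ℝ) +ᵥ z) = Complex.exp (2 * Real.pi * Complex.I * κ) * H z} = {κ} := by
    ext κ'
    simp only [Set.mem_ofPred_eq, Set.mem_singleton_iff]
    constructor
    · rintro ⟨h0, h1, h3⟩
      obtain ⟨z, hz⟩ := Function.ne_iff.1 hH0
      have h4 : exp (2 * Real.pi * I * κ') = exp (2 * Real.pi * I * κ) :=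
        mul_right_cancel₀ hz ((h3 z).symm.trans (h2 z))
      obtain ⟨n, hn⟩ := Complex.exp_eq_exp_iff_exists_int.1 h4
      have h5 : (κ' : ℂ) = κ + n := by
        have : (2 * Real.pi * I : ℂ) ≠ 0 := two_pi_I_ne_zero
        apply mul_left_cancel₀ this
        rw [hn]; ring
      have h6 : κ' = κ + n := by exact_mod_cast h5
      have h7 : n = 0 := by
        have ha : (n : ℝ) < 1 := by linarith
        have hb : (-1 : ℝ) < n := by linarith
        have ha' : n < 1 := by exact_mod_cast ha
        have hb' : -1 < n := by exact_mod_cast hb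
        omega
      simp [h6, h7]
    · rintro rfl
      exact ⟨hκ0, hκ1, h2⟩
  have : cuspParam H = κ := by
    rw [cuspParam, hset, csInf_singleton]
  rw [this]
  exact ⟨hκ0, hκ1, h2⟩

theorem mdifferentiable_mul_exp {H : ℍ → ℂ} (hH : MDifferentiable 𝓘(ℂ) 𝓘(ℂ) H) (c : ℂ) :
    MDifferentiable 𝓘(ℂ) 𝓘(ℂ) (fun z : ℍ => H z * exp (c * z)) := by
  rw [UpperHalfPlane.mdifferentiable_iff]
  have hD := differentiableOn_comp_ofComplex hH
  refine DifferentiableOn.congr (f := fun z => (H ∘ ofComplex) z * exp (c * z))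
    (hD.mul (by fun_prop)) ?_
  intro z hz
  simp [Function.comp, ofComplex_apply_of_im_pos hz]

theorem periodic_of_vadd {P : ℍ → ℂ} (hP : ∀ z : ℍ, P ((1 : ℝ) +ᵥ z) = P z) :
    Function.Periodic (P ∘ ofComplex) ((1 : ℝ) : ℂ) := by
  intro w
  by_cases hw : 0 < im w
  · have hw' : 0 < im (w + (1 : ℝ)) := by simpa using hw
    simp only [Function.comp_apply, ofComplex_apply_of_im_pos hw', ofComplex_apply_of_im_pos hw]
    rw [← hP ⟨w, hw⟩]
    congr 1
    ext
    simp [add_comm]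
  · have hw' : im (w + (1 : ℝ)) ≤ 0 := by simpa using hw
    rw [Function.comp_apply, Function.comp_apply, ofComplex_apply_of_im_nonpos hw',
      ofComplex_apply_of_im_nonpos (not_lt.1 hw)]

section Expansion

variable {H : ℍ → ℂ} (hH : MDifferentiable 𝓘(ℂ) 𝓘(ℂ) H) (hH0 : H ≠ 0)
    (hper : ∀ z, ‖H ((1 : ℝ) +ᵥ z)‖ = ‖H z‖)
    (hgr : ∃ C K Y : ℝ, ∀ z : ℍ, Y ≤ z.im → ‖H z‖ ≤ C * z.im ^ K)

include hH in
theorem mdifferentiable_cuspPart : MDifferentiable 𝓘(ℂ) 𝓘(ℂ) (cuspPart H) := by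
  have := mdifferentiable_mul_exp hH (-(2 * Real.pi * I * cuspParam H))
  simp only [neg_mul] at this
  exact this

include hH hH0 hper in
theorem cuspPart_vadd (z : ℍ) : cuspPart H ((1 : ℝ) +ᵥ z) = cuspPart H z := by
  simp only [cuspPart, (cuspParam_mem hH hH0 hper).2.2 z, coe_vadd]
  rw [mul_comm (exp _) (H z), mul_assoc, ← Complex.exp_add]
  congr 2
  push_cast
  ring

-- A priori e^{-2πiκz} H(z) could grow like e^{2πκy}. Multiplied by e^{2πiz} it tends to 0 because κ
-- < 1, and a periodic holomorphic function that vanishes at i∞ is O(|e^{2πiz}|) there; dividing by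
-- this factor gives boundedness.
include hH hH0 hper hgr in
theorem isBoundedAtImInfty_cuspPart : IsBoundedAtImInfty (cuspPart H) := by
  obtain ⟨h0, h1, -⟩ := cuspParam_mem hH hH0 hper
  obtain ⟨C, K, Y, hC⟩ := hgr
  have hpi := Real.pi_pos
  set κ := cuspParam H with hκ
  let Q : ℍ → ℂ := fun z => cuspPart H z * exp (2 * Real.pi * I * z)
  have hnQ : ∀ z, ‖Q z‖ = ‖H z‖ * Real.exp (-(2 * Real.pi * (1 - κ)) * z.im) := by
    intro z
    simp only [Q, cuspPart, norm_mul, mul_assoc, Complex.norm_exp, ← Real.exp_add]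
    congr 2
    simp [← hκ]
    ring
  have hQz : IsZeroAtImInfty Q := by
    rw [UpperHalfPlane.isZeroAtImInfty_iff]
    intro ε hε
    have ht : Tendsto (fun y : ℝ => C * (y ^ K * Real.exp (-(2 * Real.pi * (1 - κ)) * y))) atTop
        (𝓝 (C * 0)) :=
      (tendsto_rpow_mul_exp_neg_mul_atTop_nhds_zero K _ (by nlinarith)).const_mul C
    rw [mul_zero] at ht
    obtain ⟨A, hA⟩ := eventually_atTop.1 (ht.eventually (eventually_le_nhds hε))
    refine ⟨max A Y, fun z hz => ?_⟩
    rw [hnQ]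
    refine le_trans ?_ (hA z.im ((le_max_left _ _).trans hz))
    rw [← mul_assoc]
    exact mul_le_mul_of_nonneg_right (hC z ((le_max_right _ _).trans hz)) (Real.exp_nonneg _)
  have hQd : MDifferentiable 𝓘(ℂ) 𝓘(ℂ) Q :=
    mdifferentiable_mul_exp (mdifferentiable_cuspPart hH) (2 * Real.pi * I)
  have hQp : Function.Periodic (Q ∘ ofComplex) ((1 : ℝ) : ℂ) := by
    apply periodic_of_vadd
    intro z
    simp only [Q, cuspPart_vadd hH hH0 hper, coe_vadd]
    congr 1
    rw [mul_add, Complex.exp_add]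
    simp
  have hdec := hQz.exp_decay_atImInfty one_pos hQp hQd hQz.isBoundedAtImInfty
  obtain ⟨c, hc⟩ := hdec.bound
  rw [UpperHalfPlane.isBoundedAtImInfty_iff]
  obtain ⟨A, hA⟩ := (UpperHalfPlane.atImInfty_mem _).1 hc
  refine ⟨c, A, fun z hz => ?_⟩
  have h2 := hA z hz
  simp only [Set.mem_ofPred_eq, Q, norm_mul, Complex.norm_exp, Real.norm_eq_abs, Real.abs_exp] at h2
  have h3 : (2 * (Real.pi : ℂ) * I * (z : ℂ)).re = -2 * Real.pi * z.im / 1 := by simp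
  rw [h3] at h2
  exact le_of_mul_le_mul_right h2 (Real.exp_pos _)

include hH hH0 hper hgr in
theorem fourierCoef_eq_qExpansion (n : ℕ) :
    fourierCoef H n = (qExpansion 1 (cuspPart H)).coeff n := by
  rw [qExpansion_coeff_eq_intervalIntegral one_pos
    (periodic_of_vadd (cuspPart_vadd hH hH0 hper)) (mdifferentiable_cuspPart hH)
    (isBoundedAtImInfty_cuspPart hH hH0 hper hgr) n one_pos, fourierCoef]
  simp only [ofReal_one, div_one, one_mul]
  refine intervalIntegral.integral_congr fun t _ => ?_
  have h2 : cuspPart H ⟨(t : ℂ) + ((1 : ℝ) : ℂ) * ((UpperHalfPlane.I : ℍ) : ℂ), by simp⟩ =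
      cuspPart H (t +ᵥ UpperHalfPlane.I) := by
    congr 1; ext; simp
  simp only [ofReal_one, one_mul] at h2 ⊢
  rw [h2]
  simp only [cuspPart, coe_vadd, coe_I, Function.Periodic.qParam, one_div, ← Complex.exp_nat_mul,
    ← Complex.exp_neg, ofReal_one, div_one]
  rw [mul_comm (exp _) (H _ * _), mul_assoc (H _), ← Complex.exp_add]
  congr 2
  ring

include hH hH0 hper hgr in
/-- The Fourier expansion at a cusp. -/
theorem hasSum_fourier (z : ℍ) :
    HasSum (fun n : ℕ => fourierCoef H n * exp (2 * Real.pi * I * ((n : ℂ) + cuspParam H) * z))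
      (H z) := by
  have h := (hasSum_qExpansion one_pos
    (periodic_of_vadd (cuspPart_vadd hH hH0 hper)) (mdifferentiable_cuspPart hH)
    (isBoundedAtImInfty_cuspPart hH hH0 hper hgr) z).mul_right
      (exp (2 * Real.pi * I * cuspParam H * z))
  have h1 : cuspPart H z * exp (2 * Real.pi * I * cuspParam H * z) = H z := by
    rw [cuspPart, mul_assoc, ← Complex.exp_add]
    simp
  rw [h1] at h
  convert! h using 2 with n
  rw [fourierCoef_eq_qExpansion hH hH0 hper hgr, smul_eq_mul, mul_assoc (PowerSeries.coeff n _),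
    Function.Periodic.qParam, ← Complex.exp_nat_mul, ← Complex.exp_add]
  congr 2
  simp
  ring

end Expansion


/-! ### Series of exponentials with increasing frequencies -/

/-- The exponential `e^{2πi λ z}`. -/
def ex (l : ℝ) (z : ℂ) : ℂ := exp (2 * Real.pi * I * l * z)

theorem norm_ex (l : ℝ) (z : ℂ) : ‖ex l z‖ = Real.exp (-(2 * Real.pi * l * z.im)) := by
  rw [ex, Complex.norm_exp]
  congr 1
  simp

theorem norm_ex_ofReal (l x : ℝ) : ‖ex l x‖ = 1 := by
  simp [norm_ex]

/-- A series of exponentials with nonnegative frequencies is bounded by its majorant on a lower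
horocycle; it decays exponentially when the frequencies are bounded away from `0`. -/
theorem norm_le_of_hasSum_ex {a : ℕ → ℂ} {l : ℕ → ℝ} {H : ℂ → ℂ}
    (h : ∀ z : ℂ, 0 < z.im → HasSum (fun n => a n * ex (l n) z) (H z)) {l₀ : ℝ}
    (hl : ∀ n, a n ≠ 0 → l₀ ≤ l n) {y₀ : ℝ} (hy₀ : 0 < y₀) :
    ∃ C : ℝ, 0 ≤ C ∧ ∀ z : ℂ, y₀ ≤ z.im → ‖H z‖ ≤ C * Real.exp (-(2 * Real.pi * l₀ * z.im)) := by
  have hs : Summable fun n => ‖a n * ex (l n) (y₀ * I)‖ := (h (y₀ * I) (by simpa)).summable.norm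
  refine ⟨Real.exp (2 * Real.pi * l₀ * y₀) * ∑' n, ‖a n * ex (l n) (y₀ * I)‖, by positivity,
    fun z hz => ?_⟩
  have hz0 : 0 < z.im := hy₀.trans_le hz
  have hle : ∀ n, ‖a n * ex (l n) z‖ ≤ ‖a n * ex (l n) (y₀ * I)‖ *
      (Real.exp (2 * Real.pi * l₀ * y₀) * Real.exp (-(2 * Real.pi * l₀ * z.im))) := by
    intro n
    rw [norm_mul, norm_mul, mul_assoc]
    by_cases hn : a n = 0
    · simp [hn]
    refine mul_le_mul_of_nonneg_left ?_ (norm_nonneg _)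
    rw [norm_ex, norm_ex, ← Real.exp_add, ← Real.exp_add]
    apply Real.exp_le_exp.2
    have h1 : 0 ≤ (l n - l₀) * (z.im - y₀) :=
      mul_nonneg (sub_nonneg.2 (hl n hn)) (sub_nonneg.2 hz)
    have h2 := mul_nonneg Real.pi_pos.le h1
    simp only [mul_im, ofReal_re, Complex.I_im, mul_one, ofReal_im, Complex.I_re, mul_zero, add_zero]
    nlinarith
  have := (h z hz0).norm_le_of_bounded (hs.mul_right _).hasSum hle
  rw [tsum_mul_right] at this
  linarith [this]

end FracModular

end

section

namespace FracModular

open Complex Filter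
open UpperHalfPlane hiding I

/-! ### The invariant modulus of a modular form -/

theorem coe_smul_int (γ : SL(2, ℤ)) (z : ℍ) :
    ((γ • z : ℍ) : ℂ) = ((γ 0 0 : ℂ) * z + γ 0 1) / ((γ 1 0 : ℂ) * z + γ 1 1) := by
  rw [coe_specialLinearGroup_apply]
  simp

theorem denom_int_ne_zero (γ : SL(2, ℤ)) {z : ℂ} (hz : 0 < z.im) :
    (γ 1 0 : ℂ) * z + γ 1 1 ≠ 0 := by
  have := UpperHalfPlane.denom_ne_zero (γ : GL (Fin 2) ℝ) ⟨z, hz⟩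
  rwa [ModularGroup.denom_apply] at this

theorem im_smul_int (γ : SL(2, ℤ)) (z : ℍ) :
    (γ • z : ℍ).im = z.im / ‖(γ 1 0 : ℂ) * z + γ 1 1‖ ^ 2 := by
  rw [ModularGroup.im_smul_eq_div_normSq, ModularGroup.denom_apply, Complex.normSq_eq_norm_sq]

/-- The function `|f(z)| (Im z)^{r/2}`, which is invariant under the group of `f`. -/
def invNorm (r : ℝ) (f : ℍ → ℂ) (z : ℍ) : ℝ := ‖f z‖ * z.im ^ (r / 2)

theorem invNorm_nonneg (r : ℝ) (f : ℍ → ℂ) (z : ℍ) : 0 ≤ invNorm r f z :=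
  mul_nonneg (norm_nonneg _) (Real.rpow_nonneg z.im_pos.le _)

theorem norm_eq_invNorm (r : ℝ) (f : ℍ → ℂ) (z : ℍ) :
    ‖f z‖ = invNorm r f z * z.im ^ (-(r / 2)) := by
  rw [invNorm, mul_assoc, ← Real.rpow_add z.im_pos]
  simp

theorem div_sq_rpow_half {y t : ℝ} (hy : 0 ≤ y) (ht : 0 ≤ t) (r : ℝ) :
    (y / t ^ 2) ^ (r / 2) = y ^ (r / 2) / t ^ r := by
  rw [Real.div_rpow hy (by positivity), ← Real.rpow_natCast, ← Real.rpow_mul ht]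
  congr 2
  push_cast
  ring

theorem norm_slash_eq (r : ℝ) (f : ℍ → ℂ) (γ : SL(2, ℤ)) (z : ℍ) :
    ‖f (γ • z) / ((γ 1 0 : ℂ) * z + γ 1 1) ^ (r : ℂ)‖ =
      invNorm r f (γ • z) * z.im ^ (-(r / 2)) := by
  rw [norm_div, norm_cpow_real, invNorm, im_smul_int,
    div_sq_rpow_half z.im_pos.le (norm_nonneg _), Real.rpow_neg z.im_pos.le]
  have := (Real.rpow_pos_of_pos z.im_pos (r / 2)).ne'
  field_simp

section Invariance

variable {Γ : Subgroup SL(2, ℤ)} {r : ℝ} {f : ℍ → ℂ}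

theorem IsModularForm.invNorm_smul (hf : IsModularForm Γ r f) {γ : SL(2, ℤ)} (hγ : γ ∈ Γ)
    (z : ℍ) : invNorm r f (γ • z) = invNorm r f z := by
  obtain ⟨μ, hμ⟩ := hf.modular
  obtain ⟨h1, h2⟩ := hμ γ hγ
  have hd := norm_pos_iff.2 (denom_int_ne_zero γ z.im_pos)
  rw [invNorm, h2, im_smul_int, div_sq_rpow_half z.im_pos.le (norm_nonneg _), norm_mul, norm_mul,
    h1, norm_cpow_real, invNorm]
  have := (Real.rpow_pos_of_pos hd r).ne'
  change ‖(γ 1 0 : ℂ) * z + γ 1 1‖ ^ r ≠ 0 at this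
  field_simp

theorem IsModularForm.invNorm_mul_smul (hf : IsModularForm Γ r f) {δ : SL(2, ℤ)} (hδ : δ ∈ Γ)
    (γ : SL(2, ℤ)) (z : ℍ) : invNorm r f ((δ * γ) • z) = invNorm r f (γ • z) := by
  rw [mul_smul, hf.invNorm_smul hδ]

theorem IsModularForm.invNorm_conj_smul (hf : IsModularForm Γ r f) {γ τ : SL(2, ℤ)}
    (h : γ * τ * γ⁻¹ ∈ Γ ∨ -(γ * τ * γ⁻¹) ∈ Γ) (z : ℍ) :
    invNorm r f (γ • τ • z) = invNorm r f (γ • z) := by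
  have h1 : γ • τ • z = (γ * τ * γ⁻¹) • γ • z := by
    rw [smul_smul, smul_smul]; congr 1; group
  rw [h1]
  rcases h with h | h
  · rw [hf.invNorm_smul h]
  · rw [← ModularGroup.SL_neg_smul, hf.invNorm_smul h]

theorem exists_conj_T_pow_mem (Γ : Subgroup SL(2, ℤ)) [Γ.FiniteIndex] (γ : SL(2, ℤ)) :
    ∃ n : ℕ, 0 < n ∧ γ * ModularGroup.T ^ n * γ⁻¹ ∈ Γ := by
  obtain ⟨n, hn, -, h⟩ := Subgroup.exists_pow_mem_of_index_ne_zero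
    (Subgroup.FiniteIndex.index_ne_zero (H := Γ)) (γ * ModularGroup.T * γ⁻¹)
  exact ⟨n, hn, by rwa [conj_pow] at h⟩

theorem width_spec (Γ : Subgroup SL(2, ℤ)) [Γ.FiniteIndex] (γ : SL(2, ℤ)) :
    0 < width Γ γ ∧ (γ * ModularGroup.T ^ width Γ γ * γ⁻¹ ∈ Γ ∨
      -(γ * ModularGroup.T ^ width Γ γ * γ⁻¹) ∈ Γ) := by
  obtain ⟨n, hn, h⟩ := exists_conj_T_pow_mem Γ γ
  exact Nat.sInf_mem (s := {n : ℕ | 0 < n ∧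
    (γ * ModularGroup.T ^ n * γ⁻¹ ∈ Γ ∨ -(γ * ModularGroup.T ^ n * γ⁻¹) ∈ Γ)}) ⟨n, hn, Or.inl h⟩

/-- The growth hypothesis speaks only of points near the real axis. A matrix with non-zero lower
left entry carries high points there, and left multiplication by Γ does not change the invariant
modulus. If c = 0, a power of the unipotent conjugate ST^nS⁻¹ in Γ repairs this. -/
theorem exists_lower_left_ne_zero (Γ : Subgroup SL(2, ℤ)) [Γ.FiniteIndex] (γ : SL(2, ℤ)) :
    ∃ δ ∈ Γ, (δ * γ) 1 0 ≠ 0 := by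
  by_cases hc : γ 1 0 = 0
  · obtain ⟨n, hn, h⟩ := exists_conj_T_pow_mem Γ (ModularGroup.S)
    refine ⟨_, h, ?_⟩
    have h1 : γ 0 0 ≠ 0 := by
      intro h0
      have := γ.det_coe
      rw [Matrix.det_fin_two] at this
      simp [h0, hc] at this
    have hS : ((ModularGroup.S * ModularGroup.T ^ n * ModularGroup.S⁻¹ : SL(2, ℤ)) :
        Matrix (Fin 2) (Fin 2) ℤ) = !![1, 0; -(n : ℤ), 1] := by
      rw [← zpow_natCast]
      simp only [Matrix.SpecialLinearGroup.coe_mul, ModularGroup.coe_T_zpow,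
        Matrix.SpecialLinearGroup.coe_inv, ModularGroup.coe_S, Matrix.adjugate_fin_two_of]
      simp
    rw [Matrix.SpecialLinearGroup.coe_mul, hS, Matrix.mul_apply, Fin.sum_univ_two]
    simp [hc, h1, hn.ne']
  · exact ⟨1, Γ.one_mem, by simpa using hc⟩

/-- Polynomial growth of the invariant modulus at every cusp. -/
theorem IsModularForm.invNorm_growth [Γ.FiniteIndex] (hr : 0 < r) (hf : IsModularForm Γ r f)
    (γ : SL(2, ℤ)) : ∃ C K Y : ℝ, 0 < Y ∧ ∀ z : ℍ, Y ≤ z.im →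
      invNorm r f (γ • z) ≤ C * z.im ^ K := by
  obtain ⟨δ, hδ, hc⟩ := exists_lower_left_ne_zero Γ γ
  set σ := δ * γ with hσ
  obtain ⟨N, hN, hT⟩ := exists_conj_T_pow_mem Γ σ
  obtain ⟨C, K, ε, hε, hC⟩ := hf.growth
  have hN' : (0 : ℝ) < N := by exact_mod_cast hN
  set D : ℝ := |(σ 1 0 : ℝ)| * (N + 1) + |(σ 1 1 : ℝ)| with hD
  have hc1 : (1 : ℝ) ≤ |(σ 1 0 : ℝ)| := by exact_mod_cast Int.one_le_abs hc
  have hD1 : 1 ≤ D := by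
    have : (0 : ℝ) ≤ |(σ 1 1 : ℝ)| := abs_nonneg _
    nlinarith
  refine ⟨|C| * (D ^ 2) ^ |K|, |K|, max 1 (2 / ε), by positivity, fun z hz => ?_⟩
  rw [← hf.invNorm_mul_smul hδ γ z, ← hσ]
  have hy1 : 1 ≤ z.im := (le_max_left _ _).trans hz
  have hyε : 2 / ε ≤ z.im := (le_max_right _ _).trans hz
  -- reduce the real part
  set k : ℤ := -⌊z.re / N⌋
  set w : ℍ := ModularGroup.T ^ (N * k : ℤ) • z with hw
  have hper : invNorm r f (σ • w) = invNorm r f (σ • z) := by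
    refine hf.invNorm_conj_smul (Or.inl ?_) z
    have := Γ.zpow_mem hT k
    rwa [conj_zpow, ← zpow_natCast, ← zpow_mul] at this
  have hwim : w.im = z.im := ModularGroup.im_T_zpow_smul z _
  have hwre : |w.re| ≤ N := by
    have h1 : w.re = z.re + (N * k : ℤ) := ModularGroup.re_T_zpow_smul z _
    have h2 : w.re = N * Int.fract (z.re / N) := by
      rw [h1, Int.fract]
      push_cast [k]
      field_simp
      ring
    have h3 := Int.fract_nonneg (z.re / N)
    have h4 := (Int.fract_lt_one (z.re / N)).le
    rw [h2, abs_of_nonneg (by positivity)]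
    nlinarith
  rw [← hper, ← hwim]
  rw [← hwim] at hy1 hyε
  have hwpos := w.im_pos
  -- The denominator is comparable with the height: `w.im ≤ t ≤ D * w.im`, because |c| ≥ 1 and |Re
  -- w| ≤ N. So Im σw lies between 1/(D² Im w) and 1/Im w, and the threshold 2/ε puts it below ε,
  -- where the growth hypothesis applies.
  set t : ℝ := ‖(σ 1 0 : ℂ) * w + σ 1 1‖ with ht
  have ht1 : w.im ≤ t := by
    have h1 : |((σ 1 0 : ℂ) * w + σ 1 1).im| ≤ t := Complex.abs_im_le_norm _
    have h2 : ((σ 1 0 : ℂ) * w + σ 1 1).im = (σ 1 0 : ℝ) * w.im := by simp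
    rw [h2, abs_mul, abs_of_pos hwpos] at h1
    nlinarith
  have ht2 : t ≤ D * w.im := by
    have h1 : t ≤ |(σ 1 0 : ℝ)| * ‖(w : ℂ)‖ + |(σ 1 1 : ℝ)| := by
      refine (norm_add_le _ _).trans ?_
      rw [norm_mul, Complex.norm_intCast, Complex.norm_intCast]
    have h2 : ‖(w : ℂ)‖ ≤ N + w.im := by
      refine (Complex.norm_le_abs_re_add_abs_im _).trans ?_
      rw [UpperHalfPlane.coe_re, UpperHalfPlane.coe_im, abs_of_pos hwpos]
      linarith
    have h3 : (0 : ℝ) ≤ |(σ 1 1 : ℝ)| := abs_nonneg _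
    have h4 : N + w.im ≤ (N + 1) * w.im := by nlinarith
    calc t ≤ |(σ 1 0 : ℝ)| * ((N + 1) * w.im) + |(σ 1 1 : ℝ)| * w.im := by
          have := mul_le_mul_of_nonneg_left (h2.trans h4) (abs_nonneg (σ 1 0 : ℝ))
          nlinarith
      _ = D * w.im := by rw [hD]; ring
  have htpos : 0 < t := hwpos.trans_le ht1
  have him : (σ • w).im = w.im / t ^ 2 := im_smul_int σ w
  have him1 : w.im / t ^ 2 ≤ 1 / w.im := by
    rw [div_le_div_iff₀ (by positivity) hwpos]
    nlinarith
  have him2 : 1 / (D ^ 2 * w.im) ≤ w.im / t ^ 2 := by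
    rw [div_le_div_iff₀ (by positivity) (by positivity)]
    have := mul_self_le_mul_self htpos.le ht2
    nlinarith
  have him3 : 1 / w.im ≤ 1 := by rw [div_le_one hwpos]; exact hy1
  have hpos := (σ • w).im_pos
  have hlt : (σ • w).im < ε := by
    rw [him]
    refine him1.trans_lt ?_
    rw [div_lt_iff₀ hwpos]
    rw [div_le_iff₀ hε] at hyε
    linarith
  rw [invNorm]
  have h5 : (σ • w).im ^ (r / 2) ≤ 1 :=
    Real.rpow_le_one hpos.le (by rw [him]; linarith) (by positivity)
  have h6 : (σ • w).im ^ (-K) ≤ (D ^ 2) ^ |K| * w.im ^ |K| := by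
    calc (σ • w).im ^ (-K) ≤ (σ • w).im ^ (-|K|) :=
          Real.rpow_le_rpow_of_exponent_ge hpos (by rw [him]; linarith)
            (neg_le_neg (le_abs_self K))
      _ ≤ (1 / (D ^ 2 * w.im)) ^ (-|K|) :=
          Real.rpow_le_rpow_of_nonpos (by positivity) (by rw [him]; exact him2)
            (neg_nonpos.2 (abs_nonneg K))
      _ = (D ^ 2) ^ |K| * w.im ^ |K| := by
          rw [one_div, Real.inv_rpow (by positivity), Real.rpow_neg (by positivity), inv_inv,
            Real.mul_rpow (by positivity) hwpos.le]
  calc ‖f (σ • w)‖ * (σ • w).im ^ (r / 2) ≤ (C * (σ • w).im ^ (-K)) * 1 := by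
        refine mul_le_mul (hC _ hlt) h5 (by positivity) ?_
        exact (norm_nonneg _).trans (hC _ hlt)
    _ ≤ |C| * (σ • w).im ^ (-K) := by
        rw [mul_one]
        exact mul_le_mul_of_nonneg_right (le_abs_self C) (Real.rpow_nonneg hpos.le _)
    _ ≤ |C| * (D ^ 2) ^ |K| * w.im ^ |K| := by
        rw [mul_assoc]
        exact mul_le_mul_of_nonneg_left h6 (abs_nonneg C)

end Invariance

end FracModular

end

section

namespace FracModular

open Complex Filter
open UpperHalfPlane hiding I

/-! ### Expansions at the cusps -/

section

variable {H : ℍ → ℂ} (hH : MDifferentiable 𝓘(ℂ) 𝓘(ℂ) H) (hH0 : H ≠ 0)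
    (hper : ∀ z, ‖H ((1 : ℝ) +ᵥ z)‖ = ‖H z‖)
    (hgr : ∃ C K Y : ℝ, ∀ z : ℍ, Y ≤ z.im → ‖H z‖ ≤ C * z.im ^ K)

include hH hH0 hper hgr

theorem hasSum_fourier_ex (z : ℂ) (hz : 0 < z.im) :
    HasSum (fun n : ℕ => fourierCoef H n * ex (n + cuspParam H) z) (H (ofComplex z)) := by
  have h := hasSum_fourier hH hH0 hper hgr ⟨z, hz⟩
  rw [ofComplex_apply_of_im_pos hz]
  simpa [ex] using h

theorem exists_norm_le_of_im_ge {y₀ : ℝ} (hy₀ : 0 < y₀) :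
    ∃ C : ℝ, 0 ≤ C ∧ ∀ z : ℍ, y₀ ≤ z.im → ‖H z‖ ≤ C := by
  obtain ⟨C, hC0, hC⟩ := norm_le_of_hasSum_ex (l₀ := 0) (hasSum_fourier_ex hH hH0 hper hgr)
    (fun n _ => add_nonneg n.cast_nonneg (cuspParam_mem hH hH0 hper).1) hy₀
  refine ⟨C, hC0, fun z hz => ?_⟩
  have := hC z (by simpa using hz)
  simpa using this

/-- The frequencies with non-zero coefficient are at least κ, or at least 1 when the coefficient at
0 vanishes. The rate `l₀` does not depend on the height `y₀`. -/
theorem exists_norm_le_exp (h : 0 < cuspParam H ∨ fourierCoef H 0 = 0) :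
    ∃ l₀ : ℝ, 0 < l₀ ∧ ∀ y₀ : ℝ, 0 < y₀ → ∃ C : ℝ, 0 ≤ C ∧ ∀ z : ℍ, y₀ ≤ z.im →
      ‖H z‖ ≤ C * Real.exp (-(2 * Real.pi * l₀ * z.im)) := by
  have hκ := (cuspParam_mem hH hH0 hper).1
  obtain ⟨l₀, hl₀, hl⟩ : ∃ l₀ : ℝ, 0 < l₀ ∧ ∀ n : ℕ, fourierCoef H n ≠ 0 →
      l₀ ≤ n + cuspParam H := by
    rcases h with h | h
    · exact ⟨_, h, fun n _ => le_add_of_nonneg_left n.cast_nonneg⟩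
    · refine ⟨1, one_pos, fun n hn => ?_⟩
      have : n ≠ 0 := by rintro rfl; exact hn h
      have : (1 : ℝ) ≤ n := by exact_mod_cast Nat.one_le_iff_ne_zero.2 this
      linarith
  refine ⟨l₀, hl₀, fun y₀ hy₀ => ?_⟩
  obtain ⟨C, hC0, hC⟩ := norm_le_of_hasSum_ex (hasSum_fourier_ex hH hH0 hper hgr) hl hy₀
  refine ⟨C, hC0, fun z hz => ?_⟩
  have := hC z (by simpa using hz)
  simpa using this

/-- The expansion without its constant term. -/
theorem hasSum_fourier_sub_const (z : ℂ) (hz : 0 < z.im) :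
    HasSum (fun n : ℕ => (if 0 < (n : ℝ) + cuspParam H then fourierCoef H n else 0) *
      ex (n + cuspParam H) z)
      (H (ofComplex z) - if 0 < cuspParam H then 0 else fourierCoef H 0) := by
  have hκ := (cuspParam_mem hH hH0 hper).1
  have h := hasSum_fourier_ex hH hH0 hper hgr z hz
  have h0 := hasSum_ite_eq (0 : ℕ) (if 0 < cuspParam H then 0 else fourierCoef H 0)
  convert! h.sub h0 using 2 with n
  by_cases hn : n = 0
  · subst hn
    by_cases hk : 0 < cuspParam H
    · simp [hk]
    · have : cuspParam H = 0 := le_antisymm (not_lt.1 hk) hκ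
      simp [this, ex]
  · have : 0 < (n : ℝ) + cuspParam H := by
      have : (0 : ℝ) < n := by exact_mod_cast Nat.pos_of_ne_zero hn
      linarith
    simp [hn, this]

/-- Here κ = 0 and the constant term is non-zero. All other frequencies are at least 1, so the rest
of the expansion decays exponentially and eventually stays below half of the constant term. -/
theorem exists_le_norm (h : ¬ (0 < cuspParam H ∨ fourierCoef H 0 = 0)) :
    ∃ c Y : ℝ, 0 < c ∧ 0 < Y ∧ ∀ z : ℍ, Y ≤ z.im → c ≤ ‖H z‖ := by
  push Not at h
  have ha : 0 < ‖fourierCoef H 0‖ := norm_pos_iff.2 h.2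
  have hκ : cuspParam H = 0 := le_antisymm h.1 (cuspParam_mem hH hH0 hper).1
  obtain ⟨C, hC0, hC⟩ := norm_le_of_hasSum_ex (l₀ := 1) (hasSum_fourier_sub_const hH hH0 hper hgr)
    (fun n hn => by
      have : n ≠ 0 := by rintro rfl; simp [hκ] at hn
      have : (1 : ℝ) ≤ n := by exact_mod_cast Nat.one_le_iff_ne_zero.2 this
      linarith) one_pos
  have ht : Tendsto (fun y : ℝ => C * Real.exp (-(2 * Real.pi * 1) * y)) atTop (𝓝 (C * 0)) := by
    refine Tendsto.const_mul C (Real.tendsto_exp_atBot.comp ?_)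
    exact tendsto_id.const_mul_atTop_of_neg (by have := Real.pi_pos; linarith)
  rw [mul_zero] at ht
  obtain ⟨A, hA⟩ := eventually_atTop.1 (ht.eventually (eventually_le_nhds (half_pos ha)))
  refine ⟨‖fourierCoef H 0‖ / 2, max A 1, half_pos ha, by positivity, fun z hz => ?_⟩
  have h1 := hC z (by simpa using (le_max_right _ _).trans hz)
  have h2 := hA z.im ((le_max_left _ _).trans hz)
  simp only [hκ, lt_irrefl, if_false, ofComplex_apply] at h1
  rw [UpperHalfPlane.coe_im] at h1
  rw [neg_mul] at h2
  have h3 : ‖fourierCoef H 0‖ ≤ ‖H z‖ + ‖H z - fourierCoef H 0‖ := by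
    have := norm_sub_norm_le (fourierCoef H 0) (H z)
    rw [norm_sub_rev] at this
    linarith
  linarith

end

section Cusps

variable {Γ : Subgroup SL(2, ℤ)} {r : ℝ} {f : ℍ → ℂ}

/-- Multiplication of a point of the upper half-plane by a positive real number. -/
def scale (m : ℝ) (hm : 0 < m) (z : ℍ) : ℍ := ⟨m * z, by simpa using mul_pos hm z.im_pos⟩

theorem coe_scale (m : ℝ) (hm : 0 < m) (z : ℍ) : ((scale m hm z : ℍ) : ℂ) = m * z := rfl

theorem im_scale (m : ℝ) (hm : 0 < m) (z : ℍ) : (scale m hm z).im = m * z.im := by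
  rw [← UpperHalfPlane.coe_im, coe_scale]; simp

theorem ofComplex_natCast_mul {m : ℕ} (hm : (0 : ℝ) < m) (z : ℍ) :
    ofComplex ((m : ℂ) * z) = scale m hm z := by
  have : ((m : ℂ) * z) = ((scale m hm z : ℍ) : ℂ) := by rw [coe_scale]; simp
  rw [this, ofComplex_apply]

theorem scale_vadd {m : ℕ} (hm : (0 : ℝ) < m) (z : ℍ) :
    scale m hm ((1 : ℝ) +ᵥ z) = ModularGroup.T ^ m • scale m hm z := by
  ext
  rw [← zpow_natCast, ModularGroup.coe_T_zpow_smul_eq, coe_scale, coe_scale, coe_vadd]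
  push_cast
  ring

theorem scale_inv (m : ℝ) (hm : 0 < m) (z : ℍ) : scale m hm (scale m⁻¹ (inv_pos.2 hm) z) = z := by
  ext
  rw [coe_scale, coe_scale, ← mul_assoc]
  rw [← ofReal_mul, mul_inv_cancel₀ hm.ne']
  simp

theorem norm_scaledSlash (hm : (0 : ℝ) < width Γ γ) (z : ℍ) :
    ‖scaledSlash Γ r f γ z‖ = invNorm r f (γ • scale (width Γ γ) hm z) * z.im ^ (-(r / 2)) := by
  have h := norm_slash_eq r f γ (scale (width Γ γ) hm z)
  rw [coe_scale, im_scale, Real.mul_rpow hm.le z.im_pos.le] at h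
  rw [scaledSlash, ofComplex_natCast_mul hm, norm_mul, Complex.norm_real,
    Real.norm_of_nonneg (Real.rpow_nonneg hm.le _)]
  simp only [ofReal_natCast] at h
  rw [h, Real.rpow_neg hm.le]
  have := (Real.rpow_pos_of_pos hm (r / 2)).ne'
  field_simp

theorem norm_dilate (hm : (0 : ℝ) < width Γ 1) (z : ℍ) :
    ‖dilate Γ f z‖ = invNorm r f ((1 : SL(2, ℤ)) • scale (width Γ 1) hm z) *
      (width Γ 1 * z.im) ^ (-(r / 2)) := by
  rw [dilate, ofComplex_natCast_mul hm, norm_eq_invNorm r, im_scale, one_smul]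

theorem mdifferentiable_scaledSlash (hm : (0 : ℝ) < width Γ γ)
    (hf : MDifferentiable 𝓘(ℂ) 𝓘(ℂ) f) : MDifferentiable 𝓘(ℂ) 𝓘(ℂ) (scaledSlash Γ r f γ) := by
  rw [UpperHalfPlane.mdifferentiable_iff]
  have hD := differentiableOn_comp_ofComplex hf
  set m := width Γ γ with hmdef
  have him : ∀ z : ℂ, 0 < z.im → 0 < ((m : ℂ) * z).im := by
    intro z hz; simpa using mul_pos hm hz
  have hne : ∀ z : ℂ, 0 < z.im → (γ 1 0 : ℂ) * ((m : ℂ) * z) + γ 1 1 ≠ 0 :=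
    fun z hz => denom_int_ne_zero γ (him z hz)
  have hmob : ∀ z : ℂ, ∀ hz : 0 < z.im, ((γ • (⟨m * z, him z hz⟩ : ℍ) : ℍ) : ℂ) =
      ((γ 0 0 : ℂ) * ((m : ℂ) * z) + γ 0 1) / ((γ 1 0 : ℂ) * ((m : ℂ) * z) + γ 1 1) :=
    fun z hz => coe_smul_int γ _
  refine DifferentiableOn.congr (f := fun z => ((((m : ℝ) ^ (r / 2) : ℝ)) : ℂ) *
    ((f ∘ ofComplex) (((γ 0 0 : ℂ) * ((m : ℂ) * z) + γ 0 1) /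
      ((γ 1 0 : ℂ) * ((m : ℂ) * z) + γ 1 1)) /
      ((γ 1 0 : ℂ) * ((m : ℂ) * z) + γ 1 1) ^ (r : ℂ))) ?_ ?_
  · refine (DifferentiableOn.div ?_ ?_ ?_).const_mul _
    · refine hD.comp ?_ ?_
      · intro z hz
        exact DifferentiableAt.differentiableWithinAt
          (DifferentiableAt.div (by fun_prop) (by fun_prop) (hne z hz))
      · intro z hz
        have h := UpperHalfPlane.im_pos (γ • (⟨m * z, him z hz⟩ : ℍ))
        rw [← UpperHalfPlane.coe_im, hmob z hz] at h
        exact h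
    -- For c = 0 the base of the power is a constant, possibly on the branch cut. For c ≠ 0 its
    -- imaginary part never vanishes, so it avoids the cut.
    · by_cases hc : γ 1 0 = 0
      · simp only [hc, Int.cast_zero, zero_mul, zero_add]
        exact differentiableOn_const _
      · intro z hz
        refine (DifferentiableAt.cpow_const (by fun_prop) ?_).differentiableWithinAt
        refine Or.inr ?_
        have h1 := (mul_pos hm hz).ne'
        have h2 : (γ 1 0 : ℝ) ≠ 0 := by exact_mod_cast hc
        simpa [hm.ne', (show z.im ≠ 0 from (show 0 < z.im from hz).ne')] using hc
    · intro z hz h0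
      have := (cpow_eq_zero_iff _ _).1 h0
      exact hne z hz this.1
  · intro z hz
    have h1 : ofComplex ((m : ℂ) * z) = ⟨m * z, him z hz⟩ := ofComplex_apply_of_im_pos (him z hz)
    simp only [Function.comp, scaledSlash, ofComplex_apply_of_im_pos hz, ← hmdef, h1]
    rw [← hmob z hz, ofComplex_apply]

theorem mdifferentiable_dilate (hm : (0 : ℝ) < width Γ 1)
    (hf : MDifferentiable 𝓘(ℂ) 𝓘(ℂ) f) : MDifferentiable 𝓘(ℂ) 𝓘(ℂ) (dilate Γ f) := by
  rw [UpperHalfPlane.mdifferentiable_iff]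
  have hD := differentiableOn_comp_ofComplex hf
  set m := width Γ 1 with hmdef
  have him : ∀ z : ℂ, 0 < z.im → 0 < ((m : ℂ) * z).im := by
    intro z hz; simpa using mul_pos hm hz
  refine (hD.comp (f := fun z : ℂ => (m : ℂ) * z) (by fun_prop) him).congr fun z hz => ?_
  simp [Function.comp, dilate, ofComplex_apply_of_im_pos hz, hmdef]

/-- A function whose modulus is the invariant modulus of `f` at the cusp `γ(∞)`, up to a power of
the height and a constant. -/
structure IsCuspLift (Γ : Subgroup SL(2, ℤ)) (r : ℝ) (f : ℍ → ℂ) (γ : SL(2, ℤ)) (H : ℍ → ℂ) :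
    Prop where
  pos : (0 : ℝ) < width Γ γ
  holo : MDifferentiable 𝓘(ℂ) 𝓘(ℂ) H
  norm_eq : ∃ b : ℝ, 0 < b ∧ ∀ z : ℍ,
    ‖H z‖ = b * (invNorm r f (γ • scale (width Γ γ) pos z) * z.im ^ (-(r / 2)))

variable [Γ.FiniteIndex] (hr : 0 < r) (hf : IsModularForm Γ r f) (hf0 : f ≠ 0)

include hf in
theorem isCuspLift_scaledSlash (γ : SL(2, ℤ)) : IsCuspLift Γ r f γ (scaledSlash Γ r f γ) where
  pos := by exact_mod_cast (width_spec Γ γ).1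
  holo := mdifferentiable_scaledSlash (by exact_mod_cast (width_spec Γ γ).1) hf.holo
  norm_eq := ⟨1, one_pos, fun z => by rw [norm_scaledSlash, one_mul]⟩

-- The series of f_α uses f(mz) without the factor m^{r/2}. `IsCuspLift` allows a positive constant,
-- so one treatment of expansions serves both normalizations.
include hf in
theorem isCuspLift_dilate : IsCuspLift Γ r f 1 (dilate Γ f) where
  pos := by exact_mod_cast (width_spec Γ 1).1
  holo := mdifferentiable_dilate (by exact_mod_cast (width_spec Γ 1).1) hf.holo
  norm_eq := by
    have hm : (0 : ℝ) < width Γ 1 := by exact_mod_cast (width_spec Γ 1).1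
    refine ⟨(width Γ 1 : ℝ) ^ (-(r / 2)), by positivity, fun z => ?_⟩
    rw [norm_dilate (r := r) hm, Real.mul_rpow hm.le z.im_pos.le]
    ring

section

variable {γ : SL(2, ℤ)} {H : ℍ → ℂ} (hL : IsCuspLift Γ r f γ H)

include hL

omit [Γ.FiniteIndex] in
include hf0 in
theorem IsCuspLift.ne_zero : H ≠ 0 := by
  obtain ⟨b, hb, h⟩ := hL.norm_eq
  obtain ⟨z₀, hz₀⟩ := Function.ne_iff.1 hf0
  intro h0
  have h1 := h (scale _ (inv_pos.2 hL.pos) (γ⁻¹ • z₀))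
  rw [congrFun h0, scale_inv, smul_inv_smul, invNorm] at h1
  have h2 : 0 < ‖f z₀‖ := norm_pos_iff.2 hz₀
  have h3 := z₀.im_pos
  have h4 := (scale _ (inv_pos.2 hL.pos) (γ⁻¹ • z₀)).im_pos
  have : 0 < b * (‖f z₀‖ * z₀.im ^ (r / 2) *
    (scale _ (inv_pos.2 hL.pos) (γ⁻¹ • z₀)).im ^ (-(r / 2))) := by positivity
  rw [← h1] at this
  simp at this

include hf in
theorem IsCuspLift.norm_vadd (z : ℍ) : ‖H ((1 : ℝ) +ᵥ z)‖ = ‖H z‖ := by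
  obtain ⟨b, hb, h⟩ := hL.norm_eq
  rw [h, h, scale_vadd, hf.invNorm_conj_smul (width_spec Γ γ).2]
  simp

include hr hf in
theorem IsCuspLift.growth : ∃ C K Y : ℝ, ∀ z : ℍ, Y ≤ z.im → ‖H z‖ ≤ C * z.im ^ K := by
  obtain ⟨b, hb, h⟩ := hL.norm_eq
  obtain ⟨C, K, Y, hY, hC⟩ := hf.invNorm_growth hr γ
  have hm := hL.pos
  refine ⟨b * C * (width Γ γ : ℝ) ^ K, K + -(r / 2), Y / width Γ γ, fun z hz => ?_⟩
  have h1 := hC (scale _ hm z) (by rw [im_scale]; rwa [div_le_iff₀' hm] at hz)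
  rw [im_scale, Real.mul_rpow hm.le z.im_pos.le] at h1
  rw [h, Real.rpow_add z.im_pos]
  have h2 : 0 ≤ z.im ^ (-(r / 2)) := Real.rpow_nonneg z.im_pos.le _
  calc b * (invNorm r f (γ • scale _ hm z) * z.im ^ (-(r / 2)))
      ≤ b * (C * ((width Γ γ : ℝ) ^ K * z.im ^ K) * z.im ^ (-(r / 2))) := by gcongr
    _ = _ := by ring

omit [Γ.FiniteIndex] in
theorem IsCuspLift.invNorm_eq : ∃ b : ℝ, 0 < b ∧ ∀ w : ℍ,
    invNorm r f (γ • w) = b * ‖H (scale _ (inv_pos.2 hL.pos) w)‖ * w.im ^ (r / 2) := by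
  obtain ⟨b, hb, h⟩ := hL.norm_eq
  have hm := hL.pos
  refine ⟨b⁻¹ * ((width Γ γ : ℝ)⁻¹) ^ (r / 2), by positivity, fun w => ?_⟩
  rw [h, scale_inv, im_scale, Real.mul_rpow (by positivity) w.im_pos.le,
    Real.rpow_neg (by positivity), Real.rpow_neg w.im_pos.le]
  have h1 := (Real.rpow_pos_of_pos w.im_pos (r / 2)).ne'
  have h2 := (Real.rpow_pos_of_pos (inv_pos.2 hm) (r / 2)).ne'
  field_simp

end

/-- The invariant modulus has maximal growth at the cusp `γ(∞)`. -/
def GrowsAt (r : ℝ) (f : ℍ → ℂ) (γ : SL(2, ℤ)) : Prop :=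
  ∃ c Y : ℝ, 0 < c ∧ 0 < Y ∧ ∀ w : ℍ, Y ≤ w.im → c * w.im ^ (r / 2) ≤ invNorm r f (γ • w)

include hr hf hf0

theorem growsAt_of_not_cuspidal {γ : SL(2, ℤ)}
    (h : ¬ (0 < cuspParam (scaledSlash Γ r f γ) ∨ fourierCoef (scaledSlash Γ r f γ) 0 = 0)) :
    GrowsAt r f γ := by
  have hL := isCuspLift_scaledSlash hf γ
  obtain ⟨c, Y, hc, hY, h⟩ := exists_le_norm hL.holo (hL.ne_zero hf0) (hL.norm_vadd hf)
    (hL.growth hr hf) h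
  obtain ⟨b, hb, hb'⟩ := hL.invNorm_eq
  have hm := hL.pos
  refine ⟨b * c, Y * width Γ γ, by positivity, by positivity, fun w hw => ?_⟩
  rw [hb']
  have h1 := h (scale _ (inv_pos.2 hL.pos) w) (by
    rw [im_scale, ← div_eq_inv_mul, le_div_iff₀ hm]; exact hw)
  have h2 : 0 ≤ w.im ^ (r / 2) := Real.rpow_nonneg w.im_pos.le _
  gcongr

theorem exists_invNorm_le_rpow (γ : SL(2, ℤ)) :
    ∃ C : ℝ, ∀ w : ℍ, 1 / 2 ≤ w.im → invNorm r f (γ • w) ≤ C * w.im ^ (r / 2) := by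
  have hL := isCuspLift_scaledSlash hf γ
  have hm := hL.pos
  obtain ⟨C, hC, h⟩ := exists_norm_le_of_im_ge hL.holo (hL.ne_zero hf0) (hL.norm_vadd hf)
    (hL.growth hr hf) (y₀ := 1 / 2 / width Γ γ) (by positivity)
  obtain ⟨b, hb, hb'⟩ := hL.invNorm_eq
  refine ⟨b * C, fun w hw => ?_⟩
  rw [hb']
  have h1 := h (scale _ (inv_pos.2 hL.pos) w) (by
    rw [im_scale, ← div_eq_inv_mul]; gcongr)
  have h2 : 0 ≤ w.im ^ (r / 2) := Real.rpow_nonneg w.im_pos.le _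
  gcongr

/-- The exponential decay of the expansion absorbs the factor (Im w)^{r/2}. -/
theorem exists_invNorm_le_of_cuspidal {γ : SL(2, ℤ)}
    (h : 0 < cuspParam (scaledSlash Γ r f γ) ∨ fourierCoef (scaledSlash Γ r f γ) 0 = 0) :
    ∃ C : ℝ, ∀ w : ℍ, 1 / 2 ≤ w.im → invNorm r f (γ • w) ≤ C := by
  have hL := isCuspLift_scaledSlash hf γ
  have hm := hL.pos
  obtain ⟨l₀, hl₀, hl⟩ := exists_norm_le_exp hL.holo (hL.ne_zero hf0) (hL.norm_vadd hf)
    (hL.growth hr hf) h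
  obtain ⟨C, hC, h⟩ := hl (1 / 2 / width Γ γ) (by positivity)
  obtain ⟨b, hb, hb'⟩ := hL.invNorm_eq
  have hpi := Real.pi_pos
  set a : ℝ := 2 * Real.pi * l₀ * (width Γ γ : ℝ)⁻¹ with ha
  obtain ⟨A, hA⟩ := eventually_atTop.1 ((tendsto_rpow_mul_exp_neg_mul_atTop_nhds_zero (r / 2) a
    (by positivity)).eventually (eventually_le_nhds one_pos))
  refine ⟨b * C * max 1 (A ^ (r / 2)), fun w hw => ?_⟩
  rw [hb']
  have h1 := h (scale _ (inv_pos.2 hL.pos) w) (by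
    rw [im_scale, ← div_eq_inv_mul]; gcongr)
  have h2 : 0 ≤ w.im ^ (r / 2) := Real.rpow_nonneg w.im_pos.le _
  have h3 : 2 * Real.pi * l₀ * (scale _ (inv_pos.2 hL.pos) w).im = a * w.im := by
    rw [im_scale, ha]; ring
  rw [h3] at h1
  have h4 : w.im ^ (r / 2) * Real.exp (-(a * w.im)) ≤ max 1 (A ^ (r / 2)) := by
    rcases le_total A w.im with hw' | hw'
    · have := hA _ hw'
      rw [neg_mul] at this
      exact this.trans (le_max_left _ _)
    · refine le_trans ?_ (le_max_right _ _)
      have h5 : Real.exp (-(a * w.im)) ≤ 1 := by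
        rw [Real.exp_le_one_iff]
        have := w.im_pos
        have : 0 < a * w.im := by positivity
        linarith
      calc w.im ^ (r / 2) * Real.exp (-(a * w.im)) ≤ w.im ^ (r / 2) * 1 := by gcongr
        _ ≤ A ^ (r / 2) := by
          rw [mul_one]
          exact Real.rpow_le_rpow w.im_pos.le hw' (by positivity)
  calc b * ‖scaledSlash Γ r f γ (scale _ (inv_pos.2 hL.pos) w)‖ * w.im ^ (r / 2)
      ≤ b * (C * Real.exp (-(a * w.im))) * w.im ^ (r / 2) := by gcongr
    _ = b * C * (w.im ^ (r / 2) * Real.exp (-(a * w.im))) := by ring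
    _ ≤ _ := by gcongr

/-- At a cuspidal cusp the invariant modulus stays bounded, which excludes growth like y^{r/2} along
the imaginary axis. Cuspidality is thereby read off from `invNorm` alone, and becomes visibly
invariant under Γ. -/
theorem growsAt_iff {γ : SL(2, ℤ)} : GrowsAt r f γ ↔
    ¬ (0 < cuspParam (scaledSlash Γ r f γ) ∨ fourierCoef (scaledSlash Γ r f γ) 0 = 0) := by
  refine ⟨fun ⟨c, Y, hc, hY, h⟩ hcusp => ?_, growsAt_of_not_cuspidal hr hf hf0⟩
  obtain ⟨C, hC⟩ := exists_invNorm_le_of_cuspidal hr hf hf0 hcusp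
  have ht : Tendsto (fun y : ℝ => c * y ^ (r / 2)) atTop atTop :=
    (tendsto_rpow_atTop (by positivity)).const_mul_atTop hc
  obtain ⟨y, hy1, hy2, hy3⟩ := ((ht.eventually (eventually_gt_atTop C)).and
    ((eventually_ge_atTop Y).and (eventually_ge_atTop (1 / 2 : ℝ)))).exists
  have hy0 : 0 < y := by linarith
  let w : ℍ := ⟨y * I, by simpa using hy0⟩
  have hw : w.im = y := by rw [← UpperHalfPlane.coe_im]; simp [w]
  have h1 := h w (by rw [hw]; exact hy2)
  have h2 := hC w (by rw [hw]; exact hy3)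
  rw [hw] at h1
  linarith

end Cusps

end FracModular

end

section

namespace FracModular

open Complex Filter
open UpperHalfPlane hiding I

/-! ### Bounds for the modular form that are uniform over the cusps -/

theorem exists_finset_coset_reps (Γ : Subgroup SL(2, ℤ)) [Γ.FiniteIndex] :
    ∃ S : Finset SL(2, ℤ), ∀ γ, ∃ δ ∈ Γ, ∃ σ ∈ S, γ = δ * σ := by
  classical
  have : Fintype (SL(2, ℤ) ⧸ Γ) := Fintype.ofFinite _
  refine ⟨Finset.univ.image fun q : SL(2, ℤ) ⧸ Γ => (Quotient.out q)⁻¹, fun γ => ?_⟩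
  set q : SL(2, ℤ) ⧸ Γ := QuotientGroup.mk γ⁻¹ with hq
  refine ⟨γ * Quotient.out q, ?_, (Quotient.out q)⁻¹,
    Finset.mem_image_of_mem _ (Finset.mem_univ _), by group⟩
  have h1 : (QuotientGroup.mk (Quotient.out q) : SL(2, ℤ) ⧸ Γ) = QuotientGroup.mk γ⁻¹ := by
    rw [← hq]; exact Quotient.out_eq' q
  have h2 := QuotientGroup.eq.1 h1.symm
  simpa using h2

/-- There are finitely many cosets Γγ. A property that is monotone in the constant and invariant
under Γ from the left needs a constant only on representatives, and one above their sum serves for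
all. -/
theorem exists_uniform_bound (Γ : Subgroup SL(2, ℤ)) [Γ.FiniteIndex] {B : SL(2, ℤ) → ℝ → Prop}
    (hmono : ∀ γ C C', B γ C → C ≤ C' → B γ C') (hinv : ∀ δ ∈ Γ, ∀ γ C, B γ C → B (δ * γ) C)
    (h : ∀ γ, ∃ C, B γ C) : ∃ C, 1 ≤ C ∧ ∀ γ, B γ C := by
  obtain ⟨S, hS⟩ := exists_finset_coset_reps Γ
  choose C hC using h
  refine ⟨1 + ∑ σ ∈ S, |C σ|, by
    have : 0 ≤ ∑ σ ∈ S, |C σ| := Finset.sum_nonneg fun _ _ => abs_nonneg _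
    linarith, fun γ => ?_⟩
  obtain ⟨δ, hδ, σ, hσ, rfl⟩ := hS γ
  refine hinv δ hδ σ _ (hmono σ _ _ (hC σ) ?_)
  have := Finset.single_le_sum (f := fun σ => |C σ|) (fun _ _ => abs_nonneg _) hσ
  have := le_abs_self (C σ)
  linarith

/-- By reduction theory every SL₂(ℤ)-orbit reaches height 1/2. This is why the bounds at the cusps
are stated from height 1/2 on: together they cover the whole half-plane. -/
theorem exists_eq_smul_im_ge (z : ℍ) : ∃ (γ : SL(2, ℤ)) (w : ℍ), z = γ • w ∧ 1 / 2 ≤ w.im := by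
  obtain ⟨γ, h⟩ := ModularGroup.exists_one_half_le_im_smul z
  exact ⟨γ⁻¹, γ • z, (inv_smul_smul γ z).symm, h⟩

/-- The height of a point seen from the cusp `γ(∞)`. -/
theorem im_mul_norm_sq (γ : SL(2, ℤ)) (w : ℍ) :
    w.im * ‖(γ 1 0 : ℂ) * (γ • w : ℍ) - γ 0 0‖ ^ 2 = (γ • w).im := by
  have h := im_smul_int γ⁻¹ (γ • w)
  rw [inv_smul_smul] at h
  have h1 : ((γ⁻¹ : SL(2, ℤ)) 1 0 : ℤ) = -γ 1 0 := by
    rw [Matrix.SpecialLinearGroup.coe_inv, Matrix.adjugate_fin_two]; rfl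
  have h2 : ((γ⁻¹ : SL(2, ℤ)) 1 1 : ℤ) = γ 0 0 := by
    rw [Matrix.SpecialLinearGroup.coe_inv, Matrix.adjugate_fin_two]; rfl
  have hne := denom_int_ne_zero γ⁻¹ (γ • w).im_pos
  rw [h1, h2] at h hne
  have h3 : ‖(γ 1 0 : ℂ) * (γ • w : ℍ) - γ 0 0‖ =
      ‖((-γ 1 0 : ℤ) : ℂ) * (γ • w : ℍ) + γ 0 0‖ := by
    rw [← norm_neg]; congr 1; push_cast; ring
  rw [h3, h]
  have h4 := norm_ne_zero_iff.2 hne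
  change ‖((-γ 1 0 : ℤ) : ℂ) * (γ • w : ℍ) + γ 0 0‖ ≠ 0 at h4
  rw [div_mul_cancel₀ _ (pow_ne_zero 2 h4)]

theorem im_mul_sq_of_lower_left_eq_zero {γ : SL(2, ℤ)} (hc : γ 1 0 = 0) (w : ℍ) :
    (γ • w).im = w.im := by
  have h1 := γ.det_coe
  rw [Matrix.det_fin_two, hc, mul_zero, sub_zero] at h1
  have h2 : ‖(γ 0 0 : ℂ)‖ = 1 := by
    have := Int.isUnit_iff.1 (IsUnit.of_mul_eq_one _ h1)
    rcases this with h | h <;> simp [h]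
  rw [← im_mul_norm_sq, hc, Int.cast_zero, zero_mul, zero_sub, norm_neg, h2, one_pow, mul_one]

theorem norm_lower_left_mul_sub {γ : SL(2, ℤ)} (hc : γ 1 0 ≠ 0) (z : ℂ) :
    ‖(γ 1 0 : ℂ) * z - γ 0 0‖ = |(γ 1 0 : ℝ)| * ‖z - ((γ 0 0 : ℝ) / (γ 1 0 : ℝ) : ℝ)‖ := by
  have hc' : (γ 1 0 : ℂ) ≠ 0 := by exact_mod_cast hc
  rw [← Complex.norm_intCast, ← norm_mul, mul_sub]
  congr 2
  push_cast
  field_simp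

section

variable {Γ : Subgroup SL(2, ℤ)} {r : ℝ} {f : ℍ → ℂ}

theorem IsModularForm.growsAt_mul (hf : IsModularForm Γ r f) {δ : SL(2, ℤ)} (hδ : δ ∈ Γ)
    (γ : SL(2, ℤ)) : GrowsAt r f (δ * γ) ↔ GrowsAt r f γ := by
  simp only [GrowsAt, hf.invNorm_mul_smul hδ γ]

variable [Γ.FiniteIndex] (hr : 0 < r) (hf : IsModularForm Γ r f) (hf0 : f ≠ 0)

include hr hf hf0

theorem exists_uniform_upper : ∃ C, 1 ≤ C ∧ ∀ (γ : SL(2, ℤ)) (w : ℍ), 1 / 2 ≤ w.im →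
    invNorm r f (γ • w) ≤ C * w.im ^ (r / 2) := by
  refine exists_uniform_bound Γ (B := fun γ C => ∀ w : ℍ, 1 / 2 ≤ w.im →
    invNorm r f (γ • w) ≤ C * w.im ^ (r / 2)) ?_ ?_ (exists_invNorm_le_rpow hr hf hf0)
  · intro γ C C' h hC w hw
    exact (h w hw).trans (mul_le_mul_of_nonneg_right hC (Real.rpow_nonneg w.im_pos.le _))
  · intro δ hδ γ C h w hw
    rw [hf.invNorm_mul_smul hδ]
    exact h w hw

theorem exists_uniform_upper_of_not_growsAt : ∃ C, 1 ≤ C ∧ ∀ γ : SL(2, ℤ), ¬ GrowsAt r f γ →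
    ∀ w : ℍ, 1 / 2 ≤ w.im → invNorm r f (γ • w) ≤ C := by
  refine exists_uniform_bound Γ (B := fun γ C => ¬ GrowsAt r f γ → ∀ w : ℍ, 1 / 2 ≤ w.im →
    invNorm r f (γ • w) ≤ C) ?_ ?_ ?_
  · intro γ C C' h hC hγ w hw
    exact (h hγ w hw).trans hC
  · intro δ hδ γ C h hγ w hw
    rw [hf.invNorm_mul_smul hδ]
    rw [hf.growsAt_mul hδ] at hγ
    exact h hγ w hw
  · intro γ
    by_cases hγ : GrowsAt r f γ
    · exact ⟨0, fun h => absurd hγ h⟩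
    · rw [growsAt_iff hr hf hf0, not_not] at hγ
      obtain ⟨C, hC⟩ := exists_invNorm_le_of_cuspidal hr hf hf0 hγ
      exact ⟨C, fun _ => hC⟩

-- One constant plays two roles, the height from which the bound holds and the factor in it, so that
-- the uniformity over the cosets can be applied to a single number.
omit hr hf0 in
theorem exists_uniform_lower : ∃ C, 1 ≤ C ∧ ∀ γ : SL(2, ℤ), GrowsAt r f γ →
    ∀ w : ℍ, C ≤ w.im → w.im ^ (r / 2) ≤ C * invNorm r f (γ • w) := by
  refine exists_uniform_bound Γ (B := fun γ C => GrowsAt r f γ →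
    ∀ w : ℍ, C ≤ w.im → w.im ^ (r / 2) ≤ C * invNorm r f (γ • w)) ?_ ?_ ?_
  · intro γ C C' h hC hγ w hw
    exact (h hγ w (hC.trans hw)).trans (mul_le_mul_of_nonneg_right hC (invNorm_nonneg _ _ _))
  · intro δ hδ γ C h hγ w hw
    rw [hf.invNorm_mul_smul hδ]
    rw [hf.growsAt_mul hδ] at hγ
    exact h hγ w hw
  · intro γ
    by_cases hγ : GrowsAt r f γ
    · obtain ⟨c, Y, hc, hY, h⟩ := id hγ
      refine ⟨max Y c⁻¹, fun _ w hw => ?_⟩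
      have h1 := h w ((le_max_left _ _).trans hw)
      calc w.im ^ (r / 2) = c⁻¹ * (c * w.im ^ (r / 2)) := by field_simp
        _ ≤ c⁻¹ * invNorm r f (γ • w) := by gcongr
        _ ≤ _ := mul_le_mul_of_nonneg_right (le_max_right _ _) (invNorm_nonneg _ _ _)
    · exact ⟨0, fun h => absurd h hγ⟩

/-- With z = γw one has Im w = y/|cz-a|², which is at most 1/y: for c ≠ 0 because |cz-a| ≥ |c|y ≥ y,
for c = 0 because Im w = y ≤ 1. So the invariant modulus is O(y^{-r/2}), and passing to |f| costs
another y^{-r/2}. -/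
theorem exists_norm_le_im_rpow_neg : ∃ C, 1 ≤ C ∧ ∀ z : ℍ, z.im ≤ 1 →
    ‖f z‖ ≤ C * z.im ^ (-r) := by
  obtain ⟨C, hC1, hC⟩ := exists_uniform_upper hr hf hf0
  refine ⟨C, hC1, fun z hz => ?_⟩
  obtain ⟨γ, w, rfl, hw⟩ := exists_eq_smul_im_ge z
  set z := γ • w with hzdef
  have hzpos := z.im_pos
  have hwpos := w.im_pos
  have h1 : w.im ≤ z.im⁻¹ := by
    by_cases hc : γ 1 0 = 0
    · rw [← im_mul_sq_of_lower_left_eq_zero hc w, ← hzdef]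
      exact hz.trans ((one_le_inv₀ hzpos).2 hz)
    · have h2 := im_mul_norm_sq γ w
      have h3 : z.im ≤ ‖(γ 1 0 : ℂ) * z - γ 0 0‖ := by
        have h4 : |((γ 1 0 : ℂ) * z - γ 0 0).im| ≤ _ := Complex.abs_im_le_norm _
        have h5 : ((γ 1 0 : ℂ) * z - γ 0 0).im = (γ 1 0 : ℝ) * z.im := by simp
        have h6 : (1 : ℝ) ≤ |(γ 1 0 : ℝ)| := by exact_mod_cast Int.one_le_abs hc
        rw [h5, abs_mul, abs_of_pos hzpos] at h4
        nlinarith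
      have h7 : w.im * z.im ^ 2 ≤ z.im := by
        rw [← hzdef] at h2
        calc w.im * z.im ^ 2 ≤ w.im * ‖(γ 1 0 : ℂ) * z - γ 0 0‖ ^ 2 := by gcongr
          _ = z.im := h2
      rw [le_inv_comm₀ hwpos hzpos, le_inv_comm₀ hzpos hwpos, inv_eq_one_div,
        le_div_iff₀ hzpos]
      nlinarith
  rw [norm_eq_invNorm r]
  have h2 : w.im ^ (r / 2) ≤ z.im ^ (-(r / 2)) := by
    rw [Real.rpow_neg hzpos.le, ← Real.inv_rpow hzpos.le]
    exact Real.rpow_le_rpow hwpos.le h1 (by positivity)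
  calc invNorm r f z * z.im ^ (-(r / 2))
      ≤ (C * w.im ^ (r / 2)) * z.im ^ (-(r / 2)) :=
        mul_le_mul_of_nonneg_right (hC γ w hw) (Real.rpow_nonneg hzpos.le _)
    _ ≤ (C * z.im ^ (-(r / 2))) * z.im ^ (-(r / 2)) := by gcongr
    _ = C * z.im ^ (-r) := by
      rw [mul_assoc, ← Real.rpow_add hzpos]; congr 2; ring

/-- Hecke's bound: for a cusp form the invariant modulus is bounded on the whole half-plane. -/
theorem exists_norm_le_of_forall_not_growsAt (h : ∀ γ, ¬ GrowsAt r f γ) : ∃ C, 1 ≤ C ∧ ∀ z : ℍ,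
    ‖f z‖ ≤ C * z.im ^ (-(r / 2)) := by
  obtain ⟨C, hC1, hC⟩ := exists_uniform_upper_of_not_growsAt hr hf hf0
  refine ⟨C, hC1, fun z => ?_⟩
  obtain ⟨γ, w, rfl, hw⟩ := exists_eq_smul_im_ge z
  rw [norm_eq_invNorm r]
  exact mul_le_mul_of_nonneg_right (hC γ (h γ) w hw) (Real.rpow_nonneg (γ • w).im_pos.le _)

theorem not_isCuspidalAt_iff (q : ℚ) : ¬ IsCuspidalAt Γ r f (q : OnePoint ℚ) ↔
    ∃ γ : SL(2, ℤ), γ 1 0 ≠ 0 ∧ (γ 0 0 : ℚ) / (γ 1 0 : ℚ) = q ∧ GrowsAt r f γ := by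
  have key : ∀ γ : SL(2, ℤ), Matrix.SpecialLinearGroup.mapGL ℚ γ • (OnePoint.infty : OnePoint ℚ)
      = (q : OnePoint ℚ) ↔ γ 1 0 ≠ 0 ∧ (γ 0 0 : ℚ) / (γ 1 0 : ℚ) = q := by
    intro γ
    rw [OnePoint.smul_infty_eq_ite]
    by_cases hc : γ 1 0 = 0
    · simp [hc]
    · simp [hc]
  simp only [IsCuspidalAt, not_forall, growsAt_iff hr hf hf0, key]
  simp only [exists_prop, and_assoc]

theorem not_isCuspForm_iff : ¬ IsCuspForm Γ r f ↔ ∃ γ, GrowsAt r f γ := by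
  simp only [IsCuspForm, IsCuspidalAt, not_forall, growsAt_iff hr hf hf0]
  constructor
  · rintro ⟨-, γ, -, h⟩
    exact ⟨γ, h⟩
  · rintro ⟨γ, h⟩
    exact ⟨_, γ, rfl, h⟩

omit hr hf hf0 [Γ.FiniteIndex] in
theorem den_eq_abs_lower_left {γ : SL(2, ℤ)} (hc : γ 1 0 ≠ 0) {q : ℚ}
    (h : (γ 0 0 : ℚ) / (γ 1 0 : ℚ) = q) : (q.den : ℝ) = |(γ 1 0 : ℝ)| := by
  have hcop : IsCoprime (γ 0 0) (γ 1 0) := by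
    have h1 := γ.det_coe
    rw [Matrix.det_fin_two] at h1
    exact ⟨γ 1 1, -γ 0 1, by linarith⟩
  have h2 := Rat.den_div_eq_of_coprime (a := (γ 1 0).sign * γ 0 0) (b := |γ 1 0|)
    (abs_pos.2 hc) (by
      rw [Int.natAbs_mul, Int.natAbs_sign_of_ne_zero hc, one_mul, Int.natAbs_abs]
      exact Int.isCoprime_iff_gcd_eq_one.1 hcop)
  have h3 : (((γ 1 0).sign * γ 0 0 : ℤ) : ℚ) / ((|γ 1 0| : ℤ) : ℚ) = q := by
    rw [← h]
    rcases lt_or_gt_of_ne hc with h | h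
    · rw [Int.sign_eq_neg_one_of_neg h, abs_of_neg h]; push_cast; rw [neg_one_mul, neg_div_neg_eq]
    · rw [Int.sign_eq_one_of_pos h, abs_of_pos h, one_mul]
  rw [h3] at h2
  rw [← Int.cast_abs, ← h2]
  simp

end

end FracModular

end

section

namespace FracModular

open Complex Filter
open UpperHalfPlane hiding I

/-! ### Rational approximation and the size of the modular form -/

/-- Rationals with denominator at most `N` keep a positive distance ε from the irrational `x`.
Dirichlet's theorem with 1/(n+1) < ε therefore produces a larger denominator. -/
theorem exists_rat_den_gt_abs_sub_le {x : ℝ} (hx : Irrational x) (N : ℕ) :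
    ∃ q : ℚ, N < q.den ∧ |x - q| ≤ 1 / (q.den : ℝ) ^ 2 := by
  obtain ⟨ε, hε, hε0⟩ := ((hx.eventually_forall_le_dist_cast_rat_of_den_le N).filter_mono
    nhdsWithin_le_nhds).and (self_mem_nhdsWithin (a := (0 : ℝ)) (s := Set.Ioi 0)) |>.exists
  have hε0 : 0 < ε := hε0
  obtain ⟨n, hn⟩ := exists_nat_one_div_lt hε0
  obtain ⟨q, hq1, hq2⟩ := Real.exists_rat_abs_sub_le_and_den_le x (n := n + 1) (Nat.succ_pos n)
  have hd : (1 : ℝ) ≤ q.den := by exact_mod_cast q.den_pos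
  have hqn : (q.den : ℝ) ≤ n + 1 := by exact_mod_cast hq2
  push_cast at hq1
  refine ⟨q, ?_, hq1.trans ?_⟩
  · by_contra hle
    have h1 := hε q (not_lt.1 hle)
    rw [Real.dist_eq] at h1
    have h2 : 1 / (((n : ℝ) + 1 + 1) * q.den) ≤ 1 / ((n : ℝ) + 1) := by
      apply one_div_le_one_div_of_le (by positivity)
      nlinarith
    linarith
  · apply one_div_le_one_div_of_le (by positivity)
    nlinarith

/-- The Bézout coefficient is reduced modulo the denominator. The condition 0 ≤ d < c later keeps
|cw+d| comparable with c for w in a compact set, and keeps entries of products positive. -/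
theorem exists_matrix_of_rat (q : ℚ) : ∃ γ : SL(2, ℤ), γ 0 0 = q.num ∧ γ 1 0 = q.den ∧
    0 ≤ γ 1 1 ∧ γ 1 1 < q.den := by
  have hcop : IsCoprime q.num (q.den : ℤ) := Int.isCoprime_iff_gcd_eq_one.2 (by
    simpa [Int.gcd] using q.reduced)
  obtain ⟨u, v, h⟩ := hcop
  have hden : (q.den : ℤ) ≠ 0 := by exact_mod_cast q.den_pos.ne'
  have hu := Int.emod_add_mul_ediv u q.den
  refine ⟨⟨!![q.num, -(v + q.num * (u / q.den)); (q.den : ℤ), u % q.den], ?_⟩, rfl, rfl,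
    Int.emod_nonneg _ hden, Int.emod_lt_of_pos _ (by exact_mod_cast q.den_pos)⟩
  rw [Matrix.det_fin_two_of]
  linear_combination h + q.num * hu

section

variable {Γ : Subgroup SL(2, ℤ)} {r : ℝ} {f : ℍ → ℂ}

theorem smul_sub_eq {γ : SL(2, ℤ)} (hc : γ 1 0 ≠ 0) (w : ℍ) :
    ((γ • w : ℍ) : ℂ) - ((γ 0 0 : ℝ) / (γ 1 0 : ℝ) : ℝ) =
      -1 / ((γ 1 0 : ℂ) * ((γ 1 0 : ℂ) * w + γ 1 1)) := by
  have h1 := γ.det_coe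
  rw [Matrix.det_fin_two] at h1
  have h2 : (γ 0 0 : ℂ) * γ 1 1 - γ 0 1 * γ 1 0 = 1 := by exact_mod_cast h1
  have hc' : (γ 1 0 : ℂ) ≠ 0 := by exact_mod_cast hc
  have hd := denom_int_ne_zero γ w.im_pos
  change (γ 1 0 : ℂ) * (w : ℂ) + γ 1 1 ≠ 0 at hd
  rw [coe_smul_int]
  push_cast
  rw [div_sub_div _ _ hd hc', div_eq_div_iff (mul_ne_zero hd hc') (mul_ne_zero hc' hd)]
  linear_combination (-1 * (((γ 1 0 : ℂ) * w + γ 1 1) * γ 1 0)) * h2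

variable [Γ.FiniteIndex]

/-- The invariant modulus is bounded below along a sequence of points which tends to a given
irrational number without becoming tangential to the real axis. -/
theorem exists_recurrent (hf : IsModularForm Γ r f) (hf0 : f ≠ 0) {x : ℝ}
    (hx : Irrational x) : ∃ C, 1 ≤ C ∧ ∀ ε : ℝ, 0 < ε → ∃ z : ℍ, ‖(z : ℂ) - x‖ < ε ∧
      ‖(z : ℂ) - x‖ ≤ C * z.im ∧ 1 ≤ C * invNorm r f z := by
  -- For each γ there is a point w with f(γw) ≠ 0, for instance γ⁻¹z₀ with f(z₀) ≠ 0. Finiteness of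
  -- the cosets keeps w in a fixed compact set. If γ(∞) is a Dirichlet approximation p/q of x, then
  -- γw lies within O(q^{-2}) of x, at height comparable with q^{-2}.
  obtain ⟨C, hC1, hC⟩ := exists_uniform_bound Γ (B := fun γ C => 0 < C ∧ ∃ w : ℍ, ‖(w : ℂ)‖ ≤ C ∧
      1 ≤ C * w.im ∧ 1 ≤ C * invNorm r f (γ • w)) (by
    rintro γ C C' ⟨h0, w, h1, h2, h3⟩ h
    refine ⟨h0.trans_le h, w, h1.trans h, h2.trans ?_, h3.trans ?_⟩
    · exact mul_le_mul_of_nonneg_right h w.im_pos.le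
    · exact mul_le_mul_of_nonneg_right h (invNorm_nonneg _ _ _)) (by
    rintro δ hδ γ C ⟨h0, w, h1, h2, h3⟩
    exact ⟨h0, w, h1, h2, by rwa [hf.invNorm_mul_smul hδ]⟩) (by
    intro γ
    obtain ⟨z₀, hz₀⟩ := Function.ne_iff.1 hf0
    have h1 : 0 < invNorm r f z₀ :=
      mul_pos (norm_pos_iff.2 hz₀) (Real.rpow_pos_of_pos z₀.im_pos _)
    set w : ℍ := γ⁻¹ • z₀ with hw
    have h2 := w.im_pos
    refine ⟨max ‖(w : ℂ)‖ (max (w.im)⁻¹ (invNorm r f z₀)⁻¹), ?_, w, le_max_left _ _, ?_, ?_⟩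
    · exact lt_max_of_lt_right (lt_max_of_lt_left (inv_pos.2 h2))
    · calc (1 : ℝ) = w.im⁻¹ * w.im := by field_simp
        _ ≤ _ := mul_le_mul_of_nonneg_right ((le_max_left _ _).trans (le_max_right _ _)) h2.le
    · rw [hw, smul_inv_smul]
      calc (1 : ℝ) = (invNorm r f z₀)⁻¹ * invNorm r f z₀ := by field_simp
        _ ≤ _ := mul_le_mul_of_nonneg_right ((le_max_right _ _).trans (le_max_right _ _)) h1.le)
  -- The distance to x is at most (C+1)/d², while the height Im w/t² is at least 1/(C(C+1)²d²); the
  -- quotient is C(C+1)³.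
  refine ⟨C * (C + 1) ^ 3, by nlinarith [pow_le_pow_left₀ zero_le_one (show 1 ≤ C + 1 by linarith) 3],
    fun ε hε => ?_⟩
  obtain ⟨N, hN⟩ := exists_nat_gt ((C + 1) / ε)
  obtain ⟨q, hqN, hq⟩ := exists_rat_den_gt_abs_sub_le hx N
  obtain ⟨γ, h00, h10, h11, h11'⟩ := exists_matrix_of_rat q
  obtain ⟨-, w, hw1, hw2, hw3⟩ := hC γ
  have hd1 : (1 : ℝ) ≤ q.den := by exact_mod_cast q.den_pos
  have hdN : (N : ℝ) < q.den := by exact_mod_cast hqN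
  set d : ℝ := (q.den : ℝ) with hd
  have hc : γ 1 0 ≠ 0 := by rw [h10]; exact_mod_cast q.den_pos.ne'
  have hcC : (γ 1 0 : ℂ) = (d : ℂ) := by rw [h10, hd]; simp
  set t : ℝ := ‖(γ 1 0 : ℂ) * w + γ 1 1‖ with ht
  have hwpos := w.im_pos
  have ht1 : d ≤ C * t := by
    have h1 : |((γ 1 0 : ℂ) * w + γ 1 1).im| ≤ t := Complex.abs_im_le_norm _
    have h2 : ((γ 1 0 : ℂ) * w + γ 1 1).im = d * w.im := by rw [hcC]; simp
    rw [h2, abs_of_pos (by positivity)] at h1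
    calc d ≤ d * (C * w.im) := by nlinarith
      _ = C * (d * w.im) := by ring
      _ ≤ C * t := by gcongr
  have ht2 : t ≤ (C + 1) * d := by
    have h1 : t ≤ d * ‖(w : ℂ)‖ + d := by
      refine (norm_add_le _ _).trans ?_
      rw [norm_mul, hcC, Complex.norm_real, Real.norm_of_nonneg (by positivity),
        Complex.norm_intCast, abs_of_nonneg (by exact_mod_cast h11)]
      have : (γ 1 1 : ℝ) ≤ d := by rw [hd]; exact_mod_cast h11'.le
      linarith
    nlinarith
  have htpos : 0 < t := by
    by_contra h; nlinarith
  have hqd : ((γ 0 0 : ℝ) / (γ 1 0 : ℝ) : ℝ) = (q : ℝ) := by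
    rw [h00, h10, Rat.cast_def]; simp
  have hsub : ‖((γ • w : ℍ) : ℂ) - (q : ℝ)‖ ≤ C / d ^ 2 := by
    have := smul_sub_eq hc w
    rw [hqd] at this
    rw [this, norm_div, norm_mul, ← ht, hcC, norm_neg, norm_one, Complex.norm_real,
      Real.norm_of_nonneg (by positivity), div_le_div_iff₀ (by positivity) (by positivity)]
    nlinarith
  have hdist : ‖((γ • w : ℍ) : ℂ) - x‖ ≤ (C + 1) / d ^ 2 := by
    have h1 : ‖((γ • w : ℍ) : ℂ) - x‖ ≤ ‖((γ • w : ℍ) : ℂ) - (q : ℝ)‖ + |x - q| := by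
      have : ((γ • w : ℍ) : ℂ) - x = (((γ • w : ℍ) : ℂ) - (q : ℝ)) - ((x - q : ℝ) : ℂ) := by
        push_cast; ring
      rw [this]
      refine (norm_sub_le _ _).trans ?_
      rw [Complex.norm_real, Real.norm_eq_abs]
    rw [add_div]
    linarith
  refine ⟨γ • w, hdist.trans_lt ?_, hdist.trans ?_, hw3.trans ?_⟩
  · rw [div_lt_iff₀ (by positivity)]
    rw [div_lt_iff₀ hε] at hN
    nlinarith
  · rw [im_smul_int, ← ht, mul_div_assoc', div_le_div_iff₀ (by positivity) (by positivity)]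
    have h1 : t ^ 2 ≤ (C + 1) ^ 2 * d ^ 2 := by
      rw [← mul_pow]; exact pow_le_pow_left₀ htpos.le ht2 2
    calc (C + 1) * t ^ 2 ≤ (C + 1) * ((C + 1) ^ 2 * d ^ 2) := by gcongr
      _ = (C + 1) ^ 3 * d ^ 2 * 1 := by ring
      _ ≤ (C + 1) ^ 3 * d ^ 2 * (C * w.im) := by gcongr
      _ = _ := by ring
  · refine mul_le_mul_of_nonneg_right ?_ (invNorm_nonneg _ _ _)
    have : 1 ≤ (C + 1) ^ 3 := one_le_pow₀ (by linarith)
    nlinarith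

theorem growsAt_neg (γ : SL(2, ℤ)) : GrowsAt r f (-γ) ↔ GrowsAt r f γ := by
  simp only [GrowsAt, ModularGroup.SL_neg_smul]

theorem T_zpow_mul_apply (n : ℤ) (w : SL(2, ℤ)) :
    (ModularGroup.T ^ n * w) 0 0 = w 0 0 + n * w 1 0 ∧ (ModularGroup.T ^ n * w) 1 0 = w 1 0 := by
  rw [Matrix.SpecialLinearGroup.coe_mul, ModularGroup.coe_T_zpow]
  simp [Matrix.mul_apply, Fin.sum_univ_two]

/-- Near every irrational number there are rationals at which the form is not cuspidal, at a
distance that is at most a constant times the inverse square of the denominator. -/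
theorem exists_rat_not_cuspidal_near (hr : 0 < r) (hf : IsModularForm Γ r f) (hf0 : f ≠ 0)
    (hg : ∃ γ, GrowsAt r f γ) {x : ℝ} (hx : Irrational x) :
    ∃ C, 1 ≤ C ∧ ∀ N : ℕ, ∃ q : ℚ, N < q.den ∧ ¬ IsCuspidalAt Γ r f (q : OnePoint ℚ) ∧
      |x - q| ≤ C / (q.den : ℝ) ^ 2 := by
  obtain ⟨γ₀, hγ₀⟩ := hg
  -- For every γ either γ(∞) is non-cuspidal, or (γw)(∞) is for some w whose first column is
  -- positive and bounded. If γ(∞) = q has denominator d, the second case gives q' with denominator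
  -- d' between d and Cd and |q-q'| = w₁₀/(dd'), so q' approximates x as well as q up to a constant.
  obtain ⟨C, hC1, hC⟩ := exists_uniform_bound Γ (B := fun γ C => GrowsAt r f γ ∨
      ∃ w : SL(2, ℤ), GrowsAt r f (γ * w) ∧ 0 < w 0 0 ∧ 0 < w 1 0 ∧
        (w 0 0 : ℝ) + w 1 0 ≤ C) (by
    rintro γ C C' (h | ⟨w, h1, h2, h3, h4⟩) h'
    · exact Or.inl h
    · exact Or.inr ⟨w, h1, h2, h3, h4.trans h'⟩) (by
    rintro δ hδ γ C h
    simpa only [mul_assoc, hf.growsAt_mul hδ] using h) (by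
    intro γ
    obtain ⟨w, hw, hw0⟩ : ∃ w : SL(2, ℤ), GrowsAt r f (γ * w) ∧ 0 ≤ w 1 0 := by
      rcases le_total 0 ((γ⁻¹ * γ₀) 1 0) with h | h
      · exact ⟨_, by rwa [mul_inv_cancel_left], h⟩
      · refine ⟨-(γ⁻¹ * γ₀), by rwa [mul_neg, mul_inv_cancel_left, growsAt_neg], ?_⟩
        rw [Matrix.SpecialLinearGroup.coe_neg, Matrix.neg_apply]
        omega
    -- If w₁₀ = 0, then w fixes ∞ and preserves heights, so the growth is already that at γ(∞).
    rcases hw0.eq_or_lt with h0 | hpos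
    · refine ⟨0, Or.inl ?_⟩
      obtain ⟨c, Y, hc, hY, h⟩ := hw
      refine ⟨c, Y, hc, hY, fun u hu => ?_⟩
      have h1 : (w • (w⁻¹ • u)).im = (w⁻¹ • u).im := im_mul_sq_of_lower_left_eq_zero h0.symm _
      rw [smul_inv_smul] at h1
      have h2 := h (w⁻¹ • u) (by rwa [← h1])
      rwa [mul_smul, smul_inv_smul, ← h1] at h2
    -- Replacing w by T^{nk}w keeps the growth, as γT^{nk}γ⁻¹ lies in Γ, and for suitable k makes
    -- the upper left entry positive.
    · obtain ⟨n, hn, hT⟩ := exists_conj_T_pow_mem Γ γ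
      obtain ⟨k, hk⟩ : ∃ k : ℤ, 0 < w 0 0 + (n * k) * w 1 0 := by
        refine ⟨|w 0 0| + 1, ?_⟩
        have hn' : (1 : ℤ) ≤ n := by exact_mod_cast hn
        have h1 : (1 : ℤ) ≤ n * w 1 0 := by nlinarith
        have h2 := neg_abs_le (w 0 0)
        have h3 := abs_nonneg (w 0 0)
        nlinarith
      obtain ⟨e1, e2⟩ := T_zpow_mul_apply (n * k) w
      refine ⟨_, Or.inr ⟨ModularGroup.T ^ (n * k : ℤ) * w, ?_, by rw [e1]; exact hk,
        by rw [e2]; exact hpos, le_rfl⟩⟩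
      have h1 := Γ.zpow_mem hT k
      rw [conj_zpow, ← zpow_natCast, ← zpow_mul] at h1
      rw [← hf.growsAt_mul h1] at hw
      convert hw using 1
      group)
  refine ⟨2 * C ^ 2, by nlinarith, fun N => ?_⟩
  obtain ⟨q, hqN, hq⟩ := exists_rat_den_gt_abs_sub_le hx N
  obtain ⟨γ, h00, h10, h11, h11'⟩ := exists_matrix_of_rat q
  have hc : γ 1 0 ≠ 0 := by rw [h10]; exact_mod_cast q.den_pos.ne'
  have hqd : ((γ 0 0 : ℚ) / (γ 1 0 : ℚ) : ℚ) = q := by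
    rw [h00, h10]; exact_mod_cast q.num_div_den
  have hd1 : (1 : ℝ) ≤ q.den := by exact_mod_cast q.den_pos
  rcases hC γ with h | ⟨w, h1, h2, h3, h4⟩
  · refine ⟨q, hqN, (not_isCuspidalAt_iff hr hf hf0 q).2 ⟨γ, hc, hqd, h⟩, hq.trans ?_⟩
    gcongr
    nlinarith
  · have e10 : (γ * w) 1 0 = q.den * w 0 0 + γ 1 1 * w 1 0 := by
      rw [Matrix.SpecialLinearGroup.coe_mul, Matrix.mul_apply, Fin.sum_univ_two, h10]
    have e00 : (γ * w) 0 0 = q.num * w 0 0 + γ 0 1 * w 1 0 := by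
      rw [Matrix.SpecialLinearGroup.coe_mul, Matrix.mul_apply, Fin.sum_univ_two, h00]
    have hdi : (1 : ℤ) ≤ q.den := by exact_mod_cast q.den_pos
    have hge : (q.den : ℤ) ≤ (γ * w) 1 0 := by
      rw [e10]; nlinarith [mul_nonneg h11 h3.le]
    have hle : (((γ * w) 1 0 : ℤ) : ℝ) ≤ q.den * C := by
      have h5 : (γ * w) 1 0 ≤ q.den * (w 0 0 + w 1 0) := by
        rw [e10]; nlinarith [mul_le_mul_of_nonneg_right h11'.le h3.le]
      have h6 : (((γ * w) 1 0 : ℤ) : ℝ) ≤ q.den * ((w 0 0 : ℝ) + w 1 0) := by exact_mod_cast h5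
      exact h6.trans (by gcongr)
    have hc' : (γ * w) 1 0 ≠ 0 := by omega
    obtain ⟨q', hq'⟩ : ∃ q' : ℚ, (((γ * w) 0 0 : ℤ) : ℚ) / (((γ * w) 1 0 : ℤ) : ℚ) = q' :=
      ⟨_, rfl⟩
    have hden' := den_eq_abs_lower_left hc' hq'
    have hge' : (q.den : ℝ) ≤ (((γ * w) 1 0 : ℤ) : ℝ) := by exact_mod_cast hge
    rw [abs_of_pos (by linarith)] at hden'
    refine ⟨q', ?_, (not_isCuspidalAt_iff hr hf hf0 q').2 ⟨γ * w, hc', hq', h1⟩, ?_⟩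
    · have : (q.den : ℝ) ≤ q'.den := by rw [hden']; exact hge'
      have : q.den ≤ q'.den := by exact_mod_cast this
      omega
    · rw [← hden'] at hle hge'
      have hdet := γ.det_coe
      rw [Matrix.det_fin_two, h00, h10] at hdet
      have hdet' : (q.num : ℝ) * γ 1 1 - γ 0 1 * (q.den : ℝ) = 1 := by exact_mod_cast hdet
      set d : ℝ := (q.den : ℝ)
      set d' : ℝ := (q'.den : ℝ)
      have hqr : (q : ℝ) = q.num / d := Rat.cast_def q
      have hq'r : (q' : ℝ) = (q.num * w 0 0 + γ 0 1 * w 1 0) / d' := by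
        rw [← hq', Rat.cast_div, hden']
        rw [e00]; push_cast; rfl
      have hd'r : d' = d * w 0 0 + γ 1 1 * w 1 0 := by
        rw [hden', e10]; push_cast; rfl
      have hd0 : 0 < d := by linarith
      have hd'0 : 0 < d' := by linarith
      have hdiff : (q : ℝ) - q' = w 1 0 / (d * d') := by
        rw [hqr, hq'r, div_sub_div _ _ hd0.ne' hd'0.ne']
        congr 1
        rw [hd'r]
        linear_combination (w 1 0 : ℝ) * hdet'
      have hw10 : (0 : ℝ) < w 1 0 := by exact_mod_cast h3
      have hw00 : (0 : ℝ) < w 0 0 := by exact_mod_cast h2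
      have hb1 : 1 / d ^ 2 ≤ C ^ 2 / d' ^ 2 := by
        rw [div_le_div_iff₀ (by positivity) (by positivity), one_mul, ← mul_pow]
        exact pow_le_pow_left₀ hd'0.le (by linarith) 2
      have hb2 : (w 1 0 : ℝ) / (d * d') ≤ C ^ 2 / d' ^ 2 := by
        rw [div_le_div_iff₀ (by positivity) (by positivity)]
        have : (w 1 0 : ℝ) * d' ≤ C * (d * C) := by
          apply mul_le_mul (by linarith) hle hd'0.le (by linarith)
        nlinarith
      calc |x - q'| = |(x - q) + (q - q')| := by congr 1; ring
        _ ≤ |x - q| + |(q : ℝ) - q'| := abs_add_le _ _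
        _ ≤ C ^ 2 / d' ^ 2 + C ^ 2 / d' ^ 2 := by
          rw [hdiff, abs_of_pos (div_pos hw10 (mul_pos hd0 hd'0))]
          exact add_le_add (hq.trans hb1) hb2
        _ = _ := by ring

/-- The form is large above the rationals at which it is not cuspidal. -/
theorem exists_le_norm_above_rat (hr : 0 < r) (hf : IsModularForm Γ r f) (hf0 : f ≠ 0) :
    ∃ C, 1 ≤ C ∧ ∀ q : ℚ, ¬ IsCuspidalAt Γ r f (q : OnePoint ℚ) → ∀ z : ℍ, z.re = q →
      C * (z.im * (q.den : ℝ) ^ 2) ≤ 1 → ((q.den : ℝ) * z.im) ^ (-r) ≤ C * ‖f z‖ := by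
  obtain ⟨C, hC1, hC⟩ := exists_uniform_lower hf
  refine ⟨C, hC1, fun q hq z hz hzq => ?_⟩
  obtain ⟨γ, hc, hγq, hγ⟩ := (not_isCuspidalAt_iff hr hf hf0 q).1 hq
  have hden := den_eq_abs_lower_left hc hγq
  have hd1 : (1 : ℝ) ≤ q.den := by exact_mod_cast q.den_pos
  set d : ℝ := (q.den : ℝ)
  have hd0 : 0 < d := by linarith
  have hy := z.im_pos
  set w := γ⁻¹ • z with hw
  have hzw : z = γ • w := (smul_inv_smul γ z).symm
  have h1 := im_mul_norm_sq γ w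
  rw [← hzw, norm_lower_left_mul_sub hc, ← hden] at h1
  have hγq' : ((γ 0 0 : ℝ) / (γ 1 0 : ℝ) : ℝ) = (q : ℝ) := by
    rw [← hγq]; push_cast; rfl
  have h2 : ‖(z : ℂ) - ((γ 0 0 : ℝ) / (γ 1 0 : ℝ) : ℝ)‖ = z.im := by
    rw [hγq', ← hz]
    have : (z : ℂ) - (z.re : ℂ) = z.im * I := by
      apply Complex.ext <;> simp
    rw [this]
    simp [abs_of_pos hy]
  rw [h2] at h1
  -- Directly above q the distance to q is y, so the height seen from this cusp is 1/(yd²). The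
  -- lower bound (Im w)^{r/2} for the invariant modulus then becomes (dy)^{-r} for |f|.
  have h3 : w.im = 1 / (z.im * d ^ 2) := by
    rw [eq_div_iff (by positivity)]
    have : z.im * (w.im * (z.im * d ^ 2)) = z.im * 1 := by nlinarith
    exact mul_left_cancel₀ hy.ne' this
  have h4 := hC γ hγ w (by rw [h3, le_div_iff₀ (by positivity)]; exact hzq)
  rw [← hzw, invNorm] at h4
  have h5 : w.im ^ (r / 2) = z.im ^ (r / 2) * (d * z.im) ^ (-r) := by
    have e : (d * z.im) ^ (-r) = ((d * z.im) ^ 2) ^ (-(r / 2)) := by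
      rw [← Real.rpow_natCast, ← Real.rpow_mul (by positivity)]
      congr 1; push_cast; ring
    rw [e, Real.rpow_neg (by positivity), ← Real.inv_rpow (by positivity),
      ← Real.mul_rpow hy.le (by positivity), h3]
    congr 1
    field_simp
  rw [h5] at h4
  have h6 := Real.rpow_pos_of_pos hy (r / 2)
  have h7 : z.im ^ (r / 2) * (d * z.im) ^ (-r) ≤ z.im ^ (r / 2) * (C * ‖f z‖) := by
    linarith [h4]
  exact le_of_mul_le_mul_left h7 h6

/-- Used with y = Im z, D = |z-x|, E = |z-p/q| and c = q, when |x-p/q| ≥ c₀q^{-τ}. The hypothesis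
bounds c from below by a multiple of (D+E)^{-1/τ}, so it suffices that y(D+E)^{1/τ} ≤ 2D^{1/τ}E. If
D is the larger, this follows from y ≤ E. Otherwise y is split as y^{1/τ}y^{1-1/τ}, which is at most
D^{1/τ}E^{1-1/τ}. -/
theorem le_mul_of_badly_approximated {y D E c c₀ τ : ℝ} (hy : 0 < y) (hyD : y ≤ D) (hyE : y ≤ E)
    (hc : 0 < c) (hc₀ : 0 < c₀) (hτ : 2 ≤ τ) (h : c₀ ≤ (D + E) * c ^ τ) :
    y ≤ 2 * c₀ ^ (-(1 / τ)) * (D ^ (1 / τ) * (c * E)) := by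
  have hD : 0 < D := hy.trans_le hyD
  have hE : 0 < E := hy.trans_le hyE
  have hτ0 : 0 < τ := by linarith
  have hτ1 : 1 / τ ≤ 1 := by rw [div_le_one hτ0]; linarith
  have hτ2 : 0 < 1 / τ := by positivity
  have h1 : c₀ ^ (1 / τ) ≤ (D + E) ^ (1 / τ) * c := by
    have := Real.rpow_le_rpow hc₀.le h hτ2.le
    rwa [Real.mul_rpow (by positivity) (by positivity), ← Real.rpow_mul hc.le,
      mul_one_div_cancel hτ0.ne', Real.rpow_one] at this
  have h2 : (2 : ℝ) ^ (1 / τ) ≤ 2 := by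
    calc (2 : ℝ) ^ (1 / τ) ≤ 2 ^ (1 : ℝ) := Real.rpow_le_rpow_of_exponent_le (by norm_num) hτ1
      _ = 2 := Real.rpow_one 2
  have h3 : y * (D + E) ^ (1 / τ) ≤ 2 * (D ^ (1 / τ) * E) := by
    rcases le_total E D with h | h
    · calc y * (D + E) ^ (1 / τ) ≤ E * (2 * D) ^ (1 / τ) := by
            gcongr; linarith
        _ = 2 ^ (1 / τ) * (D ^ (1 / τ) * E) := by
            rw [Real.mul_rpow (by norm_num) hD.le]; ring
        _ ≤ _ := by gcongr
    · calc y * (D + E) ^ (1 / τ) ≤ y * (2 * E) ^ (1 / τ) := by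
            gcongr; linarith
        _ = 2 ^ (1 / τ) * (E ^ (1 / τ) * (y ^ (1 / τ) * y ^ (1 - 1 / τ))) := by
            rw [Real.mul_rpow (by norm_num) hE.le, ← Real.rpow_add hy]
            rw [add_sub_cancel, Real.rpow_one]; ring
        _ ≤ 2 * (E ^ (1 / τ) * (D ^ (1 / τ) * E ^ (1 - 1 / τ))) := by
            have : 0 ≤ 1 - 1 / τ := by linarith
            gcongr
        _ = 2 * (D ^ (1 / τ) * (E ^ (1 / τ) * E ^ (1 - 1 / τ))) := by ring
        _ = _ := by rw [← Real.rpow_add hE, add_sub_cancel, Real.rpow_one]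
  have h4 : 0 < c₀ ^ (1 / τ) := Real.rpow_pos_of_pos hc₀ _
  rw [Real.rpow_neg hc₀.le]
  have h5 : y * c₀ ^ (1 / τ) ≤ 2 * (D ^ (1 / τ) * (c * E)) := by
    calc y * c₀ ^ (1 / τ) ≤ y * ((D + E) ^ (1 / τ) * c) := by gcongr
      _ = (y * (D + E) ^ (1 / τ)) * c := by ring
      _ ≤ (2 * (D ^ (1 / τ) * E)) * c := by gcongr
      _ = _ := by ring
  rw [← le_div_iff₀ h4] at h5
  refine h5.trans (le_of_eq ?_)
  field_simp

/-- The size of the form near a point which is not well approximable by the rationals at which the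
form is not cuspidal. -/
theorem exists_norm_le_near (hr : 0 < r) (hf : IsModularForm Γ r f) (hf0 : f ≠ 0) {x τ c₀ : ℝ}
    (hτ : 2 ≤ τ) (hc₀ : 0 < c₀) (h : ∀ q : ℚ, ¬ IsCuspidalAt Γ r f (q : OnePoint ℚ) →
      c₀ ≤ |x - q| * (q.den : ℝ) ^ τ) :
    ∃ C, 0 ≤ C ∧ ∀ z : ℍ, ‖(z : ℂ) - x‖ ≤ 1 →
      ‖f z‖ ≤ C * z.im ^ (-r) * ‖(z : ℂ) - x‖ ^ (r / τ) := by
  obtain ⟨C₁, hC₁, h₁⟩ := exists_uniform_upper hr hf hf0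
  obtain ⟨C₂, hC₂, h₂⟩ := exists_uniform_upper_of_not_growsAt hr hf hf0
  set K : ℝ := 2 * c₀ ^ (-(1 / τ)) with hK
  have hKpos : 0 < K := by positivity
  clear_value K
  have hτ0 : 0 < τ := by linarith
  refine ⟨C₁ + C₂ + C₁ * K ^ r, by positivity, fun z hz => ?_⟩
  set D := ‖(z : ℂ) - x‖ with hD
  have hy := z.im_pos
  have hyD : z.im ≤ D := by
    have h1 : |((z : ℂ) - x).im| ≤ D := Complex.abs_im_le_norm _
    simpa [abs_of_pos hy] using h1
  have hD0 : 0 < D := hy.trans_le hyD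
  have hyp : 0 < z.im ^ (-r) := Real.rpow_pos_of_pos hy _
  have hDp : 0 < D ^ (r / τ) := Real.rpow_pos_of_pos hD0 _
  -- a bound for the points where the invariant modulus is bounded
  have hmain : ∀ C, 0 ≤ C → invNorm r f z ≤ C → ‖f z‖ ≤ C * z.im ^ (-r) * D ^ (r / τ) := by
    intro C hC0 hC
    rw [norm_eq_invNorm r, mul_assoc]
    refine mul_le_mul hC ?_ (Real.rpow_nonneg hy.le _) hC0
    calc z.im ^ (-(r / 2)) = z.im ^ (-r) * z.im ^ (r / 2) := by
          rw [← Real.rpow_add hy]; congr 1; ring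
      _ ≤ z.im ^ (-r) * D ^ (r / 2) := by gcongr
      _ ≤ z.im ^ (-r) * D ^ (r / τ) := by
          refine mul_le_mul_of_nonneg_left ?_ hyp.le
          refine Real.rpow_le_rpow_of_exponent_ge hD0 hz ?_
          gcongr
  have hpos : 0 ≤ z.im ^ (-r) * D ^ (r / τ) := by positivity
  have hKr : 0 ≤ C₁ * K ^ r := by positivity
  obtain ⟨γ, w, hzw, hw⟩ := exists_eq_smul_im_ge z
  by_cases hγ : GrowsAt r f γ
  · by_cases hc : γ 1 0 = 0
    · have hwim : w.im = z.im := by rw [hzw]; exact (im_mul_sq_of_lower_left_eq_zero hc w).symm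
      have h3 := h₁ γ w hw
      rw [← hzw, hwim] at h3
      have h4 : z.im ^ (r / 2) ≤ 1 := Real.rpow_le_one hy.le (hyD.trans hz) (by positivity)
      refine (hmain C₁ (by linarith) (h3.trans (by nlinarith))).trans ?_
      rw [mul_assoc, mul_assoc]
      refine mul_le_mul_of_nonneg_right ?_ hpos
      linarith
    -- Close to a finite non-cuspidal q one has Im w = y/(dE)², hence |f(z)| ≤ C₁(dE)^{-r}. The bad
    -- approximability of x gives y ≤ K D^{1/τ}dE, which turns this into y^{-r}D^{r/τ}.
    · obtain ⟨q, hq⟩ : ∃ q : ℚ, (γ 0 0 : ℚ) / (γ 1 0 : ℚ) = q := ⟨_, rfl⟩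
      have hden := den_eq_abs_lower_left hc hq
      have hqn := (not_isCuspidalAt_iff hr hf hf0 q).2 ⟨γ, hc, hq, hγ⟩
      have h3 := h q hqn
      have hd1 : (1 : ℝ) ≤ q.den := by exact_mod_cast q.den_pos
      set d : ℝ := (q.den : ℝ) with hd
      have hd0 : 0 < d := by linarith
      have hq' : ((γ 0 0 : ℝ) / (γ 1 0 : ℝ) : ℝ) = (q : ℝ) := by
        rw [← hq]; push_cast; rfl
      have h4 := im_mul_norm_sq γ w
      rw [← hzw, norm_lower_left_mul_sub hc, ← hden, hq'] at h4
      set E := ‖(z : ℂ) - (q : ℝ)‖ with hE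
      have hyE : z.im ≤ E := by
        have h1 : |((z : ℂ) - (q : ℝ)).im| ≤ E := Complex.abs_im_le_norm _
        simpa [abs_of_pos hy] using h1
      have hE0 : 0 < E := hy.trans_le hyE
      have hxq : |x - q| ≤ D + E := by
        have : ((x - q : ℝ) : ℂ) = ((z : ℂ) - (q : ℝ)) - ((z : ℂ) - x) := by push_cast; ring
        rw [← Real.norm_eq_abs, ← Complex.norm_real, this]
        refine (norm_sub_le _ _).trans ?_
        linarith
      have h5 := le_mul_of_badly_approximated hy hyD hyE hd0 hc₀ hτ
        (h3.trans (mul_le_mul_of_nonneg_right hxq (Real.rpow_nonneg hd0.le _)))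
      rw [← hK] at h5
      have h6 := h₁ γ w hw
      rw [← hzw] at h6
      have hwz : w.im = z.im / (d * E) ^ 2 := by
        rw [eq_div_iff (by positivity)]; exact h4
      rw [hwz, div_sq_rpow_half hy.le (by positivity)] at h6
      have h7 : ‖f z‖ ≤ C₁ * (d * E) ^ (-r) := by
        rw [norm_eq_invNorm r, Real.rpow_neg hy.le, Real.rpow_neg (by positivity)]
        have := Real.rpow_pos_of_pos hy (r / 2)
        rw [← div_eq_mul_inv, div_le_iff₀ this]
        refine h6.trans (le_of_eq ?_)
        ring
      have h8 : (d * E) ^ (-r) ≤ K ^ r * (z.im ^ (-r) * D ^ (r / τ)) := by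
        have h9 : z.im ^ r ≤ K ^ r * (D ^ (r / τ) * (d * E) ^ r) := by
          have := Real.rpow_le_rpow hy.le h5 hr.le
          rwa [Real.mul_rpow (x := K) hKpos.le (by positivity), Real.mul_rpow (by positivity)
            (by positivity), ← Real.rpow_mul hD0.le, one_div_mul_eq_div] at this
        have h10 : 0 < (d * E) ^ r := by positivity
        have h11 : 0 < z.im ^ r := by positivity
        rw [Real.rpow_neg (by positivity), Real.rpow_neg hy.le, inv_eq_one_div,
          div_le_iff₀ h10]
        calc (1 : ℝ) = (z.im ^ r)⁻¹ * z.im ^ r := by field_simp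
          _ ≤ (z.im ^ r)⁻¹ * (K ^ r * (D ^ (r / τ) * (d * E) ^ r)) := by gcongr
          _ = _ := by ring
      calc ‖f z‖ ≤ C₁ * (K ^ r * (z.im ^ (-r) * D ^ (r / τ))) := h7.trans (by gcongr)
        _ = (C₁ * K ^ r) * (z.im ^ (-r) * D ^ (r / τ)) := by ring
        _ ≤ (C₁ + C₂ + C₁ * K ^ r) * (z.im ^ (-r) * D ^ (r / τ)) := by
            refine mul_le_mul_of_nonneg_right ?_ hpos
            linarith
        _ = _ := by ring
  · have h3 := h₂ γ hγ w hw
    rw [← hzw] at h3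
    refine (hmain C₂ (by linarith) h3).trans ?_
    rw [mul_assoc, mul_assoc]
    refine mul_le_mul_of_nonneg_right ?_ hpos
    linarith

end

end FracModular

end

section

namespace FracModular

open Complex Filter MeasureTheory

/-! ### Fractional integrals of series of exponentials -/

/-- `F(z) = ∑ b_n e^{2πi(n+κ)z/m}` is a series of exponentials with positive frequencies, and
`F(z) = O((Im z)^{-A})` near the real axis. -/
structure ExpSeries (b : ℕ → ℂ) (κ m A : ℝ) (F : ℂ → ℂ) : Prop where
  nonneg : 0 ≤ κ
  pos : 0 < m
  pos_exponent : 0 < A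
  eq_zero : ∀ n : ℕ, ¬ 0 < (n : ℝ) + κ → b n = 0
  holo : DifferentiableOn ℂ F {z | 0 < z.im}
  hasSum : ∀ z : ℂ, 0 < z.im → HasSum (fun n : ℕ => b n * ex ((n + κ) / m) z) (F z)
  bound : ∃ C : ℝ, ∀ z : ℂ, 0 < z.im → z.im ≤ 1 → ‖F z‖ ≤ C * z.im ^ (-A)

variable {b : ℕ → ℂ} {κ m A : ℝ} {F : ℂ → ℂ}

namespace ExpSeries

theorem exists_gap (h : ExpSeries b κ m A F) : ∃ l₀ : ℝ, 0 < l₀ ∧ ∀ n : ℕ, b n ≠ 0 →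
    l₀ ≤ (n + κ) / m := by
  have hm := h.pos
  by_cases hκ : 0 < κ
  · exact ⟨κ / m, by positivity, fun n _ => by
      have : (0 : ℝ) ≤ n := n.cast_nonneg
      gcongr; linarith⟩
  · refine ⟨1 / m, by positivity, fun n hn => ?_⟩
    have h1 : 0 < (n : ℝ) + κ := by
      by_contra h2; exact hn (h.eq_zero n h2)
    have h2 : n ≠ 0 := by rintro rfl; simp at h1; exact hκ h1
    have h3 : (1 : ℝ) ≤ n := by exact_mod_cast Nat.one_le_iff_ne_zero.2 h2
    have := h.nonneg
    gcongr; linarith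

theorem exists_decay (h : ExpSeries b κ m A F) (M : ℝ) : ∃ C : ℝ, 0 ≤ C ∧ ∀ z : ℂ, 1 / 2 ≤ z.im →
    ‖F z‖ ≤ C * z.im ^ (-M) := by
  obtain ⟨l₀, hl₀, hl⟩ := h.exists_gap
  obtain ⟨C, hC0, hC⟩ := norm_le_of_hasSum_ex h.hasSum hl one_half_pos
  have hpi := Real.pi_pos
  set c := 2 * Real.pi * l₀ with hc
  have hc0 : 0 < c := by positivity
  obtain ⟨B, hB⟩ := eventually_atTop.1 ((tendsto_rpow_mul_exp_neg_mul_atTop_nhds_zero M c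
    hc0).eventually (eventually_le_nhds one_pos))
  have hcont : ContinuousOn (fun y : ℝ => y ^ M * Real.exp (-c * y)) (Set.Icc (1 / 2) B) := by
    refine ContinuousOn.mul (fun y hy => ?_) (by fun_prop)
    have : (0 : ℝ) < y := lt_of_lt_of_le (by norm_num) hy.1
    exact (Real.continuousAt_rpow_const y M (Or.inl this.ne')).continuousWithinAt
  obtain ⟨B', hB'⟩ := isCompact_Icc.bddAbove_image hcont
  refine ⟨C * max 1 B', by positivity, fun z hz => ?_⟩
  have hz0 : 0 < z.im := lt_of_lt_of_le (by norm_num) hz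
  have h1 : z.im ^ M * Real.exp (-c * z.im) ≤ max 1 B' := by
    rcases le_total B z.im with h' | h'
    · exact (hB _ h').trans (le_max_left _ _)
    · exact (hB' ⟨z.im, ⟨hz, h'⟩, rfl⟩).trans (le_max_right _ _)
  have h2 : Real.exp (-(c * z.im)) ≤ max 1 B' * z.im ^ (-M) := by
    rw [Real.rpow_neg hz0.le, ← div_eq_mul_inv, le_div_iff₀ (Real.rpow_pos_of_pos hz0 M),
      mul_comm, ← neg_mul]
    exact h1
  calc ‖F z‖ ≤ C * Real.exp (-(c * z.im)) := hC z hz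
    _ ≤ C * (max 1 B' * z.im ^ (-M)) := by gcongr
    _ = _ := by ring

theorem exists_norm_le (h : ExpSeries b κ m A F) : ∃ C : ℝ, 0 ≤ C ∧ ∀ z : ℂ, 0 < z.im →
    ‖F z‖ ≤ C * z.im ^ (-A) := by
  obtain ⟨C₁, h₁⟩ := h.bound
  obtain ⟨C₂, h₂0, h₂⟩ := h.exists_decay A
  refine ⟨max C₁ C₂, le_max_of_le_right h₂0, fun z hz => ?_⟩
  have := Real.rpow_nonneg hz.le (-A)
  rcases le_total z.im 1 with hz1 | hz1
  · exact (h₁ z hz hz1).trans (mul_le_mul_of_nonneg_right (le_max_left _ _) this)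
  · exact (h₂ z (by linarith)).trans (mul_le_mul_of_nonneg_right (le_max_right _ _) this)

end ExpSeries

theorem ex_add (l : ℝ) (z w : ℂ) : ex l (z + w) = ex l z * ex l w := by
  rw [ex, ex, ex, ← Complex.exp_add]; congr 1; ring

theorem ex_add_left (l l' : ℝ) (z : ℂ) : ex (l + l') z = ex l z * ex l' z := by
  rw [ex, ex, ex, ← Complex.exp_add]; congr 1; push_cast; ring

theorem continuous_ex (l : ℝ) : Continuous (ex l) := by unfold ex; fun_prop

theorem hasDerivAt_ex (l : ℝ) (z : ℂ) : HasDerivAt (ex l) (2 * Real.pi * I * l * ex l z) z := by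
  have : HasDerivAt (fun z : ℂ => 2 * Real.pi * I * l * z) (2 * Real.pi * I * l) z := by
    simpa using (hasDerivAt_id z).const_mul (2 * Real.pi * I * l : ℂ)
  rw [mul_comm]
  exact this.cexp

theorem integral_ex_int_div (hm : 0 < m) (k : ℤ) :
    ∫ t in (0 : ℝ)..m, ex (k / m) t = if k = 0 then (m : ℂ) else 0 := by
  have hm' : (m : ℂ) ≠ 0 := ofReal_ne_zero.2 hm.ne'
  split_ifs with hk
  · simp [hk, ex]
  · have hc : (2 * Real.pi * I * ((k / m : ℝ) : ℂ)) ≠ 0 := by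
      refine mul_ne_zero two_pi_I_ne_zero ?_
      simp [hk, hm.ne']
    simp only [ex]
    rw [integral_exp_mul_complex hc]
    have : 2 * (Real.pi : ℂ) * I * ((k / m : ℝ) : ℂ) * m = k * (2 * Real.pi * I) := by
      push_cast; field_simp
    rw [this, exp_int_mul_two_pi_mul_I]
    simp

/-- The frequencies differ by integers divided by m, so the exponentials are orthogonal on a
horizontal segment of length m, whatever κ is. -/
theorem ExpSeries.integral_mul_ex (h : ExpSeries b κ m A F) {z : ℂ} (hz : 0 < z.im) (n : ℕ) :
    ∫ t in (0 : ℝ)..m, F (z + t) * ex (-((n + κ) / m)) t = m * (b n * ex ((n + κ) / m) z) := by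
  have hm := h.pos
  have hs := intervalIntegral.hasSum_integral_of_dominated_convergence (μ := volume) (a := 0)
    (b := m) (F := fun (k : ℕ) (t : ℝ) => b k * ex ((k + κ) / m) (z + t) * ex (-((n + κ) / m)) t)
    (f := fun t => F (z + t) * ex (-((n + κ) / m)) t)
    (fun k _ => ‖b k * ex ((k + κ) / m) z‖) (fun k => by
      refine Continuous.aestronglyMeasurable ?_
      have := continuous_ex ((k + κ) / m)
      have := continuous_ex (-((n + κ) / m))
      fun_prop) (fun k => by
      refine Eventually.of_forall fun t _ => ?_
      rw [norm_mul, norm_ex_ofReal, mul_one, ex_add, ← mul_assoc, norm_mul, norm_ex_ofReal, mul_one])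
    (Eventually.of_forall fun t _ => (h.hasSum z hz).summable.norm)
    (by simp)
    (Eventually.of_forall fun t _ => (h.hasSum (z + t) (by simpa using hz)).mul_right _)
  have hterm : ∀ k : ℕ, ∫ t in (0 : ℝ)..m,
      b k * ex ((k + κ) / m) (z + t) * ex (-((n + κ) / m)) t =
      if k = n then m * (b n * ex ((n + κ) / m) z) else 0 := by
    intro k
    have : ∀ t : ℝ, b k * ex ((k + κ) / m) (z + t) * ex (-((n + κ) / m)) t =
        b k * ex ((k + κ) / m) z * ex (((k - n : ℤ) : ℝ) / m) t := by
      intro t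
      have e : ((k - n : ℤ) : ℝ) / m = (k + κ) / m + -((n + κ) / m) := by push_cast; ring
      rw [e, ex_add_left, ex_add]
      ring
    simp only [this]
    rw [intervalIntegral.integral_const_mul, integral_ex_int_div hm]
    by_cases hk : k = n
    · subst hk; simp; ring
    · have : (k : ℤ) - n ≠ 0 := by omega
      simp [hk, this]
  simp only [hterm] at hs
  have h2 := hasSum_ite_eq n (m * (b n * ex ((n + κ) / m) z))
  exact hs.unique h2

theorem ex_ofReal_mul_I (l y : ℝ) : ex l (y * I) = (Real.exp (-(2 * Real.pi * l * y)) : ℝ) := by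
  rw [ex, ofReal_exp]
  congr 1
  push_cast
  linear_combination (2 * Real.pi * l * y : ℂ) * I_sq

/-- Bound for a truncated geometric series outside the unit disc. -/
theorem norm_geom_sum_le {w : ℂ} {N : ℕ} {R s : ℝ} (hw : 1 ≤ ‖w‖) (hR : ‖w‖ ^ N ≤ R)
    (hs : 0 < s) (hs' : s ≤ ‖w - 1‖) {ε : ℝ} (hε0 : 0 ≤ ε) (hε1 : ε ≤ 1) :
    ‖∑ n ∈ Finset.range N, w ^ n‖ ≤ 2 * R * (N : ℝ) ^ ε * (1 / s) ^ (1 - ε) := by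
  have hw1 : w ≠ 1 := by
    rintro rfl; simp at hs'; linarith
  have hR1 : 1 ≤ R := (one_le_pow₀ hw).trans hR
  have h1 : ‖∑ n ∈ Finset.range N, w ^ n‖ ≤ 2 * R * N := by
    refine (norm_sum_le _ _).trans ?_
    calc ∑ n ∈ Finset.range N, ‖w ^ n‖ ≤ ∑ n ∈ Finset.range N, R := by
          refine Finset.sum_le_sum fun n hn => ?_
          rw [norm_pow]
          exact (pow_le_pow_right₀ hw (Finset.mem_range.1 hn).le).trans hR
      _ = N * R := by simp
      _ ≤ 2 * R * N := by
          have : (0 : ℝ) ≤ N := N.cast_nonneg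
          nlinarith
  have h2 : ‖∑ n ∈ Finset.range N, w ^ n‖ ≤ 2 * R * (1 / s) := by
    rw [geom_sum_eq hw1, norm_div]
    have h3 : ‖w ^ N - 1‖ ≤ 2 * R := by
      refine (norm_sub_le _ _).trans ?_
      rw [norm_pow, norm_one]; linarith
    rw [mul_one_div]
    exact div_le_div₀ (by linarith) h3 hs hs'
  set T := ‖∑ n ∈ Finset.range N, w ^ n‖ with hT
  have hT0 : 0 ≤ T := norm_nonneg _
  rcases hT0.eq_or_lt with h0 | h0
  · rw [← h0]; positivity
  -- A geometric mean of the trivial bound N and the closed form bound 1/s. It replaces the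
  -- non-integrable singularity 1/s by an integrable one, at the cost of N^ε.
  calc T = T ^ ε * T ^ (1 - ε) := by rw [← Real.rpow_add h0]; simp
    _ ≤ (2 * R * N) ^ ε * (2 * R * (1 / s)) ^ (1 - ε) := by
        have : 0 ≤ 1 - ε := by linarith
        gcongr
    _ = (2 * R) ^ ε * (2 * R) ^ (1 - ε) * (N : ℝ) ^ ε * (1 / s) ^ (1 - ε) := by
        rw [Real.mul_rpow (x := 2 * R) (by positivity) (by positivity),
          Real.mul_rpow (x := 2 * R) (by positivity) (by positivity)]
        ring
    _ = _ := by
        rw [← Real.rpow_add (by positivity)]; simp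

/-- |ρe^{-iθ}-1|² = (ρ-1)² + 4ρ sin²(θ/2). -/
theorem le_norm_sub_one {ρ θ : ℝ} (hρ : 1 ≤ ρ) : 2 * |Real.sin (θ / 2)| ≤ ‖ρ * exp (-(θ * I)) - 1‖ := by
  apply abs_le_of_sq_le_sq' _ (norm_nonneg _) |>.2
  rw [← Complex.normSq_eq_norm_sq, Complex.normSq_apply]
  have h1 : (ρ * exp (-(θ * I)) - 1).re = ρ * Real.cos θ - 1 := by
    rw [← neg_mul, ← ofReal_neg, exp_mul_I]; simp [cos_ofReal_re, sin_ofReal_re]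
  have h2 : (ρ * exp (-(θ * I)) - 1).im = -(ρ * Real.sin θ) := by
    rw [← neg_mul, ← ofReal_neg, exp_mul_I]; simp [cos_ofReal_re, sin_ofReal_re]
  rw [h1, h2, mul_pow, sq_abs]
  have h3 : Real.cos θ = 1 - 2 * Real.sin (θ / 2) ^ 2 := by
    have := Real.cos_sq' (θ / 2)
    have h4 := Real.cos_two_mul (θ / 2)
    rw [mul_div_cancel₀ θ (two_ne_zero)] at h4
    linarith
  have h5 := Real.sin_sq_add_cos_sq θ
  have h6 : 0 ≤ Real.sin (θ / 2) ^ 2 := sq_nonneg _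
  nlinarith [mul_nonneg (sub_nonneg.2 hρ) h6, sq_nonneg (ρ - 1)]

theorem min_le_abs_sin {t m : ℝ} (hm : 0 < m) (ht : 0 < t) (htm : t < m) :
    1 / (2 * |Real.sin (2 * Real.pi * t / m / 2)|) ≤ m / 4 * (1 / t + 1 / (m - t)) := by
  have hpi := Real.pi_pos
  have key : ∀ u : ℝ, 0 < u → u ≤ m / 2 → 4 * u / m ≤ 2 * |Real.sin (Real.pi * u / m)| := by
    intro u hu hum
    have h1 : Real.pi * u / m ≤ Real.pi / 2 := by
      rw [div_le_div_iff₀ hm two_pos]; nlinarith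
    have h2 := Real.mul_le_sin (x := Real.pi * u / m) (by positivity) h1
    have h3 : 2 / Real.pi * (Real.pi * u / m) = 2 * u / m := by field_simp
    rw [h3] at h2
    have h4 := le_abs_self (Real.sin (Real.pi * u / m))
    have : 4 * u / m = 2 * (2 * u / m) := by ring
    linarith
  have e : 2 * Real.pi * t / m / 2 = Real.pi * t / m := by ring
  rw [e]
  have hmt : 0 < m - t := sub_pos.2 htm
  rcases le_total t (m / 2) with h | h
  · have h1 := one_div_le_one_div_of_le (by positivity) (key t ht h)
    refine h1.trans ?_
    have : 1 / (4 * t / m) = m / 4 * (1 / t) := by field_simp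
    rw [this]
    have : 0 < 1 / (m - t) := by positivity
    gcongr
    linarith
  · have h1 := one_div_le_one_div_of_le (by positivity) (key (m - t) hmt (by linarith))
    have e2 : Real.pi * (m - t) / m = Real.pi - Real.pi * t / m := by field_simp
    rw [e2, Real.sin_pi_sub] at h1
    refine h1.trans ?_
    have : 1 / (4 * (m - t) / m) = m / 4 * (1 / (m - t)) := by field_simp
    rw [this]
    have : 0 < 1 / t := by positivity
    gcongr
    linarith

/-- The partial sums of the series grow at most like `N^{A'}` on the closed half-plane. -/
theorem ExpSeries.exists_norm_sum_le (h : ExpSeries b κ m A F) {A' : ℝ} (hA : A < A') :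
    ∃ C : ℝ, 0 ≤ C ∧ ∀ N : ℕ, 1 ≤ N → ∀ z : ℂ, 0 ≤ z.im →
      ‖∑ n ∈ Finset.range N, b n * ex ((n + κ) / m) z‖ ≤ C * (N : ℝ) ^ A' := by
  have hm := h.pos
  have hpi := Real.pi_pos
  obtain ⟨C, hC0, hC⟩ := h.exists_norm_le
  set ε := min 1 (A' - A) with hε
  have hε0 : 0 < ε := lt_min one_pos (sub_pos.2 hA)
  have hε1 : ε ≤ 1 := min_le_left _ _
  have hεA : ε ≤ A' - A := min_le_right _ _
  set R := Real.exp (2 * Real.pi / m) with hR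
  set R' := Real.exp (2 * Real.pi * κ / m) with hR'
  set W : ℝ → ℝ := fun t => t ^ (-(1 - ε)) + (m - t) ^ (-(1 - ε)) with hW
  have hWi1 : IntervalIntegrable (fun t : ℝ => t ^ (-(1 - ε))) volume 0 m :=
    intervalIntegral.intervalIntegrable_rpow' (by linarith)
  have hWi2 : IntervalIntegrable (fun t : ℝ => (m - t) ^ (-(1 - ε))) volume 0 m := by
    have := hWi1.comp_sub_left m
    simpa using this.symm
  have hWi : IntervalIntegrable W volume 0 m := hWi1.add hWi2
  have hW0 : 0 ≤ ∫ t in (0 : ℝ)..m, W t := by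
    refine intervalIntegral.integral_nonneg hm.le fun t ht => ?_
    exact add_nonneg (Real.rpow_nonneg ht.1 _) (Real.rpow_nonneg (sub_nonneg.2 ht.2) _)
  set K := C * (R' * (2 * R * (m / 4) ^ (1 - ε))) with hK
  refine ⟨m⁻¹ * (K * ∫ t in (0 : ℝ)..m, W t), by positivity, fun N hN z hz => ?_⟩
  have hN1 : (1 : ℝ) ≤ N := by exact_mod_cast hN
  have hN0 : (0 : ℝ) < N := by linarith
  -- At height at least 1/N the function F is O(N^A), while the factors e^{2πλy} that undo the
  -- vertical shift stay bounded for n < N.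
  set y : ℝ := 1 / N with hy
  have hy0 : 0 < y := by positivity
  have hy1 : y ≤ 1 := by rw [hy, div_le_one hN0]; exact hN1
  have hyN : y * N = 1 := by rw [hy]; field_simp
  set ζ : ℂ := z + y * I with hζ
  have hζim : ζ.im = z.im + y := by simp [hζ]
  have hζ0 : 0 < ζ.im := by rw [hζim]; linarith
  -- The partial sum is the mean over a period of F(ζ+t) against this kernel, a truncated geometric
  -- series. The kernel is O(N^ε W(t)) with W integrable, so the total is O(N^{A+ε}), and A+ε ≤ A'.
  set D : ℝ → ℂ := fun t => ∑ n ∈ Finset.range N,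
    (Real.exp (2 * Real.pi * ((n + κ) / m) * y) : ℂ) * ex (-((n + κ) / m)) t with hD
  have hrepr : ∑ n ∈ Finset.range N, b n * ex ((n + κ) / m) z =
      (m : ℂ)⁻¹ * ∫ t in (0 : ℝ)..m, F (ζ + t) * D t := by
    have hFc : Continuous fun t : ℝ => F (ζ + t) := by
      refine h.holo.continuousOn.comp_continuous (by fun_prop) fun t => ?_
      change 0 < (ζ + t).im
      simpa using hζ0
    have h1 : ∀ t : ℝ, F (ζ + t) * D t = ∑ n ∈ Finset.range N,
        (Real.exp (2 * Real.pi * ((n + κ) / m) * y) : ℂ) *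
          (F (ζ + t) * ex (-((n + κ) / m)) t) := by
      intro t
      rw [hD, Finset.mul_sum]
      exact Finset.sum_congr rfl fun n _ => by ring
    simp only [h1]
    rw [intervalIntegral.integral_finsetSum, Finset.mul_sum]
    · refine Finset.sum_congr rfl fun n _ => ?_
      rw [intervalIntegral.integral_const_mul, h.integral_mul_ex hζ0, hζ, ex_add, ex_ofReal_mul_I]
      have hm' : (m : ℂ) ≠ 0 := ofReal_ne_zero.2 hm.ne'
      have : (Real.exp (2 * Real.pi * ((n + κ) / m) * y) : ℂ) *
          (Real.exp (-(2 * Real.pi * ((n + κ) / m) * y)) : ℝ) = 1 := by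
        rw [← ofReal_mul, ← Real.exp_add]; simp
      linear_combination (-(b n * ex ((n + κ) / m) z)) * this -
        ((Real.exp (2 * Real.pi * ((n + κ) / m) * y) : ℂ) *
          (Real.exp (-(2 * Real.pi * ((n + κ) / m) * y)) : ℝ) * (b n * ex ((n + κ) / m) z)) *
          inv_mul_cancel₀ hm'
    · intro n _
      have := (continuous_ex (-((n + κ) / m))).comp continuous_ofReal
      exact (continuous_const.mul (hFc.mul this)).intervalIntegrable _ _
  have hDbound : ∀ t ∈ Set.Ioo 0 m, ‖D t‖ ≤ R' * (2 * R * (m / 4) ^ (1 - ε)) * (N : ℝ) ^ ε * W t := by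
    intro t ht
    set ρ := Real.exp (2 * Real.pi * y / m) with hρ
    set w : ℂ := ρ * exp (-(((2 * Real.pi * t / m : ℝ) : ℂ) * I)) with hw
    have hρ1 : 1 ≤ ρ := Real.one_le_exp (by positivity)
    have hwn : ‖w‖ = ρ := by
      rw [hw, norm_mul, ← neg_mul, ← ofReal_neg, Complex.norm_exp_ofReal_mul_I, mul_one,
        Complex.norm_real, Real.norm_of_nonneg (by positivity)]
    have hterm : ∀ n : ℕ, (Real.exp (2 * Real.pi * ((n + κ) / m) * y) : ℂ) *
        ex (-((n + κ) / m)) t = ((Real.exp (2 * Real.pi * (κ / m) * y) : ℂ) *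
          ex (-(κ / m)) t) * w ^ n := by
      intro n
      rw [hw, mul_pow, hρ, ← Complex.exp_nat_mul, ← ofReal_pow, ← Real.exp_nat_mul, ex, ex,
        ofReal_exp, ofReal_exp, ofReal_exp, ← Complex.exp_add, ← Complex.exp_add,
        ← Complex.exp_add, ← Complex.exp_add]
      congr 1
      push_cast
      field_simp
      ring
    have hDt : D t = ((Real.exp (2 * Real.pi * (κ / m) * y) : ℂ) * ex (-(κ / m)) t) *
        ∑ n ∈ Finset.range N, w ^ n := by
      rw [hD, Finset.mul_sum]
      exact Finset.sum_congr rfl fun n _ => hterm n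
    have hsin : 0 < |Real.sin (2 * Real.pi * t / m / 2)| := by
      have e : 2 * Real.pi * t / m / 2 = Real.pi * t / m := by ring
      rw [e]
      refine abs_pos.2 (Real.sin_pos_of_pos_of_lt_pi (by have := ht.1; positivity) ?_).ne'
      rw [div_lt_iff₀ hm]
      nlinarith [ht.2]
    have hgeom := norm_geom_sum_le (w := w) (N := N) (R := R)
      (s := 2 * |Real.sin (2 * Real.pi * t / m / 2)|) (by rw [hwn]; exact hρ1) (by
        rw [hwn, hρ, ← Real.exp_nat_mul, hR]
        apply le_of_eq
        congr 1
        have : (N : ℝ) * (2 * Real.pi * y / m) = 2 * Real.pi * (y * N) / m := by ring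
        rw [this, hyN, mul_one]) (by positivity) (le_norm_sub_one hρ1) hε0.le hε1
    have ht0 := ht.1
    have htm : 0 < m - t := sub_pos.2 ht.2
    have hsW : (1 / (2 * |Real.sin (2 * Real.pi * t / m / 2)|)) ^ (1 - ε) ≤
        (m / 4) ^ (1 - ε) * W t := by
      calc (1 / (2 * |Real.sin (2 * Real.pi * t / m / 2)|)) ^ (1 - ε)
          ≤ (m / 4 * (1 / t + 1 / (m - t))) ^ (1 - ε) := by
            refine Real.rpow_le_rpow (by positivity) (min_le_abs_sin hm ht.1 ht.2) (by linarith)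
        _ = (m / 4) ^ (1 - ε) * (1 / t + 1 / (m - t)) ^ (1 - ε) :=
            Real.mul_rpow (by positivity) (by positivity)
        _ ≤ (m / 4) ^ (1 - ε) * ((1 / t) ^ (1 - ε) + (1 / (m - t)) ^ (1 - ε)) := by
            gcongr
            exact Real.rpow_add_le_add_rpow (by positivity) (by positivity) (by linarith)
              (by linarith)
        _ = _ := by
            rw [one_div, one_div, Real.inv_rpow ht0.le, Real.inv_rpow htm.le,
              ← Real.rpow_neg ht0.le, ← Real.rpow_neg htm.le]
    have hfac : ‖(Real.exp (2 * Real.pi * (κ / m) * y) : ℂ) * ex (-(κ / m)) t‖ ≤ R' := by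
      rw [norm_mul, norm_ex_ofReal, mul_one, Complex.norm_real, Real.norm_of_nonneg
        (Real.exp_nonneg _), hR']
      apply Real.exp_le_exp.2
      have := h.nonneg
      have : 0 ≤ 2 * Real.pi * (κ / m) := by positivity
      calc 2 * Real.pi * (κ / m) * y ≤ 2 * Real.pi * (κ / m) * 1 := by gcongr
        _ = _ := by ring
    rw [hDt, norm_mul]
    calc _ ≤ R' * (2 * R * (N : ℝ) ^ ε * ((m / 4) ^ (1 - ε) * W t)) := by
          refine mul_le_mul hfac (hgeom.trans ?_) (norm_nonneg _) (by positivity)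
          gcongr
      _ = _ := by ring
  have hint : ‖∫ t in (0 : ℝ)..m, F (ζ + t) * D t‖ ≤
      ∫ t in (0 : ℝ)..m, K * (N : ℝ) ^ A' * W t := by
    have hae : ∀ᵐ t : ℝ, t ∈ Set.Ioc 0 m → ‖F (ζ + t) * D t‖ ≤ K * (N : ℝ) ^ A' * W t := by
      have hne : ∀ᵐ t : ℝ, t ≠ m := by
        simp [ae_iff, measure_singleton]
      filter_upwards [hne] with t htm ht
      have ht' : t ∈ Set.Ioo 0 m := ⟨ht.1, lt_of_le_of_ne ht.2 htm⟩
      have hF : ‖F (ζ + t)‖ ≤ C * (N : ℝ) ^ A := by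
        have him : (ζ + t).im = z.im + y := by simp [hζim]
        refine (hC (ζ + t) (by rw [him]; linarith)).trans ?_
        rw [him]
        have e : (N : ℝ) ^ A = y ^ (-A) := by
          rw [hy, one_div, Real.inv_rpow hN0.le, Real.rpow_neg hN0.le, inv_inv]
        rw [e]
        have hA0 := h.pos_exponent
        exact mul_le_mul_of_nonneg_left
          (Real.rpow_le_rpow_of_nonpos hy0 (by linarith) (by linarith)) hC0
      have hWt : 0 ≤ W t := add_nonneg (Real.rpow_nonneg ht'.1.le _)
        (Real.rpow_nonneg (sub_nonneg.2 ht'.2.le) _)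
      rw [norm_mul]
      calc ‖F (ζ + t)‖ * ‖D t‖ ≤ (C * (N : ℝ) ^ A) *
            (R' * (2 * R * (m / 4) ^ (1 - ε)) * (N : ℝ) ^ ε * W t) :=
            mul_le_mul hF (hDbound t ht') (norm_nonneg _) (by positivity)
        _ = K * ((N : ℝ) ^ A * (N : ℝ) ^ ε) * W t := by rw [hK]; ring
        _ ≤ K * (N : ℝ) ^ A' * W t := by
            rw [← Real.rpow_add hN0]
            gcongr
            linarith
    exact intervalIntegral.norm_integral_le_of_norm_le hm.le hae (hWi.const_mul _)
  rw [hrepr, norm_mul, norm_inv, Complex.norm_real, Real.norm_of_nonneg hm.le]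
  rw [intervalIntegral.integral_const_mul] at hint
  calc m⁻¹ * ‖∫ t in (0 : ℝ)..m, F (ζ + t) * D t‖
      ≤ m⁻¹ * (K * (N : ℝ) ^ A' * ∫ t in (0 : ℝ)..m, W t) := by gcongr
    _ = _ := by ring

end FracModular

end

/-! ### Convergence and differentiation of fractional integrals -/

section

namespace FracModular

open Complex Filter MeasureTheory

/-- The terms of the fractional integral of order `α` of a series of exponentials. -/
def fracTerm (b : ℕ → ℂ) (κ m α : ℝ) (n : ℕ) (z : ℂ) : ℂ :=
  b n / ((((n : ℝ) + κ) ^ α : ℝ) : ℂ) * ex ((n + κ) / m) z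

/-- The partial sums of the fractional integral of order `α`. -/
def fracSeries (b : ℕ → ℂ) (κ m α : ℝ) (N : ℕ) (z : ℂ) : ℂ :=
  ∑ n ∈ Finset.range N, fracTerm b κ m α n z

/-- The fractional integral of order `α` of a series of exponentials. -/
def fracLim (b : ℕ → ℂ) (κ m α : ℝ) (z : ℂ) : ℂ :=
  limUnder atTop fun N => fracSeries b κ m α N z

variable {b : ℕ → ℂ} {κ m A α : ℝ} {F : ℂ → ℂ}

theorem continuous_fracSeries (N : ℕ) : Continuous (fracSeries b κ m α N) := by
  unfold fracSeries fracTerm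
  exact continuous_finsetSum _ fun n _ => continuous_const.mul (continuous_ex _)

theorem inv_rpow_sub_inv_rpow_le (hα : 0 < α) {s : ℝ} (hs : 0 < s) :
    0 ≤ (s ^ α)⁻¹ - ((s + 1) ^ α)⁻¹ ∧ (s ^ α)⁻¹ - ((s + 1) ^ α)⁻¹ ≤ α * s ^ (-α - 1) := by
  have hs1 : 0 < s + 1 := by linarith
  constructor
  · rw [sub_nonneg]
    apply inv_anti₀ (by positivity)
    exact Real.rpow_le_rpow hs.le (by linarith) hα.le
  · have h1 : 1 - α / s ≤ ((s + 1) / s) ^ (-α) := by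
      rw [Real.rpow_def_of_pos (by positivity)]
      have h2 := Real.add_one_le_exp (Real.log ((s + 1) / s) * -α)
      have h3 := Real.log_le_sub_one_of_pos (show 0 < (s + 1) / s by positivity)
      have h4 : (s + 1) / s - 1 = 1 / s := by field_simp; ring
      rw [h4] at h3
      have h5 : α / s = 1 / s * α := by ring
      rw [h5]
      nlinarith
    have h2 : ((s + 1) ^ α)⁻¹ = (s ^ α)⁻¹ * ((s + 1) / s) ^ (-α) := by
      rw [Real.div_rpow hs1.le hs.le, Real.rpow_neg hs1.le, Real.rpow_neg hs.le]
      have := (Real.rpow_pos_of_pos hs α).ne'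
      field_simp
    have h3 : s ^ (-α - 1) = (s ^ α)⁻¹ * (1 / s) := by
      rw [Real.rpow_sub hs, Real.rpow_neg hs.le, Real.rpow_one]; ring
    have h4 : 0 < (s ^ α)⁻¹ := by positivity
    rw [h2, h3]
    have : α * ((s ^ α)⁻¹ * (1 / s)) = (s ^ α)⁻¹ * (α / s) := by ring
    rw [this]
    nlinarith

theorem exists_abs_inv_rpow_sub_le (hκ : 0 ≤ κ) (hα : 0 < α) : ∃ K : ℝ, 0 ≤ K ∧ ∀ n : ℕ,
    |(((n : ℝ) + κ) ^ α)⁻¹ - (((n + 1 : ℕ) + κ : ℝ) ^ α)⁻¹| ≤ K * ((n : ℝ) + 1) ^ (-α - 1) := by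
  refine ⟨max |(((0 : ℕ) + κ : ℝ) ^ α)⁻¹ - (((0 + 1 : ℕ) + κ : ℝ) ^ α)⁻¹|
    (α * (1 / 2 : ℝ) ^ (-α - 1)), le_max_of_le_left (abs_nonneg _), fun n => ?_⟩
  -- The index 0 is treated apart: for κ = 0 the base is 0 and its inverse power takes the default
  -- value 0, so the mean value estimate is not available.
  rcases Nat.eq_zero_or_pos n with rfl | hn
  · refine le_trans ?_ (mul_le_mul_of_nonneg_right (le_max_left _ _) (by positivity))
    simp
  · have hn1 : (1 : ℝ) ≤ n := by exact_mod_cast hn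
    have hs : 0 < (n : ℝ) + κ := by linarith
    obtain ⟨h1, h2⟩ := inv_rpow_sub_inv_rpow_le hα hs
    have e : ((n + 1 : ℕ) + κ : ℝ) = (n + κ) + 1 := by push_cast; ring
    rw [e, abs_of_nonneg h1]
    refine h2.trans (le_trans ?_ (mul_le_mul_of_nonneg_right (le_max_right _ _) (by positivity)))
    rw [mul_assoc, ← Real.mul_rpow (by norm_num) (by positivity)]
    refine mul_le_mul_of_nonneg_left ?_ hα.le
    exact Real.rpow_le_rpow_of_nonpos (by positivity) (by linarith) (by linarith)

/-- Summation by parts with A < A' < α. The partial sums without weights are O(N^{A'}) uniformly on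
the closed half-plane, and the weights (n+κ)^{-α} have differences O((n+1)^{-α-1}). So the boundary
term tends to 0 and the remaining series has the summable majorant (n+1)^{A'-α-1}. -/
theorem ExpSeries.tendstoUniformlyOn_fracSeries (h : ExpSeries b κ m A F) (hα : A < α) :
    TendstoUniformlyOn (fracSeries b κ m α) (fracLim b κ m α) atTop {z | 0 ≤ z.im} := by
  have hα0 : 0 < α := h.pos_exponent.trans hα
  obtain ⟨A', hA1, hA2⟩ := exists_between hα
  obtain ⟨C, hC0, hC⟩ := h.exists_norm_sum_le hA1
  obtain ⟨K, hK0, hK⟩ := exists_abs_inv_rpow_sub_le h.nonneg hα0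
  set S : ℕ → ℂ → ℂ := fun N z => ∑ n ∈ Finset.range N, b n * ex ((n + κ) / m) z with hS
  set c : ℕ → ℝ := fun n => (((n : ℝ) + κ) ^ α)⁻¹ with hc
  have hparts : ∀ N z, fracSeries b κ m α N z = S N z * (c N : ℂ) +
      ∑ n ∈ Finset.range N, S (n + 1) z * ((c n - c (n + 1) : ℝ) : ℂ) := by
    intro N z
    induction N with
    | zero => simp [fracSeries, hS]
    | succ N ih =>
      have h1 : fracSeries b κ m α (N + 1) z = fracSeries b κ m α N z +
          b N * ex ((N + κ) / m) z * c N := by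
        rw [fracSeries, Finset.sum_range_succ, ← fracSeries, fracTerm]
        congr 1
        rw [hc]; push_cast; ring
      have h2 : S (N + 1) z = S N z + b N * ex ((N + κ) / m) z := by
        simp only [hS, Finset.sum_range_succ]
      rw [h1, ih, Finset.sum_range_succ (n := N), h2]
      push_cast
      ring
  set M : ℕ → ℝ := fun n => C * K * ((n : ℝ) + 1) ^ (A' - α - 1) with hM
  have hMs : Summable M := by
    refine Summable.mul_left _ ?_
    have : Summable fun n : ℕ => ((n : ℝ)) ^ (A' - α - 1) :=
      Real.summable_nat_rpow.2 (by linarith)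
    have h2 := (summable_nat_add_iff 1).2 this
    simpa using h2
  have hterm : ∀ n : ℕ, ∀ z ∈ {z : ℂ | 0 ≤ z.im},
      ‖S (n + 1) z * ((c n - c (n + 1) : ℝ) : ℂ)‖ ≤ M n := by
    intro n z hz
    rw [norm_mul, Complex.norm_real, Real.norm_eq_abs]
    have h1 := hC (n + 1) (by omega) z hz
    have h2 := hK n
    push_cast at h1
    have hn : (0 : ℝ) < (n : ℝ) + 1 := by positivity
    calc _ ≤ (C * ((n : ℝ) + 1) ^ A') * (K * ((n : ℝ) + 1) ^ (-α - 1)) :=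
          mul_le_mul h1 h2 (abs_nonneg _) (by positivity)
      _ = C * K * (((n : ℝ) + 1) ^ A' * ((n : ℝ) + 1) ^ (-α - 1)) := by ring
      _ = M n := by rw [← Real.rpow_add hn, hM]; congr 2; ring
  have hU2 := tendstoUniformlyOn_tsum_nat hMs hterm
  have hU1 : TendstoUniformlyOn (fun N z => S N z * (c N : ℂ)) (fun _ => 0) atTop
      {z | 0 ≤ z.im} := by
    rw [Metric.tendstoUniformlyOn_iff]
    intro ε hε
    have ht : Tendsto (fun N : ℕ => C * (N : ℝ) ^ (-(α - A'))) atTop (𝓝 (C * 0)) :=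
      ((tendsto_rpow_neg_atTop (by linarith)).comp tendsto_natCast_atTop_atTop).const_mul C
    rw [mul_zero] at ht
    filter_upwards [ht.eventually (gt_mem_nhds hε), eventually_ge_atTop 1] with N hN hN1 z hz
    rw [dist_zero_left, norm_mul, Complex.norm_real]
    refine lt_of_le_of_lt ?_ hN
    have hN0 : (0 : ℝ) < N := by exact_mod_cast hN1
    have h1 : ‖c N‖ ≤ (N : ℝ) ^ (-α) := by
      have := h.nonneg
      rw [hc, Real.norm_of_nonneg (by positivity), Real.rpow_neg hN0.le]
      apply inv_anti₀ (by positivity)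
      exact Real.rpow_le_rpow hN0.le (by linarith) hα0.le
    calc ‖S N z‖ * ‖c N‖ ≤ (C * (N : ℝ) ^ A') * (N : ℝ) ^ (-α) :=
          mul_le_mul (hC N hN1 z hz) h1 (norm_nonneg _) (by positivity)
      _ = C * (N : ℝ) ^ (-(α - A')) := by
          rw [mul_assoc, ← Real.rpow_add hN0]; congr 2; ring
  have hU := hU1.add hU2
  have hU' : TendstoUniformlyOn (fracSeries b κ m α)
      (fun z => 0 + ∑' n, S (n + 1) z * ((c n - c (n + 1) : ℝ) : ℂ)) atTop {z | 0 ≤ z.im} :=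
    hU.congr (Eventually.of_forall fun N z _ => (hparts N z).symm)
  refine hU'.congr_right fun z hz => ?_
  exact (hU'.tendsto_at hz).limUnder_eq.symm

theorem ExpSeries.tendsto_fracSeries (h : ExpSeries b κ m A F) (hα : A < α) {z : ℂ}
    (hz : 0 ≤ z.im) :
    Tendsto (fun N => fracSeries b κ m α N z) atTop (𝓝 (fracLim b κ m α z)) :=
  (h.tendstoUniformlyOn_fracSeries hα).tendsto_at hz

theorem ExpSeries.continuousOn_fracLim (h : ExpSeries b κ m A F) (hα : A < α) :
    ContinuousOn (fracLim b κ m α) {z | 0 ≤ z.im} :=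
  (h.tendstoUniformlyOn_fracSeries hα).continuousOn
    (Frequently.of_forall fun N => (continuous_fracSeries N).continuousOn)

theorem ExpSeries.tendstoUniformly_real (h : ExpSeries b κ m A F) (hα : A < α) :
    TendstoUniformly (fun N (x : ℝ) => fracSeries b κ m α N x)
      (fun x : ℝ => fracLim b κ m α x) atTop := by
  rw [Metric.tendstoUniformly_iff]
  intro ε hε
  have := (Metric.tendstoUniformlyOn_iff.1 (h.tendstoUniformlyOn_fracSeries hα)) ε hε
  filter_upwards [this] with N hN x
  exact hN x (by simp)

theorem ExpSeries.continuous_fracLim (h : ExpSeries b κ m A F) (hα : A < α) :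
    Continuous fun x : ℝ => fracLim b κ m α x :=
  (h.continuousOn_fracLim hα).comp_continuous continuous_ofReal fun x => by simp

theorem ExpSeries.hasDerivAt_fracLim (h : ExpSeries b κ m A F) (hα : A < α - 1) (x : ℝ) :
    HasDerivAt (fun x : ℝ => fracLim b κ m α x) (2 * Real.pi * I / m * fracLim b κ m (α - 1) x)
      x := by
  have hU := (h.tendstoUniformly_real hα)
  have hU' : TendstoUniformly (fun N (x : ℝ) => 2 * Real.pi * I / m * fracSeries b κ m (α - 1) N x)
      (fun x : ℝ => 2 * Real.pi * I / m * fracLim b κ m (α - 1) x) atTop := by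
    have huc : UniformContinuous fun w : ℂ => (2 * Real.pi * I / m : ℂ) * w :=
      (ContinuousLinearMap.mul ℂ ℂ (2 * Real.pi * I / m : ℂ)).uniformContinuous
    exact huc.comp_tendstoUniformly hU
  refine hasDerivAt_of_tendstoUniformly hU' (Eventually.of_forall fun N x => ?_)
    (fun x => h.tendsto_fracSeries (by linarith) (by simp)) x
  simp only [fracSeries, Finset.mul_sum]
  refine HasDerivAt.fun_sum fun n _ => ?_
  have h1 := ((hasDerivAt_ex ((n + κ) / m) (x : ℂ)).comp_ofReal).const_mul
    (b n / ((((n : ℝ) + κ) ^ α : ℝ) : ℂ))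
  simp only [fracTerm]
  convert! h1 using 1
  by_cases hn : 0 < (n : ℝ) + κ
  · rw [Real.rpow_sub_one hn.ne']
    have h2 : ((((n : ℝ) + κ) ^ α : ℝ) : ℂ) ≠ 0 :=
      ofReal_ne_zero.2 (Real.rpow_pos_of_pos hn α).ne'
    have h3 : (((n : ℝ) + κ : ℝ) : ℂ) ≠ 0 := ofReal_ne_zero.2 hn.ne'
    have h4 : (m : ℂ) ≠ 0 := ofReal_ne_zero.2 h.pos.ne'
    push_cast at h2 h3 ⊢
    field_simp
  · simp [h.eq_zero n hn]

/-! ### The integral representation -/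

/-- A weight on the half-line which is integrable for `p > 0`. -/
def wt (p u : ℝ) : ℝ := if u ≤ 1 then u ^ (p - 1) else u ^ (-2 : ℝ)

theorem wt_nonneg (p : ℝ) {u : ℝ} (hu : 0 < u) : 0 ≤ wt p u := by
  unfold wt; split_ifs <;> positivity

theorem integrableOn_wt {p : ℝ} (hp : 0 < p) : IntegrableOn (wt p) (Set.Ioi 0) := by
  rw [← Set.Ioc_union_Ioi_eq_Ioi zero_le_one]
  refine IntegrableOn.union ?_ ?_
  · have h1 : IntegrableOn (fun u : ℝ => u ^ (p - 1)) (Set.Ioc 0 1) :=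
      (intervalIntegrable_iff_integrableOn_Ioc_of_le zero_le_one).1
        (intervalIntegral.intervalIntegrable_rpow' (by linarith))
    refine h1.congr_fun (fun u hu => ?_) measurableSet_Ioc
    simp [wt, hu.2]
  · have h1 : IntegrableOn (fun u : ℝ => u ^ (-2 : ℝ)) (Set.Ioi 1) :=
      integrableOn_Ioi_rpow_of_lt (by norm_num) one_pos
    refine h1.congr_fun (fun u hu => ?_) measurableSet_Ioi
    simp [wt, not_le.2 (show (1 : ℝ) < u from hu)]

/-- The integrand in the integral representation is dominated by a weight, uniformly in the base
point. -/
theorem ExpSeries.exists_norm_integrand_le (h : ExpSeries b κ m A F) (hα : A < α) :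
    ∃ C : ℝ, 0 ≤ C ∧ ∀ z : ℂ, 0 ≤ z.im → ∀ u : ℝ, 0 < u →
      ‖((u ^ (α - 1) : ℝ) : ℂ) * F (z + u * I)‖ ≤ C * wt (α - A) u := by
  obtain ⟨C₁, hC₁0, hC₁⟩ := h.exists_norm_le
  obtain ⟨C₂, hC₂0, hC₂⟩ := h.exists_decay (α + 1)
  have hA := h.pos_exponent
  refine ⟨max C₁ C₂, le_max_of_le_left hC₁0, fun z hz u hu => ?_⟩
  have him : (z + u * I).im = z.im + u := by simp
  rw [norm_mul, Complex.norm_real, Real.norm_of_nonneg (Real.rpow_nonneg hu.le _), wt]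
  have hp : 0 < u ^ (α - 1) := Real.rpow_pos_of_pos hu _
  split_ifs with h1
  · have h2 := hC₁ (z + u * I) (by rw [him]; linarith)
    have h3 : (z + u * I).im ^ (-A) ≤ u ^ (-A) :=
      Real.rpow_le_rpow_of_nonpos hu (by rw [him]; linarith) (by linarith)
    calc u ^ (α - 1) * ‖F (z + u * I)‖ ≤ u ^ (α - 1) * (C₁ * u ^ (-A)) := by
          gcongr
          exact h2.trans (by gcongr)
      _ = C₁ * u ^ (α - A - 1) := by
          rw [mul_left_comm, ← Real.rpow_add hu]; congr 2; ring
      _ ≤ _ := by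
          gcongr
          exact le_max_left _ _
  · have h2 := hC₂ (z + u * I) (by rw [him]; linarith)
    have h3 : (z + u * I).im ^ (-(α + 1)) ≤ u ^ (-(α + 1)) :=
      Real.rpow_le_rpow_of_nonpos hu (by rw [him]; linarith) (by linarith)
    calc u ^ (α - 1) * ‖F (z + u * I)‖ ≤ u ^ (α - 1) * (C₂ * u ^ (-(α + 1))) := by
          gcongr
          exact h2.trans (by gcongr)
      _ = C₂ * u ^ (-2 : ℝ) := by
          rw [mul_left_comm, ← Real.rpow_add hu]; congr 2; ring
      _ ≤ _ := by
          gcongr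
          exact le_max_right _ _

theorem ExpSeries.continuousOn_vertical (h : ExpSeries b κ m A F) {z : ℂ} (hz : 0 ≤ z.im) :
    ContinuousOn (fun u : ℝ => F (z + u * I)) (Set.Ioi 0) := by
  refine h.holo.continuousOn.comp (by fun_prop) fun u hu => ?_
  change 0 < (z + u * I).im
  have : (0 : ℝ) < u := hu
  simp
  linarith

theorem ExpSeries.integrableOn_integrand (h : ExpSeries b κ m A F) (hα : A < α) {z : ℂ}
    (hz : 0 ≤ z.im) :
    IntegrableOn (fun u : ℝ => ((u ^ (α - 1) : ℝ) : ℂ) * F (z + u * I)) (Set.Ioi 0) := by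
  obtain ⟨C, -, hC⟩ := h.exists_norm_integrand_le hα
  refine Integrable.mono' ((integrableOn_wt (sub_pos.2 hα)).const_mul C) ?_ ?_
  · refine ContinuousOn.aestronglyMeasurable ?_ measurableSet_Ioi
    refine ContinuousOn.mul (fun u hu => ?_) (h.continuousOn_vertical hz)
    exact (continuous_ofReal.continuousAt.comp
      (Real.continuousAt_rpow_const u _ (Or.inl (ne_of_gt hu)))).continuousWithinAt
  · exact (ae_restrict_mem measurableSet_Ioi).mono fun u hu => hC z hz u hu

/-- Above the real axis the series converges absolutely, so it may be integrated term by term; each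
term is a Gamma integral that produces the factor (n+κ)^{-α}. -/
theorem ExpSeries.fracLim_eq_integral_of_pos (h : ExpSeries b κ m A F) (hα : A < α) {z : ℂ}
    (hz : 0 < z.im) : fracLim b κ m α z = (((2 * Real.pi / m) ^ α / Real.Gamma α : ℝ) : ℂ) *
      ∫ u in Set.Ioi (0 : ℝ), ((u ^ (α - 1) : ℝ) : ℂ) * F (z + u * I) := by
  have hα0 : 0 < α := h.pos_exponent.trans hα
  have hm := h.pos
  have hpi := Real.pi_pos
  have hG := Real.Gamma_pos_of_pos hα0
  obtain ⟨l₀, hl₀, hl⟩ := h.exists_gap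
  set G : ℕ → ℝ → ℂ := fun n u => ((u ^ (α - 1) : ℝ) : ℂ) * (b n * ex ((n + κ) / m) (z + u * I))
    with hGdef
  have hform : ∀ n u, G n u = b n * ex ((n + κ) / m) z *
      ((u ^ (α - 1) * Real.exp (-(2 * Real.pi * ((n + κ) / m) * u)) : ℝ) : ℂ) := by
    intro n u
    rw [hGdef]
    simp only [ex_add, ex_ofReal_mul_I]
    push_cast
    ring
  have hint : ∀ n, b n ≠ 0 → ∫ u in Set.Ioi (0 : ℝ),
      u ^ (α - 1) * Real.exp (-(2 * Real.pi * ((n + κ) / m) * u)) =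
      (1 / (2 * Real.pi * ((n + κ) / m))) ^ α * Real.Gamma α := fun n hn => by
    have := hl₀.trans_le (hl n hn)
    exact Real.integral_rpow_mul_exp_neg_mul_Ioi hα0 (by positivity)
  have hintble : ∀ n, b n ≠ 0 → IntegrableOn (fun u : ℝ =>
      u ^ (α - 1) * Real.exp (-(2 * Real.pi * ((n + κ) / m) * u))) (Set.Ioi 0) := by
    intro n hn
    -- A non-integrable function would have integral 0 by convention, whereas the value found is
    -- positive.
    refine MeasureTheory.Integrable.of_integral_ne_zero ?_
    have h2 := hl₀.trans_le (hl n hn)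
    rw [hint n hn]
    positivity
  have hGi : ∀ n, IntegrableOn (G n) (Set.Ioi 0) := by
    intro n
    by_cases hn : b n = 0
    · simp only [hGdef, hn, zero_mul, mul_zero]
      exact integrableOn_zero
    · have := ((hintble n hn).ofReal (𝕜 := ℂ)).const_mul (b n * ex ((n + κ) / m) z)
      exact this.congr (Eventually.of_forall fun u => (hform n u).symm)
  have hGint : ∀ n, ∫ u in Set.Ioi (0 : ℝ), G n u =
      (((2 * Real.pi / m) ^ α / Real.Gamma α : ℝ) : ℂ)⁻¹ * fracTerm b κ m α n z := by
    intro n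
    by_cases hn : b n = 0
    · simp [hGdef, hn, fracTerm]
    · simp only [hform]
      rw [integral_const_mul, integral_complex_ofReal, hint n hn, fracTerm]
      have hnκ : 0 < (n : ℝ) + κ := by
        have := hl₀.trans_le (hl n hn)
        by_contra h2
        exact hn (h.eq_zero n h2)
      have e : (1 / (2 * Real.pi * ((n + κ) / m))) ^ α =
          ((2 * Real.pi / m) ^ α)⁻¹ * (((n : ℝ) + κ) ^ α)⁻¹ := by
        rw [← mul_inv, ← Real.mul_rpow (by positivity) hnκ.le, ← Real.inv_rpow (by positivity)]
        congr 1
        field_simp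
      rw [e]
      push_cast
      rw [inv_div]
      ring
  have hGn : Summable fun n => ∫ u in Set.Ioi (0 : ℝ), ‖G n u‖ := by
    refine Summable.of_nonneg_of_le (fun n => integral_nonneg fun u => norm_nonneg _)
      (fun n => ?_) ((h.hasSum z hz).summable.norm.mul_right
        ((1 / (2 * Real.pi * l₀)) ^ α * Real.Gamma α))
    by_cases hn : b n = 0
    · simp [hGdef, hn]
    · have h1 : ∫ u in Set.Ioi (0 : ℝ), ‖G n u‖ = ‖b n * ex ((n + κ) / m) z‖ *
          ((1 / (2 * Real.pi * ((n + κ) / m))) ^ α * Real.Gamma α) := by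
        rw [← hint n hn, ← integral_const_mul]
        refine setIntegral_congr_fun measurableSet_Ioi fun u hu => ?_
        have hu : 0 < u := hu
        simp only [hform]
        rw [norm_mul, Complex.norm_real, Real.norm_of_nonneg (by positivity)]
      rw [h1]
      have := hl n hn
      have hpos := hl₀.trans_le this
      gcongr
  have hsum := hasSum_integral_of_summable_integral_norm hGi hGn
  have hF : ∫ u in Set.Ioi (0 : ℝ), ∑' n, G n u =
      ∫ u in Set.Ioi (0 : ℝ), ((u ^ (α - 1) : ℝ) : ℂ) * F (z + u * I) := by
    refine setIntegral_congr_fun measurableSet_Ioi fun u hu => ?_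
    have hu : 0 < u := hu
    exact ((h.hasSum (z + u * I) (by simp; linarith)).mul_left _).tsum_eq
  rw [hF] at hsum
  simp only [hGint] at hsum
  have hc : (((2 * Real.pi / m) ^ α / Real.Gamma α : ℝ) : ℂ) ≠ 0 :=
    ofReal_ne_zero.2 (by positivity)
  have h2 := hsum.mul_left (((2 * Real.pi / m) ^ α / Real.Gamma α : ℝ) : ℂ)
  simp only [mul_inv_cancel_left₀ hc] at h2
  exact h2.tendsto_sum_nat.limUnder_eq

/-- The integral representation on the real line. -/
theorem ExpSeries.fracLim_eq_integral (h : ExpSeries b κ m A F) (hα : A < α) (x : ℝ) :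
    fracLim b κ m α x = (((2 * Real.pi / m) ^ α / Real.Gamma α : ℝ) : ℂ) *
      ∫ u in Set.Ioi (0 : ℝ), ((u ^ (α - 1) : ℝ) : ℂ) * F (x + u * I) := by
  -- The formula above the axis is carried to x along x + i/(k+1): the series is continuous on the
  -- closed half-plane, and the integrals converge by a domination uniform in the base point.
  set y : ℕ → ℝ := fun k => 1 / ((k : ℝ) + 1) with hy
  have hy0 : ∀ k, 0 < y k := fun k => by positivity
  have hyt : Tendsto y atTop (𝓝 0) := tendsto_one_div_add_atTop_nhds_zero_nat
  have hzt : Tendsto (fun k => (x : ℂ) + y k * I) atTop (𝓝 (x : ℂ)) := by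
    have : Tendsto (fun k => (x : ℂ) + y k * I) atTop (𝓝 ((x : ℂ) + (0 : ℝ) * I)) :=
      ((continuous_ofReal.tendsto _).comp hyt).mul_const I |>.const_add _
    simpa using this
  have h1 : Tendsto (fun k => fracLim b κ m α (x + y k * I)) atTop (𝓝 (fracLim b κ m α x)) := by
    have hc := h.continuousOn_fracLim hα (x : ℂ) (by simp)
    refine hc.tendsto.comp (tendsto_nhdsWithin_iff.2 ⟨hzt, Eventually.of_forall fun k => ?_⟩)
    simpa using (hy0 k).le
  have h2 : Tendsto (fun k => ∫ u in Set.Ioi (0 : ℝ),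
      ((u ^ (α - 1) : ℝ) : ℂ) * F (x + y k * I + u * I)) atTop
      (𝓝 (∫ u in Set.Ioi (0 : ℝ), ((u ^ (α - 1) : ℝ) : ℂ) * F (x + u * I))) := by
    obtain ⟨C, -, hC⟩ := h.exists_norm_integrand_le hα
    have him : ∀ k, 0 ≤ ((x : ℂ) + y k * I).im := fun k => by simpa using (hy0 k).le
    refine tendsto_integral_of_dominated_convergence (fun u => C * wt (α - A) u)
      (fun k => (h.integrableOn_integrand hα (him k)).aestronglyMeasurable)
      ((integrableOn_wt (sub_pos.2 hα)).const_mul C)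
      (fun k => (ae_restrict_mem measurableSet_Ioi).mono fun u hu => hC _ (him k) u hu) ?_
    refine (ae_restrict_mem measurableSet_Ioi).mono fun u hu => ?_
    have hu : 0 < u := hu
    refine Tendsto.const_mul _ ?_
    have hmem : (x : ℂ) + u * I ∈ {z : ℂ | 0 < z.im} := by simpa using hu
    have hcont := (h.holo.continuousOn.continuousAt
      ((isOpen_lt continuous_const Complex.continuous_im).mem_nhds hmem)).tendsto
    exact hcont.comp (hzt.add_const _)
  have h3 := h2.const_mul (((2 * Real.pi / m) ^ α / Real.Gamma α : ℝ) : ℂ)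
  refine tendsto_nhds_unique h1 (h3.congr fun k => ?_)
  exact (h.fracLim_eq_integral_of_pos hα (by simpa using hy0 k)).symm

end FracModular

end

/-! ### Taylor remainders along horizontal lines -/

section

namespace FracModular

open Complex Filter MeasureTheory

/-- A Taylor formula for a family of successive derivatives `D 0, …, D k` near `x₀`, with an
arbitrary last coefficient. -/
theorem norm_sub_sum_le_of_hasDerivAt {x₀ δ ε s : ℝ} (hs : 0 ≤ s) (hε : 0 ≤ ε) (k : ℕ)
    (D : ℕ → ℝ → ℂ) (a : ℕ → ℂ) (ha : ∀ j < k, a j = D j x₀)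
    (hD : ∀ j < k, ∀ x, |x - x₀| ≤ δ → HasDerivAt (D j) (D (j + 1) x) x)
    (hk : ∀ x, |x - x₀| ≤ δ → ‖D k x - a k‖ ≤ ε * |x - x₀| ^ s) :
    ∀ x, |x - x₀| ≤ δ →
      ‖D 0 x - ∑ j ∈ Finset.range (k + 1), a j * ((x - x₀ : ℝ) : ℂ) ^ j / (j.factorial : ℂ)‖ ≤
        ε * |x - x₀| ^ (k + s) := by
  induction k generalizing D a with
  | zero => simpa using hk
  | succ k ih =>
    intro x hx
    have ih' := ih (fun j => D (j + 1)) (fun j => a (j + 1)) (fun j hj => ha _ (by omega))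
      (fun j hj => hD _ (by omega)) hk
    simp only [zero_add] at ih'
    set R : ℝ → ℂ := fun y => D 0 y - ∑ j ∈ Finset.range (k + 1 + 1),
      a j * ((y - x₀ : ℝ) : ℂ) ^ j / (j.factorial : ℂ) with hR
    have hR0 : R x₀ = 0 := by
      simp only [hR, Finset.sum_range_succ' _ (k + 1)]
      simp [ha 0 (by omega)]
    have hRd : ∀ y, |y - x₀| ≤ δ → HasDerivAt R (D 1 y - ∑ j ∈ Finset.range (k + 1),
        a (j + 1) * ((y - x₀ : ℝ) : ℂ) ^ j / (j.factorial : ℂ)) y := by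
      intro y hy
      refine (hD 0 (by omega) y hy).sub ?_
      have h1 : ∀ j : ℕ, HasDerivAt
          (fun y : ℝ => a j * ((y - x₀ : ℝ) : ℂ) ^ j / (j.factorial : ℂ))
          (a j * (j * ((y - x₀ : ℝ) : ℂ) ^ (j - 1)) / (j.factorial : ℂ)) y := by
        intro j
        have h2 : HasDerivAt (fun y : ℝ => ((y - x₀ : ℝ) : ℂ)) 1 y := by
          simpa using ((hasDerivAt_id y).sub_const x₀).ofReal_comp
        have h3 := ((h2.fun_pow j).const_mul (a j)).div_const (j.factorial : ℂ)
        simpa using h3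
      have h4 := HasDerivAt.fun_sum (u := Finset.range (k + 1 + 1)) fun j _ => h1 j
      refine h4.congr_deriv ?_
      rw [Finset.sum_range_succ']
      simp only [Nat.cast_zero, zero_mul, mul_zero, zero_div, add_zero, Nat.add_sub_cancel]
      refine Finset.sum_congr rfl fun j _ => ?_
      have h5 : ((j + 1 : ℕ) : ℂ) ≠ 0 := Nat.cast_ne_zero.2 (Nat.succ_ne_zero j)
      have h6 : (j.factorial : ℂ) ≠ 0 := Nat.cast_ne_zero.2 (Nat.factorial_ne_zero j)
      rw [Nat.factorial_succ, Nat.cast_mul]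
      field_simp
    have hbd : ∀ y ∈ Set.uIcc x₀ x, |y - x₀| ≤ |x - x₀| := fun y hy => by
      rw [abs_sub_comm y, abs_sub_comm x]
      simpa [abs_sub_comm] using Set.abs_sub_left_of_mem_uIcc hy
    -- The derivative of `R` is the remainder of the shifted family, which the induction hypothesis
    -- bounds; the mean value inequality gains one power of |x - x₀|.
    have := (convex_uIcc x₀ x).norm_image_sub_le_of_norm_hasDerivWithin_le (f := R)
      (C := ε * |x - x₀| ^ (k + s))
      (fun y hy => (hRd y ((hbd y hy).trans hx)).hasDerivWithinAt)
      (fun y hy => (ih' y ((hbd y hy).trans hx)).trans (by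
        have := hbd y hy
        gcongr))
      Set.left_mem_uIcc Set.right_mem_uIcc
    rw [hR0, sub_zero] at this
    refine this.trans (le_of_eq ?_)
    rw [Real.norm_eq_abs, mul_assoc]
    congr 1
    rcases eq_or_ne x x₀ with rfl | hne
    · rw [sub_self, abs_zero, mul_zero, Real.zero_rpow (by positivity)]
    · have : 0 < |x - x₀| := abs_pos.2 (sub_ne_zero.2 hne)
      rw [← Real.rpow_add_one this.ne']
      push_cast
      ring_nf

/-- The remainder form of Taylor's formula for a family of successive derivatives. -/
theorem norm_sub_sum_le_of_norm_le {x₀ δ M : ℝ} (hM : 0 ≤ M) (k : ℕ)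
    (D : ℕ → ℝ → ℂ)
    (hD : ∀ j < k, ∀ x, |x - x₀| ≤ δ → HasDerivAt (D j) (D (j + 1) x) x)
    (hk : ∀ x, |x - x₀| ≤ δ → ‖D k x‖ ≤ M) {x : ℝ} (hx : |x - x₀| ≤ δ) :
    ‖D 0 x - ∑ j ∈ Finset.range k, D j x₀ * ((x - x₀ : ℝ) : ℂ) ^ j / (j.factorial : ℂ)‖ ≤
        M * |x - x₀| ^ k := by
  have := norm_sub_sum_le_of_hasDerivAt (s := 0) le_rfl hM k D
    (fun j => if j < k then D j x₀ else 0) (fun j hj => by simp [hj]) hD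
    (fun y hy => by simpa using hk y hy) x hx
  rw [Finset.sum_range_succ] at this
  simp only [lt_irrefl, if_false, zero_mul, zero_div, add_zero, Real.rpow_natCast] at this
  convert this using 4 with j hj
  rw [if_pos (Finset.mem_range.1 hj)]

theorem differentiableOn_iteratedDeriv {F : ℂ → ℂ} (hF : DifferentiableOn ℂ F {z | 0 < z.im})
    (j : ℕ) : DifferentiableOn ℂ (iteratedDeriv j F) {z | 0 < z.im} := by
  induction j with
  | zero => simpa using hF
  | succ j ih =>
    rw [iteratedDeriv_succ]
    exact ih.deriv (isOpen_lt continuous_const continuous_im)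

theorem hasDerivAt_iteratedDeriv_add_mul_I {F : ℂ → ℂ}
    (hF : DifferentiableOn ℂ F {z | 0 < z.im}) (j : ℕ) {u : ℝ} (hu : 0 < u) (x : ℝ) :
    HasDerivAt (fun x : ℝ => iteratedDeriv j F (x + u * I))
      (iteratedDeriv (j + 1) F (x + u * I)) x := by
  have hmem : ((x : ℂ) + u * I) ∈ {z : ℂ | 0 < z.im} := by simpa using hu
  have h1 : HasDerivAt (iteratedDeriv j F) (iteratedDeriv (j + 1) F (x + u * I)) (x + u * I) := by
    rw [iteratedDeriv_succ]
    exact ((differentiableOn_iteratedDeriv hF j).differentiableAt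
      ((isOpen_lt continuous_const continuous_im).mem_nhds hmem)).hasDerivAt
  have h2 : HasDerivAt (fun x : ℂ => x + u * I) 1 (x : ℂ) := (hasDerivAt_id _).add_const _
  simpa using (HasDerivAt.comp (x : ℂ) h1 h2).comp_ofReal

section Remainder

variable {F : ℂ → ℂ} {A B C M x₀ : ℝ}

/-- The part of the bounds on `F` which depends on the imaginary part only. -/
def vertWeight (A M u : ℝ) : ℝ := u ^ (-A) * (1 + u) ^ (-M)

theorem vertWeight_nonneg {u : ℝ} (hu : 0 < u) : 0 ≤ vertWeight A M u := by
  unfold vertWeight; positivity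

theorem vertWeight_le (hA : 0 ≤ A) (hM : 0 ≤ M) {u v : ℝ} (hu : 0 < u) (hv : u / 2 ≤ v) :
    vertWeight A M v ≤ 2 ^ (A + M) * vertWeight A M u := by
  have h1 : v ^ (-A) ≤ 2 ^ A * u ^ (-A) := by
    calc v ^ (-A) ≤ (u / 2) ^ (-A) :=
          Real.rpow_le_rpow_of_nonpos (by positivity) hv (by linarith)
      _ = 2 ^ A * u ^ (-A) := by
          rw [Real.div_rpow hu.le zero_le_two, Real.rpow_neg zero_le_two, div_inv_eq_mul, mul_comm]
  have h2 : (1 + v) ^ (-M) ≤ 2 ^ M * (1 + u) ^ (-M) := by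
    calc (1 + v) ^ (-M) ≤ ((1 + u) / 2) ^ (-M) :=
          Real.rpow_le_rpow_of_nonpos (by positivity) (by linarith) (by linarith)
      _ = 2 ^ M * (1 + u) ^ (-M) := by
          rw [Real.div_rpow (by positivity) zero_le_two, Real.rpow_neg zero_le_two,
            div_inv_eq_mul, mul_comm]
  have hv0 : 0 < v := by linarith
  unfold vertWeight
  calc v ^ (-A) * (1 + v) ^ (-M) ≤ (2 ^ A * u ^ (-A)) * (2 ^ M * (1 + u) ^ (-M)) := by gcongr
    _ = _ := by rw [Real.rpow_add two_pos]; ring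

/-- Cauchy's estimate on the disc of radius u/2 about t+iu. On its boundary the height is at least
u/2 and the distance to x₀ is at most u/2 + u + u ≤ 3u. -/
theorem norm_iteratedDeriv_le (hF : DifferentiableOn ℂ F {z | 0 < z.im}) (hA : 0 ≤ A)
    (hM : 0 ≤ M) (hB : 0 ≤ B) (hC : 0 ≤ C)
    (hb : ∀ z : ℂ, 0 < z.im → ‖F z‖ ≤ C * (vertWeight A M z.im * ‖z - x₀‖ ^ B)) (j : ℕ)
    {u t : ℝ} (hu : 0 < u) (ht : |t - x₀| ≤ u) :
    ‖iteratedDeriv j F (t + u * I)‖ ≤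
      j.factorial * (2 : ℝ) ^ j * (2 ^ (A + M) * 3 ^ B) * C * (vertWeight A M u * u ^ B) / u ^ j := by
  have hball : Metric.closedBall ((t : ℂ) + u * I) (u / 2) ⊆ {z | 0 < z.im} := by
    intro w hw
    rw [mem_closedBall_iff_norm] at hw
    have h1 := (abs_im_le_norm _).trans hw
    simp only [sub_im, add_im, ofReal_im, mul_im, ofReal_re, I_im, I_re] at h1
    have := (abs_le.1 h1).1
    show 0 < w.im
    linarith
  have hd : DiffContOnCl ℂ F (Metric.ball ((t : ℂ) + u * I) (u / 2)) :=
    (hF.mono (hball)).diffContOnCl_ball subset_rfl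
  have := norm_iteratedDeriv_le_of_forall_mem_sphere_norm_le j (half_pos hu) hd
    (C := 2 ^ (A + M) * 3 ^ B * C * (vertWeight A M u * u ^ B)) fun w hw => by
      have hw' : ‖w - (t + u * I)‖ = u / 2 := mem_sphere_iff_norm.1 hw
      have h1 := (abs_im_le_norm _).trans hw'.le
      simp only [sub_im, add_im, ofReal_im, mul_im, ofReal_re, I_im, I_re] at h1
      have h2 : u / 2 ≤ w.im := by linarith [(abs_le.1 h1).1]
      have h3 : ‖w - x₀‖ ≤ 3 * u := by
        have e : w - x₀ = (w - (t + u * I)) + ((t - x₀ : ℝ) : ℂ) + u * I := by push_cast; ring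
        rw [e]
        refine (norm_add₃_le).trans ?_
        rw [hw', Complex.norm_real, Real.norm_eq_abs, norm_mul, Complex.norm_real, norm_I, mul_one,
          Real.norm_of_nonneg hu.le]
        linarith
      have h4 : vertWeight A M w.im ≤ 2 ^ (A + M) * vertWeight A M u := vertWeight_le hA hM hu h2
      have h5 := vertWeight_nonneg (A := A) (M := M) hu
      have h6 := vertWeight_nonneg (A := A) (M := M) (u := w.im) (by linarith)
      calc ‖F w‖ ≤ C * (vertWeight A M w.im * ‖w - x₀‖ ^ B) := hb w (by linarith)
        _ ≤ C * (2 ^ (A + M) * vertWeight A M u * (3 * u) ^ B) := by gcongr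
        _ = _ := by rw [Real.mul_rpow (by norm_num) hu.le]; ring
  refine this.trans (le_of_eq ?_)
  rw [div_pow]
  field_simp

/-- The bound on the Taylor remainders of `F` along horizontal lines. -/
theorem exists_norm_remainder_le (hA : 0 ≤ A) (hM : 0 ≤ M) (hB : 0 ≤ B) {s : ℝ} (hBs : B ≤ s)
    (N : ℕ) (hN : s ≤ N) (hN' : ∀ j < N, (j : ℝ) ≤ s) :
    ∃ K : ℝ, 0 ≤ K ∧ ∀ (F : ℂ → ℂ) (C x₀ : ℝ), DifferentiableOn ℂ F {z | 0 < z.im} → 0 ≤ C →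
      (∀ z : ℂ, 0 < z.im → ‖F z‖ ≤ C * (vertWeight A M z.im * ‖z - x₀‖ ^ B)) →
      ∀ h u : ℝ, 0 < u →
      ‖F ((x₀ + h : ℝ) + u * I) - ∑ j ∈ Finset.range N,
        iteratedDeriv j F (x₀ + u * I) * (h : ℂ) ^ j / (j.factorial : ℂ)‖ ≤
        K * C * (vertWeight A M u * u ^ B) * (|h| / u) ^ s := by
  set c : ℕ → ℝ := fun j => j.factorial * (2 : ℝ) ^ j * (2 ^ (A + M) * 3 ^ B) with hc
  have hc0 : ∀ j, 0 ≤ c j := fun j => by positivity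
  refine ⟨c N + 2 ^ B + ∑ j ∈ Finset.range N, c j, add_nonneg (by positivity)
    (Finset.sum_nonneg fun j _ => hc0 j), fun F C x₀ hF hC hb h u hu => ?_⟩
  have hd := fun j (t : ℝ) ht => norm_iteratedDeriv_le hF hA hM hB hC hb j (t := t) hu ht
  have hV := vertWeight_nonneg (A := A) (M := M) hu
  set V := vertWeight A M u * u ^ B with hVdef
  have hV0 : 0 ≤ V := by positivity
  have hs0 : 0 ≤ s := hB.trans hBs
  -- For |h| ≤ u Taylor's formula of order N applies, and N ≥ s allows the exponent to be lowered to
  -- s. For |h| ≥ u there is no cancellation: F and every Taylor term are bounded separately, using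
  -- B ≤ s and j ≤ s for j < N.
  rcases le_total |h| u with hle | hle
  · have h1 := norm_sub_sum_le_of_norm_le (x₀ := x₀) (δ := |h|) (M := c N * C * V / u ^ N)
      (by have := hc0 N; positivity) N
      (fun j (x : ℝ) => iteratedDeriv j F (x + u * I))
      (fun j _ x _ => hasDerivAt_iteratedDeriv_add_mul_I hF j hu x)
      (fun x hx => hd N x (hx.trans hle)) (x := x₀ + h) (by simp)
    rw [add_sub_cancel_left] at h1
    refine (by simpa using h1 : _ ≤ _).trans ?_
    have h2 : (|h| / u) ^ N ≤ (|h| / u) ^ s := by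
      rw [← Real.rpow_natCast]
      exact Real.rpow_le_rpow_of_exponent_ge' (by positivity) ((div_le_one hu).2 hle) hs0 hN
    have h3 : c N ≤ c N + 2 ^ B + ∑ j ∈ Finset.range N, c j := by
      have : (0 : ℝ) ≤ 2 ^ B := by positivity
      linarith [Finset.sum_nonneg fun j (_ : j ∈ Finset.range N) => hc0 j]
    calc c N * C * V / u ^ N * |h| ^ N = c N * C * V * (|h| / u) ^ N := by
          rw [div_pow]; ring
      _ ≤ _ := by have := hc0 N; gcongr
  · have hhu : 1 ≤ |h| / u := (one_le_div hu).2 hle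
    have h1 : ‖F ((x₀ + h : ℝ) + u * I)‖ ≤ 2 ^ B * C * V * (|h| / u) ^ s := by
      have h2 := hb ((x₀ + h : ℝ) + u * I) (by simpa using hu)
      have e : ((x₀ + h : ℝ) : ℂ) + u * I - x₀ = h + u * I := by push_cast; ring
      rw [e] at h2
      simp only [add_im, ofReal_im, mul_im, ofReal_re, I_im, I_re, mul_one, mul_zero, add_zero,
        zero_add] at h2
      have h3 : ‖(h : ℂ) + u * I‖ ≤ 2 * |h| := by
        refine (norm_add_le _ _).trans ?_
        rw [Complex.norm_real, Real.norm_eq_abs, norm_mul, Complex.norm_real, norm_I, mul_one,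
          Real.norm_of_nonneg hu.le]
        linarith
      calc _ ≤ C * (vertWeight A M u * ‖(h : ℂ) + u * I‖ ^ B) := h2
        _ ≤ C * (vertWeight A M u * (2 * |h|) ^ B) := by gcongr
        _ = 2 ^ B * C * V * (|h| / u) ^ B := by
          rw [Real.mul_rpow zero_le_two (abs_nonneg h), Real.div_rpow (abs_nonneg h) hu.le, hVdef]
          have := (Real.rpow_pos_of_pos hu B).ne'
          field_simp
        _ ≤ _ := by gcongr
    have h4 : ∀ j ∈ Finset.range N, ‖iteratedDeriv j F (x₀ + u * I) * (h : ℂ) ^ j /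
        (j.factorial : ℂ)‖ ≤ c j * (C * V * (|h| / u) ^ s) := by
      intro j hj
      have h5 := hd j x₀ (by simpa using hu.le)
      rw [norm_div, norm_mul, norm_pow, Complex.norm_real, Real.norm_eq_abs, Complex.norm_natCast]
      have h6 : (1 : ℝ) ≤ j.factorial := by exact_mod_cast Nat.factorial_pos j
      have h7 : (|h| / u) ^ j ≤ (|h| / u) ^ s := by
        rw [← Real.rpow_natCast]
        exact Real.rpow_le_rpow_of_exponent_le hhu (hN' j (Finset.mem_range.1 hj))
      calc _ ≤ ‖iteratedDeriv j F (x₀ + u * I)‖ * |h| ^ j := div_le_self (by positivity) h6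
        _ ≤ (c j * C * V / u ^ j) * |h| ^ j := by gcongr
        _ = c j * (C * V * (|h| / u) ^ j) := by rw [div_pow]; ring
        _ ≤ _ := by have := hc0 j; gcongr
    refine (norm_sub_le _ _).trans ((add_le_add h1 (norm_sum_le_of_le _ h4)).trans ?_)
    rw [← Finset.sum_mul]
    have h8 : 0 ≤ c N * (C * V * (|h| / u) ^ s) := by have := hc0 N; positivity
    nlinarith

end Remainder

end FracModular

end

/-! ### Smoothness of fractional integrals from bounds on the function -/

section

namespace FracModular

open Complex Filter MeasureTheory

section

variable {b : ℕ → ℂ} {κ m A B α s x₀ : ℝ} {F : ℂ → ℂ}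

theorem le_vertWeight_of_le_one {M : ℝ} (hM : 0 ≤ M) {u : ℝ} (hu : 0 < u) (hu1 : u ≤ 1) :
    u ^ (-A) ≤ 2 ^ M * vertWeight A M u := by
  have h2 : (2 : ℝ) ^ (-M) ≤ (1 + u) ^ (-M) :=
    Real.rpow_le_rpow_of_nonpos (by positivity) (by linarith) (by linarith)
  have h3 : (2 : ℝ) ^ M * 2 ^ (-M) = 1 := by rw [← Real.rpow_add two_pos]; simp
  have h4 : 0 < u ^ (-A) := Real.rpow_pos_of_pos hu _
  calc u ^ (-A) = 2 ^ M * (u ^ (-A) * 2 ^ (-M)) := by linear_combination (-u ^ (-A)) * h3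
    _ ≤ _ := by unfold vertWeight; gcongr

theorem le_vertWeight_of_one_le {M : ℝ} (hM : 0 ≤ M) {u : ℝ} (hu1 : 1 ≤ u) :
    u ^ (-(A + M)) ≤ 2 ^ M * vertWeight A M u := by
  have hu : 0 < u := by linarith
  have h2 : (2 * u : ℝ) ^ (-M) ≤ (1 + u) ^ (-M) :=
    Real.rpow_le_rpow_of_nonpos (by positivity) (by linarith) (by linarith)
  rw [Real.mul_rpow zero_le_two hu.le] at h2
  have h3 : (2 : ℝ) ^ M * 2 ^ (-M) = 1 := by rw [← Real.rpow_add two_pos]; simp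
  have h4 : 0 < u ^ (-A) := Real.rpow_pos_of_pos hu _
  calc u ^ (-(A + M)) = 2 ^ M * (u ^ (-A) * (2 ^ (-M) * u ^ (-M))) := by
        rw [neg_add, Real.rpow_add hu]
        linear_combination (-(u ^ (-A) * u ^ (-M))) * h3
    _ ≤ _ := by unfold vertWeight; gcongr

theorem ExpSeries.exists_norm_le_vertWeight (h : ExpSeries b κ m A F) {M : ℝ} (hM : 0 ≤ M) :
    ∃ C : ℝ, 0 ≤ C ∧ ∀ z : ℂ, 0 < z.im → ‖F z‖ ≤ C * vertWeight A M z.im := by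
  obtain ⟨C₁, h₁0, h₁⟩ := h.exists_norm_le
  obtain ⟨C₂, h₂0, h₂⟩ := h.exists_decay (A + M)
  refine ⟨max C₁ C₂ * 2 ^ M, by positivity, fun z hz => ?_⟩
  have hV := vertWeight_nonneg (A := A) (M := M) hz
  rw [mul_assoc]
  rcases le_total z.im 1 with h1 | h1
  · refine (h₁ z hz).trans ?_
    have := le_vertWeight_of_le_one (A := A) hM hz h1
    gcongr
    exact le_max_left _ _
  · refine (h₂ z (by linarith)).trans ?_
    have := le_vertWeight_of_one_le (A := A) hM h1
    gcongr
    exact le_max_right _ _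

/-- At distance at least 1 from x₀ the factor |z-x₀|^B is at least 1, so the global bound covers
what the local hypothesis leaves out. -/
theorem ExpSeries.exists_norm_le_vertWeight_mul (h : ExpSeries b κ m A F) {M : ℝ} (hM : 0 ≤ M)
    (hB : 0 ≤ B) (hloc : ∃ C : ℝ, ∀ z : ℂ, 0 < z.im → ‖z - x₀‖ ≤ 1 →
      ‖F z‖ ≤ C * (z.im ^ (-A) * ‖z - x₀‖ ^ B)) :
    ∃ C : ℝ, 0 ≤ C ∧ ∀ z : ℂ, 0 < z.im → ‖F z‖ ≤ C * (vertWeight A M z.im * ‖z - x₀‖ ^ B) := by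
  obtain ⟨C₁, h₁⟩ := hloc
  obtain ⟨C₂, h₂0, h₂⟩ := h.exists_norm_le_vertWeight hM
  refine ⟨max C₁ C₂ * 2 ^ M, by positivity, fun z hz => ?_⟩
  have hV := vertWeight_nonneg (A := A) (M := M) hz
  rcases le_total ‖z - x₀‖ 1 with h1 | h1
  · have him : z.im ≤ 1 := by
      have := (abs_im_le_norm (z - x₀)).trans h1
      simp only [sub_im, ofReal_im, sub_zero] at this
      exact (le_abs_self _).trans this
    have := le_vertWeight_of_le_one (A := A) hM hz him
    calc ‖F z‖ ≤ C₁ * (z.im ^ (-A) * ‖z - x₀‖ ^ B) := h₁ z hz h1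
      _ ≤ max C₁ C₂ * (z.im ^ (-A) * ‖z - x₀‖ ^ B) := by gcongr; exact le_max_left _ _
      _ ≤ max C₁ C₂ * ((2 ^ M * vertWeight A M z.im) * ‖z - x₀‖ ^ B) := by gcongr
      _ = _ := by ring
  · have h3 : (1 : ℝ) ≤ ‖z - x₀‖ ^ B := Real.one_le_rpow h1 hB
    have h4 : (1 : ℝ) ≤ 2 ^ M := Real.one_le_rpow one_le_two hM
    calc ‖F z‖ ≤ C₂ * vertWeight A M z.im := h₂ z hz
      _ ≤ (max C₁ C₂ * 2 ^ M) * (vertWeight A M z.im * 1) := by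
        rw [mul_one]; gcongr; exact (le_max_right C₁ _).trans (le_mul_of_one_le_right (by positivity) h4)
      _ ≤ _ := by gcongr

/-- Near 0 the exponent is α-A+B-σ-1, integrable exactly when σ < α-A+B: this is the source of the
Hölder exponent. The decay parameter M = α-A+B+1 leaves u^{-2-σ} at infinity. -/
theorem rpow_mul_vertWeight_le (hα : A < α) (hB : 0 ≤ B) {σ : ℝ} (hσ : 0 ≤ σ) {u : ℝ}
    (hu : 0 < u) :
    u ^ (α - 1) * (vertWeight A (α - A + B + 1) u * u ^ B) / u ^ σ ≤ wt (α - A + B - σ) u := by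
  have e : u ^ (α - 1) * (vertWeight A (α - A + B + 1) u * u ^ B) / u ^ σ =
      u ^ (α - A + B - σ - 1) * (1 + u) ^ (-(α - A + B + 1)) := by
    have : u ^ (α - A + B - σ - 1) = u ^ (α - 1) * u ^ (-A) * u ^ B / u ^ σ := by
      rw [← Real.rpow_add hu, ← Real.rpow_add hu, ← Real.rpow_sub hu]
      congr 1; ring
    rw [this, vertWeight]
    ring
  rw [e, wt]
  split_ifs with h1
  · refine mul_le_of_le_one_right (by positivity) ?_
    exact Real.rpow_le_one_of_one_le_of_nonpos (by linarith) (by linarith)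
  · push Not at h1
    calc _ ≤ u ^ (α - A + B - σ - 1) * u ^ (-(α - A + B + 1)) := by
          gcongr 1
          exact Real.rpow_le_rpow_of_nonpos hu (by linarith) (by linarith)
      _ = u ^ (-2 - σ) := by rw [← Real.rpow_add hu]; congr 1; ring
      _ ≤ _ := Real.rpow_le_rpow_of_exponent_le h1.le (by linarith)

/-- The fractional integral of a function with `F(z) = O((Im z)^{-A} |z - x₀|^B)` is approximated
by polynomials near `x₀`, with uniform constants. -/
theorem ExpSeries.exists_norm_fracLim_sub_le (h : ExpSeries b κ m A F) (hα : A < α) (hB : 0 ≤ B)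
    (hBs : B ≤ s) (hs : s < α - A + B) :
    ∃ K : ℝ, 0 ≤ K ∧ ∀ C x₀ : ℝ, 0 ≤ C →
      (∀ z : ℂ, 0 < z.im → ‖F z‖ ≤ C * (vertWeight A (α - A + B + 1) z.im * ‖z - x₀‖ ^ B)) →
      ∃ p : ℕ → ℂ, ∀ t : ℝ, ‖fracLim b κ m α (x₀ + t : ℝ) -
        ∑ j ∈ Finset.range ⌈s⌉₊, p j * (t : ℂ) ^ j‖ ≤ K * C * |t| ^ s := by
  have hA := h.pos_exponent
  have hM : 0 ≤ α - A + B + 1 := by linarith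
  have hs0 : 0 ≤ s := hB.trans hBs
  have hlt : ∀ j < ⌈s⌉₊, (j : ℝ) < s := fun j hj => Nat.lt_ceil.1 hj
  obtain ⟨K, hK0, hK⟩ := exists_norm_remainder_le hA.le hM hB hBs ⌈s⌉₊ (Nat.le_ceil s)
    fun j hj => (hlt j hj).le
  set c : ℂ := (((2 * Real.pi / m) ^ α / Real.Gamma α : ℝ) : ℂ) with hc
  have hW0 : 0 ≤ ∫ u in Set.Ioi (0 : ℝ), wt (α - A + B - s) u :=
    setIntegral_nonneg measurableSet_Ioi fun u hu => wt_nonneg _ hu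
  refine ⟨‖c‖ * K * ∫ u in Set.Ioi (0 : ℝ), wt (α - A + B - s) u, by positivity,
    fun C x₀ hC hb => ?_⟩
  -- The coefficients of the approximating polynomial are the integrals of the Taylor coefficients
  -- of F along the vertical line above x₀. They converge because j < s < α-A+B.
  set T : ℕ → ℝ → ℂ := fun j u => ((u ^ (α - 1) : ℝ) : ℂ) *
    (iteratedDeriv j F (x₀ + u * I) / (j.factorial : ℂ)) with hT
  have hTi : ∀ j < ⌈s⌉₊, IntegrableOn (T j) (Set.Ioi 0) := by
    intro j hj
    refine Integrable.mono' ((integrableOn_wt (p := α - A + B - j)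
      (by linarith [hlt j hj])).const_mul
      (j.factorial * (2 : ℝ) ^ j * (2 ^ (A + (α - A + B + 1)) * 3 ^ B) * C)) ?_ ?_
    · refine ContinuousOn.aestronglyMeasurable (fun u hu => ?_) measurableSet_Ioi
      have hu : 0 < u := hu
      have hmem : ((x₀ : ℂ) + u * I) ∈ {z : ℂ | 0 < z.im} := by simpa using hu
      have h1 : ContinuousAt (iteratedDeriv j F) (x₀ + u * I) :=
        ((differentiableOn_iteratedDeriv h.holo j).differentiableAt
          ((isOpen_lt continuous_const continuous_im).mem_nhds hmem)).continuousAt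
      have h2 : ContinuousAt (fun u : ℝ => (x₀ : ℂ) + u * I) u := by fun_prop
      have h3 := ContinuousAt.comp (x := u) (f := fun u : ℝ => (x₀ : ℂ) + u * I) h1 h2
      refine ContinuousAt.continuousWithinAt (ContinuousAt.mul ?_ (h3.div_const _))
      exact continuous_ofReal.continuousAt.comp
        (Real.continuousAt_rpow_const _ _ (Or.inl hu.ne'))
    · refine (ae_restrict_mem measurableSet_Ioi).mono fun u hu => ?_
      have hu : 0 < u := hu
      have h1 := norm_iteratedDeriv_le h.holo hA.le hM hB hC hb j (t := x₀) hu (by simpa using hu.le)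
      have h2 := rpow_mul_vertWeight_le hα hB (Nat.cast_nonneg j) hu
      rw [Real.rpow_natCast] at h2
      have h6 : (1 : ℝ) ≤ j.factorial := by exact_mod_cast Nat.factorial_pos j
      have hp : 0 < u ^ (α - 1) := Real.rpow_pos_of_pos hu _
      rw [norm_mul, Complex.norm_real, Real.norm_of_nonneg hp.le, norm_div, Complex.norm_natCast]
      calc _ ≤ u ^ (α - 1) * ‖iteratedDeriv j F (x₀ + u * I)‖ := by
            gcongr; exact div_le_self (norm_nonneg _) h6
        _ ≤ u ^ (α - 1) * _ := mul_le_mul_of_nonneg_left h1 hp.le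
        _ = (j.factorial * (2 : ℝ) ^ j * (2 ^ (A + (α - A + B + 1)) * 3 ^ B) * C) *
          (u ^ (α - 1) * (vertWeight A (α - A + B + 1) u * u ^ B) / u ^ j) := by ring
        _ ≤ _ := by gcongr
  refine ⟨fun j => c * ∫ u in Set.Ioi (0 : ℝ), T j u, fun t => ?_⟩
  have hi := h.integrableOn_integrand hα (z := ((x₀ + t : ℝ) : ℂ)) (by simp)
  have hsum : IntegrableOn (fun u => ∑ j ∈ Finset.range ⌈s⌉₊, T j u * (t : ℂ) ^ j)
      (Set.Ioi 0) :=
    integrable_finsetSum _ fun j hj => (hTi j (Finset.mem_range.1 hj)).mul_const _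
  have e : fracLim b κ m α (x₀ + t : ℝ) - ∑ j ∈ Finset.range ⌈s⌉₊,
      (c * ∫ u in Set.Ioi (0 : ℝ), T j u) * (t : ℂ) ^ j =
      c * ∫ u in Set.Ioi (0 : ℝ), (((u ^ (α - 1) : ℝ) : ℂ) * F ((x₀ + t : ℝ) + u * I) -
        ∑ j ∈ Finset.range ⌈s⌉₊, T j u * (t : ℂ) ^ j) := by
    rw [integral_sub hi hsum, integral_finsetSum _ fun j hj =>
      (hTi j (Finset.mem_range.1 hj)).mul_const _, h.fracLim_eq_integral hα, mul_sub,
      Finset.mul_sum]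
    simp only [integral_mul_const, mul_assoc]
    rfl
  rw [e, norm_mul]
  have hbd : ‖∫ u in Set.Ioi (0 : ℝ), (((u ^ (α - 1) : ℝ) : ℂ) * F ((x₀ + t : ℝ) + u * I) -
      ∑ j ∈ Finset.range ⌈s⌉₊, T j u * (t : ℂ) ^ j)‖ ≤
      ∫ u in Set.Ioi (0 : ℝ), K * C * |t| ^ s * wt (α - A + B - s) u := by
    refine norm_integral_le_of_norm_le ((integrableOn_wt (by linarith)).const_mul _) ?_
    refine (ae_restrict_mem measurableSet_Ioi).mono fun u hu => ?_
    have hu : 0 < u := hu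
    have hp : 0 < u ^ (α - 1) := Real.rpow_pos_of_pos hu _
    have h1 := hK F C x₀ h.holo hC hb t u hu
    have h2 := rpow_mul_vertWeight_le hα hB hs0 hu
    have e2 : ((u ^ (α - 1) : ℝ) : ℂ) * F ((x₀ + t : ℝ) + u * I) -
        ∑ j ∈ Finset.range ⌈s⌉₊, T j u * (t : ℂ) ^ j = ((u ^ (α - 1) : ℝ) : ℂ) *
        (F ((x₀ + t : ℝ) + u * I) - ∑ j ∈ Finset.range ⌈s⌉₊,
          iteratedDeriv j F (x₀ + u * I) * (t : ℂ) ^ j / (j.factorial : ℂ)) := by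
      rw [mul_sub, Finset.mul_sum]
      congr 1
      refine Finset.sum_congr rfl fun j _ => ?_
      simp only [hT]
      ring
    rw [e2, norm_mul, Complex.norm_real, Real.norm_of_nonneg hp.le]
    calc _ ≤ u ^ (α - 1) * _ := mul_le_mul_of_nonneg_left h1 hp.le
      _ = K * C * |t| ^ s *
        (u ^ (α - 1) * (vertWeight A (α - A + B + 1) u * u ^ B) / u ^ s) := by
          rw [Real.div_rpow (abs_nonneg t) hu.le]; ring
      _ ≤ _ := by gcongr
  rw [integral_const_mul] at hbd
  calc _ ≤ ‖c‖ * (K * C * |t| ^ s * ∫ u in Set.Ioi (0 : ℝ), wt (α - A + B - s) u) := by gcongr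
    _ = _ := by ring

theorem ExpSeries.memPointwise_fracLim (h : ExpSeries b κ m A F) (hα : A < α) (hB : 0 ≤ B)
    (hs0 : 0 ≤ s) (hs : s < α - A + B) (hloc : ∃ C : ℝ, ∀ z : ℂ, 0 < z.im → ‖z - x₀‖ ≤ 1 →
      ‖F z‖ ≤ C * (z.im ^ (-A) * ‖z - x₀‖ ^ B)) :
    MemPointwise (fun x : ℝ => fracLim b κ m α x) s x₀ := by
  -- The approximation needs B ≤ s. Near x₀ the exponent B may be lowered, and s < α-A+s holds
  -- anyway because A < α.
  have hB' : 0 ≤ min B s := le_min hB hs0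
  have hs' : s < α - A + min B s := by
    rcases le_total B s with h1 | h1
    · rwa [min_eq_left h1]
    · rw [min_eq_right h1]; linarith
  obtain ⟨K, hK0, hK⟩ := h.exists_norm_fracLim_sub_le hα hB' (min_le_right B s) hs'
  have hloc' : ∃ C : ℝ, ∀ z : ℂ, 0 < z.im → ‖z - x₀‖ ≤ 1 →
      ‖F z‖ ≤ C * (z.im ^ (-A) * ‖z - x₀‖ ^ (min B s)) := by
    obtain ⟨C, hC⟩ := hloc
    refine ⟨|C|, fun z hz hz1 => (hC z hz hz1).trans ?_⟩
    have h1 : ‖z - x₀‖ ^ B ≤ ‖z - x₀‖ ^ (min B s) :=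
      Real.rpow_le_rpow_of_exponent_ge' (norm_nonneg _) hz1 hB' (min_le_left B s)
    gcongr
    exact le_abs_self C
  obtain ⟨C, hC0, hC⟩ := h.exists_norm_le_vertWeight_mul (M := α - A + min B s + 1)
    (by linarith) hB' hloc'
  obtain ⟨p, hp⟩ := hK C x₀ hC0 hC
  refine ⟨hs0, h.continuous_fracLim hα, ∑ j ∈ Finset.range ⌈s⌉₊, Polynomial.C (p j) *
    Polynomial.X ^ j, fun n hn => ?_, ?_⟩
  · by_contra hns
    refine Polynomial.mem_support_iff.1 hn ?_
    rw [Polynomial.finsetSum_coeff]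
    refine Finset.sum_eq_zero fun j hj => ?_
    rw [Polynomial.coeff_C_mul_X_pow, if_neg]
    rintro rfl
    exact hns (Nat.lt_ceil.1 (Finset.mem_range.1 hj))
  · refine Asymptotics.IsBigO.of_bound (K * C) (Eventually.of_forall fun x => ?_)
    have := hp (x - x₀)
    rw [add_sub_cancel] at this
    rw [Real.norm_of_nonneg (by positivity)]
    simpa [Polynomial.eval_finsetSum] using this

/-- The uniform Hölder condition for fractional integrals. -/
theorem ExpSeries.exists_holder_fracLim (h : ExpSeries b κ m A F) (hα : A < α) (hs0 : 0 ≤ s)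
    (hs1 : s ≤ 1) (hs : s < α - A) : ∃ C : ℝ, 0 ≤ C ∧ ∀ x y : ℝ,
      ‖fracLim b κ m α x - fracLim b κ m α y‖ ≤ C * |x - y| ^ s := by
  obtain ⟨K, hK0, hK⟩ := h.exists_norm_fracLim_sub_le hα le_rfl hs0 (by simpa using hs)
  obtain ⟨C, hC0, hC⟩ := h.exists_norm_le_vertWeight (M := α - A + 0 + 1) (by linarith)
  have hK' := fun y : ℝ => hK C y hC0 (by simpa using hC)
  rcases hs0.eq_or_lt with rfl | hs0
  · refine ⟨K * C + K * C, by positivity, fun x y => ?_⟩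
    have h1 : ∀ y : ℝ, ‖fracLim b κ m α y‖ ≤ K * C := fun y => by
      obtain ⟨p, hp⟩ := hK' y
      simpa using hp 0
    simpa using (norm_sub_le _ _).trans (add_le_add (h1 x) (h1 y))
  · refine ⟨K * C, by positivity, fun x y => ?_⟩
    obtain ⟨p, hp⟩ := hK' y
    -- For 0 < s ≤ 1 the polynomial is a constant, and the estimate at t = 0 identifies it with the
    -- value at y. The constant in the bound does not depend on y.
    have hc : ⌈s⌉₊ = 1 := (Nat.ceil_eq_iff one_ne_zero).2 (by simpa using ⟨hs0, hs1⟩)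
    rw [hc] at hp
    have h0 := hp 0
    rw [abs_zero, Real.zero_rpow hs0.ne'] at h0
    simp only [Finset.sum_range_one, pow_zero, mul_one, add_zero, mul_zero, norm_le_zero_iff,
      sub_eq_zero] at h0 hp
    have := hp (x - y)
    rwa [add_sub_cancel, ← h0] at this

end

end FracModular

end

/-! ### The analyzing function: Fourier transform and vanishing moments -/

section

namespace FracModular

open Complex Filter MeasureTheory

section Wavelet

variable {α : ℝ}

theorem integrableOn_rpow_mul_exp {p c : ℝ} (hp : -1 < p) (hc : 0 < c) :
    IntegrableOn (fun t : ℝ => t ^ p * Real.exp (-(c * t))) (Set.Ioi 0) := by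
  simpa using integrableOn_rpow_mul_exp_neg_mul_rpow (p := 1) (s := p) (b := c) hp one_pos hc

theorem norm_rpow_mul_exp {p t : ℝ} (ht : 0 < t) (w : ℂ) :
    ‖((t ^ p : ℝ) : ℂ) * cexp (-(w * t))‖ = t ^ p * Real.exp (-(w.re * t)) := by
  rw [norm_mul, Complex.norm_real, Real.norm_of_nonneg (by positivity), norm_exp]
  simp

theorem aestronglyMeasurable_rpow_mul_exp (p : ℝ) (w : ℂ) :
    AEStronglyMeasurable (fun t : ℝ => ((t ^ p : ℝ) : ℂ) * cexp (-(w * t)))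
      (volume.restrict (Set.Ioi 0)) := by
  refine ContinuousOn.aestronglyMeasurable (fun t ht => ?_) measurableSet_Ioi
  have ht : 0 < t := ht
  refine ContinuousAt.continuousWithinAt (ContinuousAt.mul ?_ (by fun_prop))
  exact continuous_ofReal.continuousAt.comp (Real.continuousAt_rpow_const _ _ (Or.inl ht.ne'))

/-- The Gamma integral along a ray in the right half-plane. -/
theorem integral_rpow_mul_exp_neg_mul {p : ℝ} (hp : 0 < p) {w : ℂ} (hw : 0 < w.re) :
    ∫ t in Set.Ioi (0 : ℝ), ((t ^ (p - 1) : ℝ) : ℂ) * cexp (-(w * t)) =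
      w ^ ((-p : ℝ) : ℂ) * (Real.Gamma p : ℂ) := by
  set U : Set ℂ := {w | 0 < w.re} with hU
  have hUo : IsOpen U := isOpen_lt continuous_const continuous_re
  have hUc : IsPreconnected U := (convex_halfSpace_re_gt 0).isPreconnected
  have h1 : DifferentiableOn ℂ
      (fun w : ℂ => ∫ t in Set.Ioi (0 : ℝ), ((t ^ (p - 1) : ℝ) : ℂ) * cexp (-(w * t))) U := by
    intro w₀ hw₀
    have hw₀ : 0 < w₀.re := hw₀
    refine (HasDerivAt.differentiableAt (hasDerivAt_integral_of_dominated_loc_of_deriv_le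
      (F' := fun w t => ((t ^ (p - 1) : ℝ) : ℂ) * (cexp (-(w * t)) * -t))
      (bound := fun t => t ^ p * Real.exp (-(w₀.re / 2 * t)))
      (Metric.ball_mem_nhds w₀ (half_pos hw₀))
      (Eventually.of_forall fun w => aestronglyMeasurable_rpow_mul_exp _ w) ?_ ?_ ?_ ?_ ?_).2
      ).differentiableWithinAt
    · refine Integrable.mono' (integrableOn_rpow_mul_exp (p := p - 1) (by linarith) hw₀)
        (aestronglyMeasurable_rpow_mul_exp _ _) ?_
      exact (ae_restrict_mem measurableSet_Ioi).mono fun t ht => (norm_rpow_mul_exp ht w₀).le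
    · simp only [← mul_assoc]
      exact (aestronglyMeasurable_rpow_mul_exp _ _).mul
        (by fun_prop : Continuous fun t : ℝ => -(t : ℂ)).aestronglyMeasurable
    · refine (ae_restrict_mem measurableSet_Ioi).mono fun t ht w hw => ?_
      have ht : 0 < t := ht
      have h2 : w₀.re / 2 ≤ w.re := by
        have := ((abs_re_le_norm _).trans_lt (mem_ball_iff_norm.1 hw)).le
        rw [sub_re] at this
        linarith [(abs_le.1 this).1]
      rw [← mul_assoc, norm_mul, norm_rpow_mul_exp ht, norm_neg, Complex.norm_real,
        Real.norm_of_nonneg ht.le, Real.rpow_sub_one ht.ne']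
      calc t ^ p / t * Real.exp (-(w.re * t)) * t = t ^ p * Real.exp (-(w.re * t)) := by
            field_simp
        _ ≤ _ := by gcongr
    · exact integrableOn_rpow_mul_exp (by linarith) (half_pos hw₀)
    · refine Eventually.of_forall fun t w _ => ?_
      have h3 : HasDerivAt (fun w : ℂ => -(w * t)) (-t) w := by
        simpa using ((hasDerivAt_id w).mul_const (t : ℂ)).fun_neg
      exact h3.cexp.const_mul _
  have h2 : DifferentiableOn ℂ (fun w : ℂ => w ^ ((-p : ℝ) : ℂ) * (Real.Gamma p : ℂ)) U :=
    fun w hw => ((differentiableAt_id.cpow_const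
      (Or.inl hw)).mul_const _).differentiableWithinAt
  -- Both sides are holomorphic in the right half-plane and agree at the real points 1 + 1/(n+1),
  -- which accumulate at 1.
  refine (h1.analyticOnNhd hUo).eqOn_of_preconnected_of_frequently_eq (h2.analyticOnNhd hUo) hUc
    (show (1 : ℂ) ∈ U by simp [hU]) ?_ hw
  have h3 : Tendsto (fun n : ℕ => ((1 + 1 / ((n : ℝ) + 1) : ℝ) : ℂ)) atTop (𝓝[≠] 1) := by
    refine tendsto_nhdsWithin_iff.2 ⟨?_, Eventually.of_forall fun n => ?_⟩
    · have := (tendsto_const_nhds (x := (1 : ℝ))).add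
        (tendsto_one_div_add_atTop_nhds_zero_nat (𝕜 := ℝ))
      rw [add_zero] at this
      exact_mod_cast (continuous_ofReal.tendsto _).comp this
    · have : (0 : ℝ) < 1 / ((n : ℝ) + 1) := by positivity
      rw [Set.mem_compl_singleton_iff, ← ofReal_one, Ne, ofReal_inj]
      linarith
  refine h3.frequently (Frequently.of_forall fun n => ?_)
  have hc : (0 : ℝ) < 1 + 1 / ((n : ℝ) + 1) := by positivity
  generalize 1 + 1 / ((n : ℝ) + 1) = c at hc
  have h4 := Real.integral_rpow_mul_exp_neg_mul_Ioi hp hc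
  rw [one_div, Real.inv_rpow hc.le, ← Real.rpow_neg hc.le] at h4
  have h5 : (c : ℂ) ^ ((-p : ℝ) : ℂ) = ((c ^ (-p) : ℝ) : ℂ) := (ofReal_cpow hc.le _).symm
  simp only [h5]
  rw [← ofReal_mul, ← h4, ← integral_complex_ofReal]
  push_cast
  rfl

/-- The analyzing function `(1 + 2πit)^{-α-1}`. -/
def wavelet (α t : ℝ) : ℂ := (1 + 2 * Real.pi * t * I) ^ ((-(α + 1) : ℝ) : ℂ)

/-- The Fourier transform of `wavelet α`. -/
def gammaKernel (α l : ℝ) : ℝ := (max l 0) ^ α * Real.exp (-l) / Real.Gamma (α + 1)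

theorem gammaKernel_of_nonpos (hα : 0 < α) {l : ℝ} (hl : l ≤ 0) : gammaKernel α l = 0 := by
  rw [gammaKernel, max_eq_right hl, Real.zero_rpow hα.ne', zero_mul, zero_div]

theorem continuous_gammaKernel (hα : 0 < α) : Continuous (gammaKernel α) := by
  unfold gammaKernel
  refine Continuous.div_const (Continuous.mul ?_ (by fun_prop)) _
  exact (by fun_prop : Continuous fun l : ℝ => max l 0).rpow_const fun _ => Or.inr hα.le

theorem integrable_gammaKernel (hα : 0 < α) : Integrable (gammaKernel α) := by
  rw [← integrableOn_iff_integrable_of_support_subset (s := Set.Ioi 0) fun l hl => ?_]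
  · have h1 := (integrableOn_rpow_mul_exp (p := α) (by linarith) one_pos).div_const
      (Real.Gamma (α + 1))
    refine IntegrableOn.congr_fun h1 (fun l hl => ?_) measurableSet_Ioi
    simp only [gammaKernel, one_mul, max_eq_left (le_of_lt (show 0 < l from hl))]
  · by_contra h
    exact hl (gammaKernel_of_nonpos hα (not_lt.1 h))

theorem wavelet_base_re (t : ℝ) : (1 + 2 * Real.pi * t * I : ℂ).re = 1 := by simp

theorem wavelet_base_im (t : ℝ) : (1 + 2 * Real.pi * t * I : ℂ).im = 2 * Real.pi * t := by simp

theorem continuous_wavelet : Continuous (wavelet α) := by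
  unfold wavelet
  refine Continuous.cpow (by fun_prop) continuous_const fun t => Or.inl ?_
  rw [wavelet_base_re]
  exact one_pos

theorem norm_wavelet_le (hα : -1 < α) (t : ℝ) :
    ‖wavelet α t‖ ≤ 2 ^ (α + 1) * (1 + |t|) ^ (-(α + 1)) := by
  rw [wavelet, norm_cpow_real]
  have h1 := re_le_norm (1 + 2 * Real.pi * t * I)
  have h2 := abs_im_le_norm (1 + 2 * Real.pi * t * I)
  rw [wavelet_base_re] at h1
  rw [wavelet_base_im, abs_mul, abs_of_pos Real.two_pi_pos] at h2
  have h3 : |t| ≤ 2 * Real.pi * |t| :=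
    le_mul_of_one_le_left (abs_nonneg t) (by linarith [Real.pi_gt_three])
  calc _ ≤ ((1 + |t|) / 2) ^ (-(α + 1)) :=
        Real.rpow_le_rpow_of_nonpos (by positivity) (by linarith) (by linarith)
    _ = _ := by
      rw [Real.div_rpow (by positivity) zero_le_two, Real.rpow_neg zero_le_two, div_inv_eq_mul,
        mul_comm]

theorem integrable_rpow_mul_wavelet {s : ℝ} (hα : -1 < α) (hs : s < α) :
    Integrable fun t : ℝ => (1 + |t|) ^ s * ‖wavelet α t‖ := by
  have h1 : Integrable fun t : ℝ => (1 + ‖t‖) ^ (-(α + 1 - s)) :=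
    integrable_one_add_norm (by simp; linarith)
  refine Integrable.mono' (h1.const_mul (2 ^ (α + 1))) ?_ (Eventually.of_forall fun t => ?_)
  · refine Continuous.aestronglyMeasurable (Continuous.mul ?_ continuous_wavelet.norm)
    exact (by fun_prop : Continuous fun t : ℝ => 1 + |t|).rpow_const
      fun t => Or.inl (by positivity)
  · rw [Real.norm_of_nonneg (by positivity), Real.norm_eq_abs]
    calc _ ≤ (1 + |t|) ^ s * (2 ^ (α + 1) * (1 + |t|) ^ (-(α + 1))) := by
          gcongr; exact norm_wavelet_le hα t
      _ = _ := by
          rw [mul_left_comm, ← Real.rpow_add (by positivity)]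
          ring_nf

theorem integrable_wavelet (hα : 0 < α) : Integrable (wavelet α) := by
  refine (integrable_norm_iff continuous_wavelet.aestronglyMeasurable).1 ?_
  simpa using integrable_rpow_mul_wavelet (s := 0) (by linarith) hα

-- This is the Gamma integral of exponent α+1 at the complex parameter 1+2πit. Since `wavelet α` is
-- itself integrable, Fourier inversion will recover `gammaKernel`, whose vanishing on nonpositive
-- frequencies is what matters later.
open FourierTransform in
theorem fourier_gammaKernel (hα : 0 < α) :
    𝓕 (fun l : ℝ => (gammaKernel α l : ℂ)) = wavelet α := by
  funext t
  rw [Real.fourier_real_eq_integral_exp_smul, ← setIntegral_eq_integral_of_forall_compl_eq_zero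
    (s := Set.Ioi 0) fun l hl => by
      rw [gammaKernel_of_nonpos hα (not_lt.1 hl), ofReal_zero, smul_zero]]
  have h1 := integral_rpow_mul_exp_neg_mul (p := α + 1) (by linarith)
    (w := 1 + 2 * Real.pi * t * I) (by rw [wavelet_base_re]; exact one_pos)
  have hG : (Real.Gamma (α + 1) : ℂ) ≠ 0 :=
    ofReal_ne_zero.2 (Real.Gamma_pos_of_pos (by linarith)).ne'
  rw [wavelet, eq_div_of_mul_eq hG h1.symm, div_eq_mul_inv, ← integral_mul_const]
  refine setIntegral_congr_fun measurableSet_Ioi fun l hl => ?_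
  have hl : 0 < l := hl
  simp only [gammaKernel, max_eq_left hl.le, add_sub_cancel_right, smul_eq_mul]
  have : cexp (-((1 + 2 * Real.pi * t * I) * l)) =
      cexp (((-2 * Real.pi * l * t : ℝ) : ℂ) * I) * cexp (-l) := by
    rw [← Complex.exp_add]
    congr 1
    push_cast
    ring
  rw [this]
  push_cast
  ring

open FourierTransform in
/-- The Fourier transform of the analyzing function. -/
theorem integral_exp_mul_wavelet (hα : 0 < α) (l : ℝ) :
    ∫ t : ℝ, cexp (2 * Real.pi * I * l * t) * wavelet α t = gammaKernel α l := by
  have hc : Continuous fun l : ℝ => (gammaKernel α l : ℂ) :=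
    continuous_ofReal.comp (continuous_gammaKernel hα)
  have h1 := congrFun (hc.fourierInv_fourier_eq (integrable_gammaKernel hα).ofReal
    (by rw [fourier_gammaKernel hα]; exact integrable_wavelet hα)) l
  rw [fourier_gammaKernel hα, Real.fourierInv_eq'] at h1
  rw [← h1]
  refine integral_congr_ae (Eventually.of_forall fun t => ?_)
  simp only [smul_eq_mul, RCLike.inner_apply, conj_trivial]
  congr 2
  push_cast
  ring

/-- A polynomial in 1+2πit times `wavelet α` is a combination of the functions `wavelet (α - j)`. As
long as j < α, each has integral `gammaKernel (α - j) 0` = 0, which gives the vanishing moments. -/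
theorem base_pow_mul_wavelet (j : ℕ) (t : ℝ) :
    (1 + 2 * Real.pi * t * I : ℂ) ^ j * wavelet α t = wavelet (α - j) t := by
  have h0 : (1 + 2 * Real.pi * t * I : ℂ) ≠ 0 := fun h => by
    have := congrArg re h
    rw [wavelet_base_re] at this
    simp at this
  rw [wavelet, wavelet, ← cpow_natCast, ← cpow_add _ _ h0]
  congr 1
  push_cast
  ring

/-- The moments of the analyzing function vanish. -/
theorem integral_polynomial_base_mul_wavelet {R : Polynomial ℂ}
    (hR : ∀ n ∈ R.support, (n : ℝ) < α) :
    Integrable (fun t : ℝ => R.eval (1 + 2 * Real.pi * t * I : ℂ) * wavelet α t) ∧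
      ∫ t : ℝ, R.eval (1 + 2 * Real.pi * t * I : ℂ) * wavelet α t = 0 := by
  have e : (fun t : ℝ => R.eval (1 + 2 * Real.pi * t * I : ℂ) * wavelet α t) = fun t =>
      ∑ n ∈ R.support, R.coeff n * wavelet (α - n) t := by
    funext t
    rw [Polynomial.eval_eq_sum, Polynomial.sum, Finset.sum_mul]
    refine Finset.sum_congr rfl fun n _ => ?_
    rw [mul_assoc, base_pow_mul_wavelet]
  have hi : ∀ n ∈ R.support, Integrable fun t => R.coeff n * wavelet (α - n) t := fun n hn =>
    (integrable_wavelet (sub_pos.2 (hR n hn))).const_mul _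
  rw [e]
  refine ⟨integrable_finsetSum _ hi, ?_⟩
  rw [integral_finsetSum _ hi]
  refine Finset.sum_eq_zero fun n hn => ?_
  have h1 := integral_exp_mul_wavelet (sub_pos.2 (hR n hn)) 0
  rw [gammaKernel_of_nonpos (sub_pos.2 (hR n hn)) le_rfl] at h1
  rw [integral_const_mul]
  simp only [ofReal_zero, mul_zero, zero_mul, Complex.exp_zero, one_mul] at h1
  rw [h1, mul_zero]

theorem integral_polynomial_mul_wavelet {P : Polynomial ℂ}
    (hP : ∀ n ∈ P.support, (n : ℝ) < α) (d v : ℝ) :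
    Integrable (fun t : ℝ => P.eval ((d + 2 * Real.pi * v * t : ℝ) : ℂ) * wavelet α t) ∧
      ∫ t : ℝ, P.eval ((d + 2 * Real.pi * v * t : ℝ) : ℂ) * wavelet α t = 0 := by
  -- The affine map that takes 1+2πit to d+2πvt.
  set L : Polynomial ℂ := Polynomial.C (v / I : ℂ) * Polynomial.X + Polynomial.C (d - v / I : ℂ)
    with hL
  have e : ∀ t : ℝ, P.eval ((d + 2 * Real.pi * v * t : ℝ) : ℂ) =
      (P.comp L).eval (1 + 2 * Real.pi * t * I : ℂ) := by
    intro t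
    rw [Polynomial.eval_comp]
    congr 1
    simp only [hL, Polynomial.eval_add, Polynomial.eval_mul, Polynomial.eval_C, Polynomial.eval_X]
    push_cast
    have := I_ne_zero
    field_simp
    ring
  simp only [e]
  refine integral_polynomial_base_mul_wavelet fun n hn => ?_
  rcases eq_or_ne P 0 with rfl | hP0
  · simp at hn
  · have h1 : n ≤ P.natDegree := by
      refine (Polynomial.le_natDegree_of_mem_supp n hn).trans (Polynomial.natDegree_comp_le.trans ?_)
      exact (Nat.mul_le_mul_left _ Polynomial.natDegree_linear_le).trans (by simp)
    have h2 := hP _ (Polynomial.natDegree_mem_support_of_nonzero hP0)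
    exact lt_of_le_of_lt (Nat.cast_le.2 h1) h2

end Wavelet

end FracModular

end

/-! ### Recovering the function from its fractional integral -/

section

namespace FracModular

open Complex Filter MeasureTheory

section Transform

variable {b : ℕ → ℂ} {κ m A α : ℝ} {F : ℂ → ℂ}

theorem ExpSeries.exists_norm_fracLim_le (h : ExpSeries b κ m A F) (hα : A < α) :
    ∃ K : ℝ, 0 ≤ K ∧ ∀ x : ℝ, ‖fracLim b κ m α x‖ ≤ K := by
  obtain ⟨C, hC0, hC⟩ := h.exists_holder_fracLim hα le_rfl zero_le_one (sub_pos.2 hα)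
  refine ⟨C + ‖fracLim b κ m α (0 : ℝ)‖, by positivity, fun x => ?_⟩
  have h1 := hC x 0
  rw [Real.rpow_zero, mul_one] at h1
  have h2 := norm_sub_norm_le (fracLim b κ m α x) (fracLim b κ m α (0 : ℝ))
  linarith

theorem integrable_mul_wavelet (hα : 0 < α) {g : ℝ → ℂ} (hg : Continuous g) {K : ℝ}
    (hK : ∀ x, ‖g x‖ ≤ K) (x v : ℝ) :
    Integrable fun t : ℝ => g (x + 2 * Real.pi * v * t) * wavelet α t :=
  (integrable_wavelet hα).bdd_mul (hg.comp (by fun_prop)).aestronglyMeasurable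
    (Eventually.of_forall fun _ => hK _)

theorem tendsto_integral_mul_wavelet (hα : 0 < α) {S : ℕ → ℝ → ℂ} {g : ℝ → ℂ}
    (hS : ∀ N, Continuous (S N)) (hU : TendstoUniformly S g atTop) {K : ℝ} (hK : ∀ x, ‖g x‖ ≤ K)
    (x v : ℝ) :
    Tendsto (fun N => ∫ t : ℝ, S N (x + 2 * Real.pi * v * t) * wavelet α t) atTop
      (𝓝 (∫ t : ℝ, g (x + 2 * Real.pi * v * t) * wavelet α t)) := by
  refine tendsto_integral_filter_of_dominated_convergence (fun t => (1 + K) * ‖wavelet α t‖)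
    (Eventually.of_forall fun N => ((hS N).comp (by fun_prop) |>.mul
      continuous_wavelet).aestronglyMeasurable) ?_ ((integrable_wavelet hα).norm.const_mul _)
    (Eventually.of_forall fun t => (hU.tendsto_at _).mul_const _)
  filter_upwards [Metric.tendstoUniformly_iff.1 hU 1 one_pos] with N hN
  refine Eventually.of_forall fun t => ?_
  rw [norm_mul]
  gcongr
  have h1 := hN (x + 2 * Real.pi * v * t)
  rw [dist_comm, dist_eq_norm] at h1
  have h2 := norm_sub_norm_le (S N (x + 2 * Real.pi * v * t)) (g (x + 2 * Real.pi * v * t))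
  linarith [hK (x + 2 * Real.pi * v * t)]

theorem integral_ex_mul_wavelet (hα : 0 < α) (l x v : ℝ) :
    Integrable (fun t : ℝ => ex l (x + 2 * Real.pi * v * t : ℝ) * wavelet α t) ∧
    ∫ t : ℝ, ex l (x + 2 * Real.pi * v * t : ℝ) * wavelet α t =
      ex l x * gammaKernel α (2 * Real.pi * v * l) := by
  refine ⟨integrable_mul_wavelet hα (g := fun x : ℝ => ex l x)
    ((continuous_ex l).comp continuous_ofReal) (K := 1) (fun x => (norm_ex_ofReal l x).le) x v, ?_⟩
  rw [← integral_exp_mul_wavelet hα, ← integral_const_mul]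
  refine integral_congr_ae (Eventually.of_forall fun t => ?_)
  simp only [ex, ← mul_assoc, ← Complex.exp_add]
  congr 2
  push_cast
  ring

theorem conj_ex_ofReal (l x : ℝ) : (starRingEnd ℂ) (ex l x) = ex (-l) x := by
  simp only [ex, ← exp_conj, map_mul, conj_I, conj_ofReal, map_ofNat]
  congr 1
  push_cast
  ring

/-- The wavelet transform of a fractional integral recovers the function itself. -/
theorem ExpSeries.integral_fracLim_mul_wavelet (h : ExpSeries b κ m A F) (hα : A < α) (x : ℝ)
    {v : ℝ} (hv : 0 < v) :
    ∫ t : ℝ, fracLim b κ m α (x + 2 * Real.pi * v * t : ℝ) * wavelet α t =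
      ((((2 * Real.pi / m) ^ α / Real.Gamma (α + 1) * v ^ α : ℝ)) : ℂ) * F (x + v * I) := by
  have hα0 : 0 < α := h.pos_exponent.trans hα
  have hm := h.pos
  obtain ⟨K, -, hK⟩ := h.exists_norm_fracLim_le hα
  have h1 := tendsto_integral_mul_wavelet hα0 (S := fun N x => fracSeries b κ m α N (x : ℝ))
    (fun N => (continuous_fracSeries N).comp continuous_ofReal) (h.tendstoUniformly_real hα) hK x v
  refine tendsto_nhds_unique h1 ?_
  have h2 := ((h.hasSum (x + v * I) (by simpa using hv)).mul_left
    ((((2 * Real.pi / m) ^ α / Real.Gamma (α + 1) * v ^ α : ℝ)) : ℂ)).tendsto_sum_nat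
  refine h2.congr fun N => ?_
  simp only [fracSeries, Finset.sum_mul, fracTerm, mul_assoc]
  -- Each exponential of frequency λ is multiplied by a constant times (vλ)^α e^{-2πvλ}. The power
  -- λ^α cancels the weight in the fractional integral, and the exponential moves the point x up to
  -- x+iv.
  have key := fun l => integral_ex_mul_wavelet hα0 l x v
  simp only [mul_assoc] at key
  rw [integral_finsetSum _ fun n _ => (key _).1.const_mul _]
  refine Finset.sum_congr rfl fun n _ => ?_
  simp only [integral_const_mul]
  rw [(key _).2]
  by_cases hn : 0 < (n : ℝ) + κ
  · rw [ex_add, ex_ofReal_mul_I, gammaKernel, max_eq_left (by positivity)]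
    have e : (2 * (Real.pi * (v * (((n : ℝ) + κ) / m)))) ^ α =
        (2 * Real.pi / m) ^ α * v ^ α * ((n : ℝ) + κ) ^ α := by
      rw [← Real.mul_rpow (by positivity) (by positivity),
        ← Real.mul_rpow (by positivity) (by positivity)]
      congr 1
      field_simp
    have e2 : -(2 * (Real.pi * (v * (((n : ℝ) + κ) / m)))) =
        -(2 * Real.pi * (((n : ℝ) + κ) / m) * v) := by ring
    rw [e, e2]
    have h4 : ((((n : ℝ) + κ) ^ α : ℝ) : ℂ) ≠ 0 :=
      ofReal_ne_zero.2 (Real.rpow_pos_of_pos hn α).ne'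
    push_cast at h4 ⊢
    field_simp
  · simp [h.eq_zero n hn]

/-- Conjugation makes all frequencies nonpositive, where `gammaKernel` vanishes. Hence the real and
imaginary parts carry as much information as f_α itself. -/
theorem ExpSeries.integral_conj_fracLim_mul_wavelet (h : ExpSeries b κ m A F) (hα : A < α) (x : ℝ)
    {v : ℝ} (hv : 0 < v) :
    ∫ t : ℝ, (starRingEnd ℂ) (fracLim b κ m α (x + 2 * Real.pi * v * t : ℝ)) * wavelet α t = 0 := by
  have hα0 : 0 < α := h.pos_exponent.trans hα
  have hm := h.pos
  obtain ⟨K, -, hK⟩ := h.exists_norm_fracLim_le hα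
  have hU : TendstoUniformly (fun N (x : ℝ) => (starRingEnd ℂ) (fracSeries b κ m α N x))
      (fun x : ℝ => (starRingEnd ℂ) (fracLim b κ m α x)) atTop :=
    (conjCLE : ℂ →L[ℝ] ℂ).uniformContinuous.comp_tendstoUniformly (h.tendstoUniformly_real hα)
  have h1 := tendsto_integral_mul_wavelet hα0 (fun N => continuous_conj.comp
    ((continuous_fracSeries N).comp continuous_ofReal)) hU (K := K) (fun x => by
      rw [norm_conj]; exact hK x) x v
  refine tendsto_nhds_unique h1 (tendsto_const_nhds.congr fun N => ?_)
  simp only [fracSeries, map_sum, Finset.sum_mul, fracTerm, map_mul, conj_ex_ofReal, mul_assoc,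
    Function.comp_apply]
  have key := fun l => integral_ex_mul_wavelet hα0 l x v
  simp only [mul_assoc] at key
  rw [integral_finsetSum _ fun n _ => (key _).1.const_mul _]
  refine (Finset.sum_eq_zero fun n _ => ?_).symm
  simp only [integral_const_mul]
  have h4 : 0 ≤ ((n : ℝ) + κ) / m := div_nonneg (add_nonneg (Nat.cast_nonneg n) h.nonneg) hm.le
  rw [(key _).2, gammaKernel_of_nonpos hα0]
  · simp
  · have := mul_nonneg (mul_nonneg Real.two_pi_pos.le hv.le) h4
    linarith

/-- If a linear image of the fractional integral is close to a polynomial near `x₀`, then `F` is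
small near `x₀`. -/
theorem ExpSeries.exists_norm_le_of_norm_sub_le (h : ExpSeries b κ m A F) (hα : A < α)
    {L : ℂ →L[ℝ] ℂ} {a a' : ℂ} (ha : a ≠ 0) (hL : ∀ w, L w = a * w + a' * (starRingEnd ℂ) w)
    {s₁ s₂ : ℝ} (hs₁ : 0 ≤ s₁) (hs₁' : s₁ < α) (hs₂ : 0 ≤ s₂) (hs₂' : s₂ < α) :
    ∃ K : ℝ, 0 ≤ K ∧ ∀ (x₀ C₁ C₂ : ℝ) (P : Polynomial ℂ), 0 ≤ C₁ → 0 ≤ C₂ →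
      (∀ n ∈ P.support, (n : ℝ) < α) →
      (∀ t : ℝ, ‖L (fracLim b κ m α (x₀ + t : ℝ)) - P.eval (t : ℂ)‖ ≤
        C₁ * |t| ^ s₁ + C₂ * |t| ^ s₂) →
      ∀ x v : ℝ, 0 < v → v ^ α * ‖F (x + v * I)‖ ≤
        K * (C₁ * (|x - x₀| + v) ^ s₁ + C₂ * (|x - x₀| + v) ^ s₂) := by
  have hα0 : 0 < α := h.pos_exponent.trans hα
  have hm := h.pos
  obtain ⟨M, -, hM⟩ := h.exists_norm_fracLim_le hα
  set c : ℝ := (2 * Real.pi / m) ^ α / Real.Gamma (α + 1) with hc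
  have hc0 : 0 < c :=
    div_pos (Real.rpow_pos_of_pos (by positivity) _) (Real.Gamma_pos_of_pos (by linarith))
  set J : ℝ → ℝ := fun s => ∫ t : ℝ, (1 + |t|) ^ s * ‖wavelet α t‖ with hJ
  have hJ0 : ∀ s, 0 ≤ J s := fun s => integral_nonneg fun t => by positivity
  have ha0 : 0 < ‖a‖ := norm_pos_iff.2 ha
  refine ⟨(7 ^ s₁ * J s₁ + 7 ^ s₂ * J s₂) / (‖a‖ * c), by
    have := hJ0 s₁; have := hJ0 s₂; positivity, fun x₀ C₁ C₂ P hC₁ hC₂ hP hb x v hv => ?_⟩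
  have hcont := h.continuous_fracLim hα
  have hLi := integrable_mul_wavelet hα0 (g := fun x : ℝ => L (fracLim b κ m α x))
    (L.continuous.comp hcont) (K := ‖L‖ * M) (fun x => L.le_opNorm_of_le (hM x)) x v
  -- The conjugate part of `L` integrates to 0, so the transform of L ∘ f_α is a times that of f_α.
  have h1 : ∫ t : ℝ, L (fracLim b κ m α (x + 2 * Real.pi * v * t : ℝ)) * wavelet α t =
      a * (((c * v ^ α : ℝ) : ℂ) * F (x + v * I)) := by
    have i1 := integrable_mul_wavelet hα0 hcont hM x v
    have i2 := integrable_mul_wavelet hα0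
      (g := fun x : ℝ => (starRingEnd ℂ) (fracLim b κ m α x)) (continuous_conj.comp hcont)
      (K := M) (fun x => by rw [norm_conj]; exact hM x) x v
    rw [← h.integral_fracLim_mul_wavelet hα x hv, ← integral_const_mul]
    have h2 := h.integral_conj_fracLim_mul_wavelet hα x hv
    have h3 := integral_add (i1.const_mul a) (i2.const_mul a')
    rw [integral_const_mul a', h2, mul_zero, add_zero] at h3
    rw [← h3]
    refine integral_congr_ae (Eventually.of_forall fun t => ?_)
    simp only [hL]
    ring
  -- The vanishing moments allow the polynomial to be subtracted without changing the integral.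
  obtain ⟨hPi, hP0⟩ := integral_polynomial_mul_wavelet hP (x - x₀) v
  have h2 : ‖∫ t : ℝ, (L (fracLim b κ m α (x + 2 * Real.pi * v * t : ℝ)) * wavelet α t -
      P.eval ((x - x₀ + 2 * Real.pi * v * t : ℝ) : ℂ) * wavelet α t)‖ ≤
      ∫ t : ℝ, (C₁ * (7 * (|x - x₀| + v)) ^ s₁ * ((1 + |t|) ^ s₁ * ‖wavelet α t‖) +
        C₂ * (7 * (|x - x₀| + v)) ^ s₂ * ((1 + |t|) ^ s₂ * ‖wavelet α t‖)) := by
    refine norm_integral_le_of_norm_le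
      (((integrable_rpow_mul_wavelet (by linarith) hs₁').const_mul _).add
        ((integrable_rpow_mul_wavelet (by linarith) hs₂').const_mul _))
      (Eventually.of_forall fun t => ?_)
    rw [← sub_mul, norm_mul]
    have h3 := hb (x - x₀ + 2 * Real.pi * v * t)
    rw [show x₀ + (x - x₀ + 2 * Real.pi * v * t) = x + 2 * Real.pi * v * t by ring] at h3
    -- The number 7 is a bound for 2π.
    have h4 : |x - x₀ + 2 * Real.pi * v * t| ≤ 7 * (|x - x₀| + v) * (1 + |t|) := by
      refine (abs_add_le _ _).trans ?_
      rw [abs_mul, abs_of_pos (by positivity : 0 < 2 * Real.pi * v)]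
      have hpi : 2 * Real.pi ≤ 7 := by linarith [Real.pi_lt_d2]
      have h5 : 2 * Real.pi * v * |t| ≤ 7 * v * |t| := by gcongr
      have h6 := abs_nonneg (x - x₀)
      have h7 := abs_nonneg t
      nlinarith [mul_nonneg h6 h7]
    have h5 : ∀ s : ℝ, 0 ≤ s → |x - x₀ + 2 * Real.pi * v * t| ^ s ≤
        (7 * (|x - x₀| + v)) ^ s * (1 + |t|) ^ s := fun s hs => by
      rw [← Real.mul_rpow (by positivity) (by positivity)]
      exact Real.rpow_le_rpow (abs_nonneg _) h4 hs
    have h6 := h5 s₁ hs₁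
    have h7 := h5 s₂ hs₂
    calc _ ≤ (C₁ * |x - x₀ + 2 * Real.pi * v * t| ^ s₁ +
          C₂ * |x - x₀ + 2 * Real.pi * v * t| ^ s₂) * ‖wavelet α t‖ := by gcongr
      _ ≤ (C₁ * ((7 * (|x - x₀| + v)) ^ s₁ * (1 + |t|) ^ s₁) +
          C₂ * ((7 * (|x - x₀| + v)) ^ s₂ * (1 + |t|) ^ s₂)) * ‖wavelet α t‖ := by gcongr
      _ = _ := by ring
  rw [integral_sub hLi hPi, hP0, sub_zero, h1, integral_add
    ((integrable_rpow_mul_wavelet (by linarith) hs₁').const_mul _)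
    ((integrable_rpow_mul_wavelet (by linarith) hs₂').const_mul _), integral_const_mul,
    integral_const_mul, norm_mul, norm_mul, Complex.norm_real,
    Real.norm_of_nonneg (by positivity), Real.mul_rpow (by norm_num) (by positivity),
    Real.mul_rpow (by norm_num) (by positivity)] at h2
  have hJ₁ := hJ0 s₁
  have hJ₂ := hJ0 s₂
  rw [div_mul_eq_mul_div, le_div_iff₀ (by positivity)]
  set X := C₁ * (|x - x₀| + v) ^ s₁
  set Y := C₂ * (|x - x₀| + v) ^ s₂
  have hX : 0 ≤ X := by positivity
  have hY : 0 ≤ Y := by positivity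
  have h71 : (0 : ℝ) ≤ 7 ^ s₁ := by positivity
  have h72 : (0 : ℝ) ≤ 7 ^ s₂ := by positivity
  calc v ^ α * ‖F (x + v * I)‖ * (‖a‖ * c) = ‖a‖ * (c * v ^ α * ‖F (x + v * I)‖) := by ring
    _ ≤ _ := h2
    _ = 7 ^ s₁ * J s₁ * X + 7 ^ s₂ * J s₂ * Y := by ring
    _ ≤ _ := by
      have := mul_nonneg (mul_nonneg h71 hJ₁) hY
      have := mul_nonneg (mul_nonneg h72 hJ₂) hX
      nlinarith

end Transform

end FracModular

end

/-! ### Relations between the Hölder classes -/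

section

namespace FracModular

open Complex Filter MeasureTheory

section Holder

variable {g : ℝ → ℂ} {k : ℕ} {s s' x₀ : ℝ}

/-- The monomials of degree at least s' are dropped from the polynomial: they are O(|x - x₀|^{s'})
themselves. -/
theorem MemPointwise.mono (h : MemPointwise g s x₀) (h0 : 0 ≤ s') (hs : s' ≤ s) :
    MemPointwise g s' x₀ := by
  obtain ⟨-, hc, P, hP, hO⟩ := h
  have hle : ∀ᶠ x in 𝓝 x₀, |x - x₀| ≤ 1 := by
    filter_upwards [Metric.closedBall_mem_nhds x₀ one_pos] with x hx
    simpa [Real.dist_eq] using hx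
  have hpow : ∀ n : ℝ, s' ≤ n →
      (fun x : ℝ => |x - x₀| ^ n) =O[𝓝 x₀] fun x : ℝ => |x - x₀| ^ s' := fun n hn => by
    refine Asymptotics.IsBigO.of_bound 1 ?_
    filter_upwards [hle] with x hx
    rw [one_mul, Real.norm_of_nonneg (by positivity), Real.norm_of_nonneg (by positivity)]
    exact Real.rpow_le_rpow_of_exponent_ge' (abs_nonneg _) hx h0 hn
  refine ⟨h0, hc, ∑ n ∈ P.support.filter (fun n : ℕ => (n : ℝ) < s'), Polynomial.monomial n (P.coeff n),
    fun n hn => ?_, ?_⟩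
  · by_contra hns
    refine Polynomial.mem_support_iff.1 hn ?_
    rw [Polynomial.finsetSum_coeff]
    refine Finset.sum_eq_zero fun j hj => ?_
    rw [Polynomial.coeff_monomial, if_neg]
    rintro rfl
    exact hns (Finset.mem_filter.1 hj).2
  · have e : (fun x : ℝ => g x - (∑ n ∈ P.support.filter (fun n : ℕ => (n : ℝ) < s'),
        Polynomial.monomial n (P.coeff n)).eval ((x - x₀ : ℝ) : ℂ)) = fun x =>
        (g x - P.eval ((x - x₀ : ℝ) : ℂ)) + ∑ n ∈ P.support.filter (fun n : ℕ => ¬ (n : ℝ) < s'),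
          P.coeff n * ((x - x₀ : ℝ) : ℂ) ^ n := by
      funext x
      rw [Polynomial.eval_finsetSum, Polynomial.eval_eq_sum (p := P), Polynomial.sum,
        ← Finset.sum_filter_add_sum_filter_not P.support (fun n : ℕ => (n : ℝ) < s')]
      simp only [Polynomial.eval_monomial]
      ring
    rw [e]
    refine (hO.trans (hpow s hs)).add (Asymptotics.IsBigO.fun_sum fun n hn => ?_)
    refine Asymptotics.IsBigO.trans ?_ (hpow n (not_lt.1 (Finset.mem_filter.1 hn).2))
    refine Asymptotics.IsBigO.of_bound ‖P.coeff n‖ (Eventually.of_forall fun x => ?_)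
    rw [norm_mul, norm_pow, Complex.norm_real, Real.rpow_natCast, norm_pow, Real.norm_eq_abs,
      Real.norm_eq_abs, abs_abs]

theorem DifferentiableTimesOn.hasDerivAt {Ω : Set ℝ} (h : DifferentiableTimesOn g k Ω) {j : ℕ}
    (hj : j < k) {x : ℝ} (hx : x ∈ Ω) :
    HasDerivAt (iteratedDeriv j g) (iteratedDeriv (j + 1) g x) x := by
  rw [iteratedDeriv_succ]
  exact (h j hj x hx).hasDerivAt

theorem exists_closedBall_subset_Ioo {a b : ℝ} (ha : a < x₀) (hb : x₀ < b) :
    ∃ δ : ℝ, 0 < δ ∧ ∀ x, |x - x₀| ≤ δ → x ∈ Set.Ioo a b := by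
  refine ⟨min (x₀ - a) (b - x₀) / 2, by have := lt_min (sub_pos.2 ha) (sub_pos.2 hb); linarith,
    fun x hx => ?_⟩
  have h1 := min_le_left (x₀ - a) (b - x₀)
  have h2 := min_le_right (x₀ - a) (b - x₀)
  have := abs_le.1 hx
  constructor <;> linarith [this.1, this.2]

theorem MemRestricted.memPointwise (h : MemRestricted g k s x₀) :
    MemPointwise g (k + s) x₀ := by
  obtain ⟨hs0, -, hc, ⟨a, b, ha, hb, hd, -⟩, hO⟩ := h
  obtain ⟨δ₁, hδ₁, h₁⟩ := exists_closedBall_subset_Ioo ha hb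
  obtain ⟨C, hC0, hC⟩ := hO.exists_nonneg
  obtain ⟨δ₂, hδ₂, h₂⟩ := Metric.eventually_nhds_iff.1 hC.bound
  set δ := min δ₁ (δ₂ / 2) with hδ
  have hδ0 : 0 < δ := lt_min hδ₁ (half_pos hδ₂)
  -- For s = 0 the polynomial must have degree less than k, so the coefficient of order k is
  -- dropped; its term is O(|x - x₀|^k) and goes into the error.
  set p : ℕ → ℂ := fun j => if j < k ∨ 0 < s then iteratedDeriv j g x₀ else 0 with hp
  have hT := norm_sub_sum_le_of_hasDerivAt (x₀ := x₀) (δ := δ)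
    (ε := C + ‖iteratedDeriv k g x₀‖) hs0 (by positivity) k
    (fun j => iteratedDeriv j g) p (fun j hj => by simp [hp, hj])
    (fun j hj x hx => hd.hasDerivAt hj (h₁ x (hx.trans (min_le_left _ _)))) fun x hx => by
      have h3 := h₂ (y := x) (by
        rw [Real.dist_eq]
        linarith [hx.trans (min_le_right δ₁ (δ₂ / 2))])
      rw [Real.norm_of_nonneg (by positivity)] at h3
      rcases hs0.eq_or_lt with rfl | hs
      · simp only [hp, lt_irrefl, or_false, if_false, sub_zero, Real.rpow_zero, mul_one] at h3 ⊢
        have := norm_sub_norm_le (iteratedDeriv k g x) (iteratedDeriv k g x₀)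
        linarith
      · simp only [hp, hs, or_true, if_true]
        refine h3.trans ?_
        gcongr
        linarith [norm_nonneg (iteratedDeriv k g x₀)]
  refine ⟨by positivity, hc, ∑ j ∈ Finset.range (k + 1),
    Polynomial.monomial j (p j / (j.factorial : ℂ)), fun n hn => ?_, ?_⟩
  · by_contra hns
    refine Polynomial.mem_support_iff.1 hn ?_
    rw [Polynomial.finsetSum_coeff]
    refine Finset.sum_eq_zero fun j hj => ?_
    rw [Polynomial.coeff_monomial]
    split_ifs with hjn
    · subst hjn
      have hjk : (j : ℝ) ≤ k := by exact_mod_cast Nat.lt_succ_iff.1 (Finset.mem_range.1 hj)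
      simp only [hp]
      rw [if_neg, zero_div]
      rintro (h4 | h4)
      · have : (j : ℝ) < k := by exact_mod_cast h4
        linarith
      · linarith
    · rfl
  · refine Asymptotics.IsBigO.of_bound (C + ‖iteratedDeriv k g x₀‖) ?_
    filter_upwards [Metric.closedBall_mem_nhds x₀ hδ0] with x hx
    have h5 := hT x (by simpa [Real.dist_eq] using hx)
    rw [Real.norm_of_nonneg (by positivity), Polynomial.eval_finsetSum]
    simp only [Polynomial.eval_monomial, iteratedDeriv_zero] at h5 ⊢
    convert h5 using 4
    ring

theorem MemLocal.memRestricted {a b : ℝ} (h : MemLocal g k s (Set.Ioo a b)) (ha : a < x₀)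
    (hb : x₀ < b) : MemRestricted g k s x₀ := by
  obtain ⟨hs0, hs1, hc, hd, hK⟩ := h
  have hsub : Set.Icc ((a + x₀) / 2) ((x₀ + b) / 2) ⊆ Set.Ioo a b := fun y hy =>
    ⟨by linarith [hy.1], by linarith [hy.2]⟩
  obtain ⟨hcont, C, hC⟩ := hK _ isCompact_Icc hsub
  refine ⟨hs0, hs1, hc, ⟨(a + x₀) / 2, (x₀ + b) / 2, by linarith, by linarith,
    fun j hj x hx => hd j hj x (hsub (Set.Ioo_subset_Icc_self hx)),
    hcont.mono Set.Ioo_subset_Icc_self⟩, Asymptotics.IsBigO.of_bound C ?_⟩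
  have hmem : Set.Icc ((a + x₀) / 2) ((x₀ + b) / 2) ∈ 𝓝 x₀ :=
    Icc_mem_nhds (by linarith) (by linarith)
  filter_upwards [hmem] with x hx
  rw [Real.norm_of_nonneg (by positivity)]
  exact hC x hx x₀ (mem_of_mem_nhds hmem)

/-- A continuous k-th derivative at x extends to a neighbourhood, so nearby rationals limit k even
when x is irrational. -/
theorem MemRestricted.exists_Ioo (h : MemRestricted g k s x₀) :
    ∃ a b : ℝ, a < x₀ ∧ x₀ < b ∧ ∀ y ∈ Set.Ioo a b, MemRestricted g k 0 y := by
  obtain ⟨-, -, hc, ⟨a, b, ha, hb, hd, hcont⟩, -⟩ := h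
  refine ⟨a, b, ha, hb, fun y hy => ⟨le_rfl, zero_le_one, hc, ⟨a, b, hy.1, hy.2, hd, hcont⟩, ?_⟩⟩
  simp only [Real.rpow_zero]
  have h1 : ContinuousAt (iteratedDeriv k g) y := hcont.continuousAt (Ioo_mem_nhds hy.1 hy.2)
  exact (h1.sub continuousAt_const).isBigO_one ℝ

/-- Away from `x₀`, a bounded function is close to any polynomial of degree at most `s`, up to a
multiple of `|t|^s`. -/
theorem exists_norm_sub_eval_le_of_le {M δ : ℝ} (hM : ∀ x, ‖g x‖ ≤ M) (hδ : 0 < δ)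
    (hs0 : 0 ≤ s) (P : Polynomial ℂ) (hP : ∀ n ∈ P.support, (n : ℝ) ≤ s) :
    ∃ C : ℝ, 0 ≤ C ∧ ∀ t : ℝ, δ ≤ |t| → ‖g (x₀ + t) - P.eval (t : ℂ)‖ ≤ C * |t| ^ s := by
  have hM0 : 0 ≤ M := (norm_nonneg _).trans (hM 0)
  refine ⟨M * δ ^ (-s) + ∑ n ∈ P.support, ‖P.coeff n‖ * (δ ^ n * δ ^ (-s)), by positivity,
    fun t ht => ?_⟩
  have h1 : 1 ≤ |t| / δ := (one_le_div hδ).2 ht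
  have h2 : (|t| / δ) ^ s = δ ^ (-s) * |t| ^ s := by
    rw [Real.div_rpow (abs_nonneg t) hδ.le, Real.rpow_neg hδ.le]
    ring
  have h3 : M ≤ M * δ ^ (-s) * |t| ^ s := by
    rw [mul_assoc, ← h2]
    exact le_mul_of_one_le_right hM0 (Real.one_le_rpow h1 hs0)
  have h4 : ∀ n ∈ P.support, ‖P.coeff n * (t : ℂ) ^ n‖ ≤
      ‖P.coeff n‖ * (δ ^ n * δ ^ (-s)) * |t| ^ s := fun n hn => by
    rw [norm_mul, norm_pow, Complex.norm_real, Real.norm_eq_abs]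
    have h5 : (|t| / δ) ^ n ≤ (|t| / δ) ^ s := by
      rw [← Real.rpow_natCast]
      exact Real.rpow_le_rpow_of_exponent_le h1 (hP n hn)
    have h6 : |t| ^ n = δ ^ n * (|t| / δ) ^ n := by
      rw [← mul_pow, mul_div_cancel₀ _ hδ.ne']
    rw [h6]
    calc _ ≤ ‖P.coeff n‖ * (δ ^ n * (|t| / δ) ^ s) := by gcongr
      _ = _ := by rw [h2]; ring
  rw [Polynomial.eval_eq_sum, Polynomial.sum]
  refine (norm_sub_le _ _).trans ((add_le_add ((hM _).trans h3)
    (norm_sum_le_of_le _ h4)).trans ?_)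
  rw [← Finset.sum_mul, ← add_mul]

/-- Integrals against the analyzing function run over the whole line, so the local estimate has to
be made global; boundedness of g takes care of large |t|. -/
theorem MemPointwise.exists_norm_sub_eval_le (h : MemPointwise g s x₀) {M : ℝ}
    (hM : ∀ x, ‖g x‖ ≤ M) : ∃ (P : Polynomial ℂ) (C : ℝ), 0 ≤ C ∧ (∀ n ∈ P.support, (n : ℝ) < s) ∧
      ∀ t : ℝ, ‖g (x₀ + t) - P.eval (t : ℂ)‖ ≤ C * |t| ^ s := by
  obtain ⟨hs0, -, P, hP, hO⟩ := h
  obtain ⟨C₁, hC₁0, hC₁⟩ := hO.exists_nonneg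
  obtain ⟨δ, hδ, h₁⟩ := Metric.eventually_nhds_iff.1 hC₁.bound
  obtain ⟨C₂, hC₂0, h₂⟩ := exists_norm_sub_eval_le_of_le (x₀ := x₀) hM hδ hs0 P
    fun n hn => (hP n hn).le
  refine ⟨P, max C₁ C₂, by positivity, hP, fun t => ?_⟩
  rcases lt_or_ge |t| δ with ht | ht
  · have := h₁ (y := x₀ + t) (by simpa [Real.dist_eq] using ht)
    rw [Real.norm_of_nonneg (by positivity), add_sub_cancel_left] at this
    refine this.trans ?_
    gcongr
    exact le_max_left _ _
  · refine (h₂ t ht).trans ?_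
    gcongr
    exact le_max_right _ _

/-- If `g^{(k)}` is continuous at `x₀`, then the error in Taylor's formula is `o(|t|^k)`. -/
theorem MemRestricted.exists_norm_sub_eval_le (h : MemRestricted g k s x₀) {M : ℝ}
    (hM : ∀ x, ‖g x‖ ≤ M) (hs' : k < s') :
    ∃ P : Polynomial ℂ, (∀ n ∈ P.support, n ≤ k) ∧ ∀ ε : ℝ, 0 < ε → ∃ C : ℝ, 0 ≤ C ∧
      ∀ t : ℝ, ‖g (x₀ + t) - P.eval (t : ℂ)‖ ≤ ε * |t| ^ (k : ℝ) + C * |t| ^ s' := by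
  obtain ⟨-, -, hc, ⟨a, b, ha, hb, hd, hcont⟩, -⟩ := h
  obtain ⟨δ₁, hδ₁, h₁⟩ := exists_closedBall_subset_Ioo ha hb
  have hs0 : 0 ≤ s' := (Nat.cast_nonneg k).trans hs'.le
  set P : Polynomial ℂ := ∑ j ∈ Finset.range (k + 1),
    Polynomial.monomial j (iteratedDeriv j g x₀ / (j.factorial : ℂ)) with hPdef
  have hP : ∀ n ∈ P.support, n ≤ k := fun n hn => by
    by_contra hns
    refine Polynomial.mem_support_iff.1 hn ?_
    rw [Polynomial.finsetSum_coeff]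
    refine Finset.sum_eq_zero fun j hj => ?_
    rw [Polynomial.coeff_monomial, if_neg]
    rintro rfl
    exact hns (Nat.lt_succ_iff.1 (Finset.mem_range.1 hj))
  refine ⟨P, hP, fun ε hε => ?_⟩
  have hca : ContinuousAt (iteratedDeriv k g) x₀ := hcont.continuousAt (Ioo_mem_nhds ha hb)
  obtain ⟨δ₂, hδ₂, h₂⟩ := Metric.continuousAt_iff.1 hca ε hε
  set δ := min δ₁ (δ₂ / 2) with hδ
  have hδ0 : 0 < δ := lt_min hδ₁ (half_pos hδ₂)
  obtain ⟨C, hC0, hC⟩ := exists_norm_sub_eval_le_of_le (x₀ := x₀) hM hδ0 hs0 P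
    fun n hn => (Nat.cast_le.2 (hP n hn)).trans hs'.le
  refine ⟨C, hC0, fun t => ?_⟩
  rcases le_total δ |t| with ht | ht
  · exact (hC t ht).trans (le_add_of_nonneg_left (by positivity))
  · have hT := norm_sub_sum_le_of_hasDerivAt (x₀ := x₀) (δ := δ) (s := 0) le_rfl hε.le k
      (fun j => iteratedDeriv j g) (fun j => iteratedDeriv j g x₀) (fun j hj => rfl)
      (fun j hj x hx => hd.hasDerivAt hj (h₁ x (hx.trans (min_le_left _ _)))) (fun x hx => by
        have h3 := h₂ (x := x) (by
          rw [Real.dist_eq]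
          linarith [hx.trans (min_le_right δ₁ (δ₂ / 2))])
        rw [dist_eq_norm] at h3
        simpa using h3.le) (x₀ + t) (by simpa using ht)
    refine le_add_of_le_of_nonneg ?_ (by positivity)
    simp only [iteratedDeriv_zero, add_zero, add_sub_cancel_left] at hT
    rw [hPdef, Polynomial.eval_finsetSum]
    simp only [Polynomial.eval_monomial, div_mul_eq_mul_div]
    exact hT

theorem coe_le_of_forall_lt {v : ℝ} {X : EReal} (hv : 0 < v)
    (h : ∀ s : ℝ, 0 ≤ s → s < v → ∃ s' : ℝ, s ≤ s' ∧ (s' : EReal) ≤ X) : (v : EReal) ≤ X := by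
  refine le_of_forall_lt fun c hc => ?_
  obtain ⟨s, hcs, hsv⟩ := EReal.lt_iff_exists_real_btwn.1 hc
  have hsv : s < v := EReal.coe_lt_coe_iff.1 hsv
  obtain ⟨s', hs', hX⟩ := h (max s 0) (le_max_right _ _) (max_lt hsv hv)
  exact hcs.trans_le ((EReal.coe_le_coe_iff.2 ((le_max_left s 0).trans hs')).trans hX)

theorem holderExpStarStar_le_holderExpStar (g : ℝ → ℂ) (x₀ : ℝ) :
    holderExpStarStar g x₀ ≤ holderExpStar g x₀ := by
  refine iSup_le fun a => iSup_le fun b => iSup_le fun ha => iSup_le fun hb =>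
    iSup_le fun k => iSup_le fun s => iSup_le fun h => ?_
  exact le_iSup_of_le k (le_iSup_of_le s (le_iSup_of_le (h.memRestricted ha hb) le_rfl))

theorem holderExpStar_le_holderExp (g : ℝ → ℂ) (x₀ : ℝ) :
    holderExpStar g x₀ ≤ holderExp g x₀ := by
  refine iSup_le fun k => iSup_le fun s => iSup_le fun h => ?_
  exact le_iSup_of_le (k + s) (le_iSup_of_le h.memPointwise le_rfl)

/-- The image of a Hölder class under a real linear map. -/
theorem MemPointwise.comp_continuousLinearMap (h : MemPointwise g s x₀) (L : ℂ →L[ℝ] ℂ) :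
    MemPointwise (fun x => L (g x)) s x₀ := by
  obtain ⟨hs0, hc, P, hP, hO⟩ := h
  refine ⟨hs0, L.continuous.comp hc, ∑ n ∈ P.support, Polynomial.monomial n (L (P.coeff n)),
    fun n hn => hP n ?_, ?_⟩
  · by_contra hns
    refine Polynomial.mem_support_iff.1 hn ?_
    rw [Polynomial.finsetSum_coeff]
    refine Finset.sum_eq_zero fun j hj => ?_
    rw [Polynomial.coeff_monomial, if_neg]
    rintro rfl
    exact hns hj
  · refine (Asymptotics.IsBigO.of_bound ‖L‖ (Eventually.of_forall fun x => ?_)).trans hO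
    have e : (∑ n ∈ P.support, Polynomial.monomial n (L (P.coeff n))).eval ((x - x₀ : ℝ) : ℂ) =
        L (P.eval ((x - x₀ : ℝ) : ℂ)) := by
      rw [Polynomial.eval_finsetSum, Polynomial.eval_eq_sum (p := P), Polynomial.sum, map_sum]
      refine Finset.sum_congr rfl fun n _ => ?_
      rw [Polynomial.eval_monomial, ← ofReal_pow, mul_comm, mul_comm (P.coeff n),
        ← Complex.real_smul, ← Complex.real_smul, map_smul]
    rw [e, ← map_sub]
    exact L.le_opNorm _

end Holder

end FracModular

end

/-! ### Hölder exponents of exponential series -/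

section

namespace FracModular

open Complex Filter MeasureTheory

section Exponents

variable {b : ℕ → ℂ} {κ m A α s x₀ : ℝ} {F : ℂ → ℂ} {k : ℕ} (L : ℂ →L[ℝ] ℂ)

theorem ExpSeries.hasDerivAt_map_fracLim (h : ExpSeries b κ m A F) (hα : A < α - (k + 1)) (x : ℝ) :
    HasDerivAt (fun x : ℝ => L ((2 * Real.pi * I / m) ^ k * fracLim b κ m (α - k) x))
      (L ((2 * Real.pi * I / m) ^ (k + 1) * fracLim b κ m (α - (k + 1)) x)) x := by
  have h1 := (h.hasDerivAt_fracLim (α := α - k) (by linarith) x).const_mul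
    ((2 * Real.pi * I / m : ℂ) ^ k)
  rw [sub_sub, ← mul_assoc, ← pow_succ] at h1
  exact L.hasFDerivAt.comp_hasDerivAt x h1

/-- Differentiating k times lowers the order of the fractional integral from α to α-k, up to a
constant. -/
theorem ExpSeries.iteratedDeriv_map_fracLim (h : ExpSeries b κ m A F) (hα : A < α - k) :
    iteratedDeriv k (fun x : ℝ => L (fracLim b κ m α x)) =
      fun x : ℝ => L ((2 * Real.pi * I / m) ^ k * fracLim b κ m (α - k) x) := by
  induction k with
  | zero => simp
  | succ k ih =>
    push_cast at hα
    rw [iteratedDeriv_succ, ih (by linarith)]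
    funext x
    rw [(h.hasDerivAt_map_fracLim L hα x).deriv]
    push_cast
    rfl

theorem ExpSeries.differentiableTimesOn_map_fracLim (h : ExpSeries b κ m A F) (hα : A < α - k)
    (Ω : Set ℝ) : DifferentiableTimesOn (fun x : ℝ => L (fracLim b κ m α x)) k Ω := by
  intro j hj x _
  have hjk : (j : ℝ) + 1 ≤ k := by exact_mod_cast hj
  rw [h.iteratedDeriv_map_fracLim L (by linarith)]
  exact (h.hasDerivAt_map_fracLim L (by linarith) x).differentiableAt

theorem ExpSeries.continuous_map_fracLim (h : ExpSeries b κ m A F) (hα : A < α) (c : ℂ) :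
    Continuous fun x : ℝ => L (c * fracLim b κ m α x) :=
  L.continuous.comp (continuous_const.mul (h.continuous_fracLim hα))

theorem ExpSeries.memLocal_map_fracLim (h : ExpSeries b κ m A F) (hα : A < α - k) (hs0 : 0 ≤ s)
    (hs1 : s ≤ 1) (hs : s < α - k - A) (Ω : Set ℝ) :
    MemLocal (fun x : ℝ => L (fracLim b κ m α x)) k s Ω := by
  have hα' : A < α := by linarith [(Nat.cast_nonneg k : (0 : ℝ) ≤ k)]
  refine ⟨hs0, hs1, by simpa using h.continuous_map_fracLim L hα' 1,
    h.differentiableTimesOn_map_fracLim L hα Ω, fun K _ _ => ?_⟩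
  rw [h.iteratedDeriv_map_fracLim L hα]
  refine ⟨(h.continuous_map_fracLim L hα _).continuousOn, ?_⟩
  obtain ⟨C, hC0, hC⟩ := h.exists_holder_fracLim hα hs0 hs1 hs
  refine ⟨‖L‖ * (‖(2 * Real.pi * I / m : ℂ) ^ k‖ * C), fun x _ y _ => ?_⟩
  generalize (2 * Real.pi * I / m : ℂ) ^ k = c
  rw [← map_sub, ← mul_sub]
  refine (L.le_opNorm _).trans ?_
  rw [norm_mul]
  calc _ ≤ ‖L‖ * (‖c‖ * (C * |x - y| ^ s)) := by gcongr; exact hC x y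
    _ = _ := by ring

theorem ExpSeries.memRestricted_map_fracLim (h : ExpSeries b κ m A F) (hα : A < α - k)
    (hs0 : 0 < s) (hs1 : s ≤ 1)
    (hG : MemPointwise (fun x : ℝ => fracLim b κ m (α - k) x) s x₀) :
    MemRestricted (fun x : ℝ => L (fracLim b κ m α x)) k s x₀ := by
  have hα' : A < α := by linarith [(Nat.cast_nonneg k : (0 : ℝ) ≤ k)]
  refine ⟨hs0.le, hs1, by simpa using h.continuous_map_fracLim L hα' 1,
    ⟨x₀ - 1, x₀ + 1, by linarith, by linarith, h.differentiableTimesOn_map_fracLim L hα _, ?_⟩, ?_⟩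
  · rw [h.iteratedDeriv_map_fracLim L hα]
    exact (h.continuous_map_fracLim L hα _).continuousOn
  · rw [h.iteratedDeriv_map_fracLim L hα]
    obtain ⟨-, -, P, hP, hO⟩ := hG
    -- As s ≤ 1 the polynomial is constant, and as s > 0 the estimate at x₀ itself identifies the
    -- constant with the value there.
    have hconst : ∀ w, P.eval w = P.coeff 0 := fun w => by
      have : P.natDegree = 0 := by
        by_contra hne
        have hP0 : P ≠ 0 := by rintro rfl; simp at hne
        have h1 := hP _ (Polynomial.natDegree_mem_support_of_nonzero hP0)
        have h2 : (1 : ℝ) ≤ P.natDegree := by exact_mod_cast Nat.one_le_iff_ne_zero.2 hne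
        linarith
      rw [Polynomial.eq_C_of_natDegree_eq_zero this]
      simp
    simp only [hconst] at hO
    have h0 : P.coeff 0 = fracLim b κ m (α - k) x₀ := by
      obtain ⟨C, hC⟩ := hO.bound
      have := hC.self_of_nhds
      rw [sub_self, abs_zero, Real.zero_rpow hs0.ne', norm_zero, mul_zero, norm_le_zero_iff,
        sub_eq_zero] at this
      exact this.symm
    rw [h0] at hO
    refine (Asymptotics.IsBigO.of_bound (‖L‖ * ‖(2 * Real.pi * I / m : ℂ) ^ k‖)
      (Eventually.of_forall fun x => ?_)).trans hO
    generalize (2 * Real.pi * I / m : ℂ) ^ k = c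
    rw [← map_sub, ← mul_sub, mul_assoc, ← norm_mul]
    exact L.le_opNorm _

theorem ExpSeries.le_holderExpStarStar (h : ExpSeries b κ m A F) (hα : A < α) (x₀ : ℝ) :
    ((α - A : ℝ) : EReal) ≤ holderExpStarStar (fun x : ℝ => L (fracLim b κ m α x)) x₀ := by
  have hpos := sub_pos.2 hα
  refine coe_le_of_forall_lt hpos fun s hs0 hs => ?_
  -- This choice gives k < α-A ≤ k+1. When α-A is an integer the exponent is approached with one
  -- derivative fewer and Hölder order tending to 1.
  obtain ⟨k, hk⟩ : ∃ k : ℕ, ⌈α - A⌉₊ = k + 1 :=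
    Nat.exists_eq_add_one.2 (Nat.ceil_pos.2 hpos)
  have h1 : (k : ℝ) < α - A := Nat.lt_ceil.1 (by omega)
  have h2 : α - A ≤ k + 1 := by
    have := Nat.le_ceil (α - A)
    rw [hk] at this
    exact_mod_cast this
  have hM := h.memLocal_map_fracLim L (α := α) (k := k) (s := max (s - k) 0) (by linarith)
    (le_max_right _ _) (max_le (by linarith) zero_le_one) (max_lt (by linarith) (by linarith))
    (Set.Ioo (x₀ - 1) (x₀ + 1))
  refine ⟨k + max (s - k) 0, by linarith [le_max_left (s - k) 0], ?_⟩
  exact le_iSup_of_le (x₀ - 1) (le_iSup_of_le (x₀ + 1) (le_iSup_of_le (by linarith)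
    (le_iSup_of_le (by linarith) (le_iSup_of_le k (le_iSup_of_le _ (le_iSup_of_le hM le_rfl))))))

theorem le_of_forall_exists_rpow_le {p q c K : ℝ} (hc : 0 < c) (hK : 0 ≤ K)
    (h : ∀ ε : ℝ, 0 < ε → ∃ v : ℝ, 0 < v ∧ v < ε ∧ c * v ^ p ≤ K * v ^ q) : q ≤ p := by
  by_contra! hpq
  have hqp : 0 < q - p := sub_pos.2 hpq
  have hcK : 0 < c / (K + 1) := by positivity
  obtain ⟨v, hv, hvε, hle⟩ := h ((c / (K + 1)) ^ (1 / (q - p))) (by positivity)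
  have h1 : v ^ (q - p) < c / (K + 1) := by
    have := Real.rpow_lt_rpow hv.le hvε hqp
    rwa [← Real.rpow_mul hcK.le, one_div_mul_cancel hqp.ne', Real.rpow_one] at this
  rw [lt_div_iff₀ (by positivity)] at h1
  have hp : 0 < v ^ p := Real.rpow_pos_of_pos hv p
  have hp' : 0 < v ^ (q - p) := Real.rpow_pos_of_pos hv _
  have h2 : v ^ q = v ^ p * v ^ (q - p) := by rw [← Real.rpow_add hv]; ring_nf
  rw [h2] at hle
  nlinarith [mul_lt_mul_of_pos_left h1 hp, mul_pos hp hp']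

variable {L} {a a' : ℂ}

theorem ExpSeries.exists_norm_map_fracLim_le (h : ExpSeries b κ m A F) (hα : A < α) :
    ∃ M : ℝ, ∀ x : ℝ, ‖L (fracLim b κ m α x)‖ ≤ M := by
  obtain ⟨M, -, hM⟩ := h.exists_norm_fracLim_le hα
  exact ⟨‖L‖ * M, fun x => L.le_opNorm_of_le (hM x)⟩

theorem ExpSeries.exists_norm_le_of_memPointwise (h : ExpSeries b κ m A F) (hα : A < α)
    (ha : a ≠ 0) (hL : ∀ w, L w = a * w + a' * (starRingEnd ℂ) w) (hs : s < α)
    (hg : MemPointwise (fun x : ℝ => L (fracLim b κ m α x)) s x₀) :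
    ∃ K : ℝ, 0 ≤ K ∧ ∀ x v : ℝ, 0 < v → v ^ α * ‖F (x + v * I)‖ ≤ K * (|x - x₀| + v) ^ s := by
  obtain ⟨M, hM⟩ := h.exists_norm_map_fracLim_le (L := L) hα
  obtain ⟨P, C, hC0, hP, hC⟩ := hg.exists_norm_sub_eval_le hM
  obtain ⟨K, hK0, hK⟩ := h.exists_norm_le_of_norm_sub_le hα ha hL hg.1 hs hg.1 hs
  refine ⟨K * C, by positivity, fun x v hv => ?_⟩
  have := hK x₀ C 0 P hC0 le_rfl (fun n hn => (hP n hn).trans hs)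
    (fun t => by rw [zero_mul, add_zero]; exact hC t) x v hv
  rwa [zero_mul, add_zero, ← mul_assoc] at this

/-- An upper bound for pointwise Hölder exponents from large values of `F` in a cone. -/
theorem ExpSeries.le_of_memPointwise (h : ExpSeries b κ m A F) (hα : A < α)
    (ha : a ≠ 0) (hL : ∀ w, L w = a * w + a' * (starRingEnd ℂ) w)
    (hg : MemPointwise (fun x : ℝ => L (fracLim b κ m α x)) s x₀) {ρ C c : ℝ} (hρ : 0 < ρ)
    (hρα : ρ ≤ α) (hC : 0 ≤ C) (hc : 0 < c)
    (hF : ∀ ε : ℝ, 0 < ε → ∃ x v : ℝ, 0 < v ∧ v < ε ∧ |x - x₀| ≤ C * v ∧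
      c * v ^ (-ρ) ≤ ‖F (x + v * I)‖) : s ≤ α - ρ := by
  by_contra! hs
  -- The exponent is lowered below α, where the analyzing function has enough decay, but kept above
  -- α-ρ for the contradiction.
  set s' := min s (α - ρ / 2) with hs'
  have h1 : α - ρ < s' := lt_min hs (by linarith)
  have h2 : s' < α := (min_le_right _ _).trans_lt (by linarith)
  have h0 : 0 ≤ s' := by linarith
  obtain ⟨K, hK0, hK⟩ := h.exists_norm_le_of_memPointwise hα ha hL h2
    (hg.mono h0 (min_le_left _ _))
  refine absurd (le_of_forall_exists_rpow_le (p := α - ρ) (q := s') (K := K * (C + 1) ^ s') hc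
    (by positivity) fun ε hε => ?_) (not_le.2 h1)
  obtain ⟨x, v, hv, hvε, hx, hxF⟩ := hF ε hε
  refine ⟨v, hv, hvε, ?_⟩
  calc c * v ^ (α - ρ) = v ^ α * (c * v ^ (-ρ)) := by rw [sub_eq_add_neg, Real.rpow_add hv]; ring
    _ ≤ v ^ α * ‖F (x + v * I)‖ := by gcongr
    _ ≤ K * (|x - x₀| + v) ^ s' := hK x v hv
    _ ≤ K * ((C + 1) * v) ^ s' := by gcongr; linarith
    _ = _ := by rw [Real.mul_rpow (by positivity) hv.le]; ring

/-- If `F` grows like `v^{k-α}` above `x₀`, then the `k`-th derivative is not continuous at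
`x₀`. -/
theorem ExpSeries.not_memRestricted (h : ExpSeries b κ m A F) (hα : A < α)
    (ha : a ≠ 0) (hL : ∀ w, L w = a * w + a' * (starRingEnd ℂ) w) {ρ c : ℝ} (hρ : 0 < ρ)
    (hk : α - ρ = k) (hc : 0 < c)
    (hF : ∀ ε : ℝ, 0 < ε → ∃ v : ℝ, 0 < v ∧ v < ε ∧ c * v ^ (-ρ) ≤ ‖F (x₀ + v * I)‖) :
    ¬ MemRestricted (fun x : ℝ => L (fracLim b κ m α x)) k s x₀ := by
  intro hg
  obtain ⟨M, hM⟩ := h.exists_norm_map_fracLim_le (L := L) hα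
  obtain ⟨P, hP, hb⟩ := hg.exists_norm_sub_eval_le (s' := k + ρ / 2) hM (by linarith)
  have hk0 : (0 : ℝ) ≤ k := Nat.cast_nonneg k
  have hkα : (k : ℝ) < α := by linarith
  obtain ⟨K, hK0, hK⟩ := h.exists_norm_le_of_norm_sub_le hα ha hL hk0 hkα
    (s₂ := k + ρ / 2) (by linarith) (by linarith)
  -- The o(|t|^k) error is taken so small that it contributes at most half of the lower bound c v^k.
  -- The other half would have to be O(v^{k+ρ/2}), which fails as v tends to 0.
  set η := c / (2 * (K + 1)) with hη
  obtain ⟨C, hC0, hC⟩ := hb η (by positivity)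
  refine absurd (le_of_forall_exists_rpow_le (p := k) (q := k + ρ / 2) (K := K * C) (half_pos hc)
    (by positivity) fun ε hε => ?_) (by linarith)
  obtain ⟨v, hv, hvε, hvF⟩ := hF ε hε
  refine ⟨v, hv, hvε, ?_⟩
  have h1 := hK x₀ η C P (by positivity) hC0
    (fun n hn => (Nat.cast_le.2 (hP n hn)).trans_lt hkα) hC x₀ v hv
  rw [sub_self, abs_zero, zero_add] at h1
  have h2 : c * v ^ (k : ℝ) ≤ v ^ α * ‖F (x₀ + v * I)‖ := by
    calc c * v ^ (k : ℝ) = v ^ α * (c * v ^ (-ρ)) := by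
          rw [← hk, sub_eq_add_neg, Real.rpow_add hv]; ring
      _ ≤ _ := by gcongr
  have h3 : K * η ≤ c / 2 := by
    rw [hη, ← mul_div_assoc, div_le_div_iff₀ (by positivity) two_pos]
    nlinarith
  have h4 : 0 < v ^ (k : ℝ) := Real.rpow_pos_of_pos hv _
  nlinarith [mul_le_mul_of_nonneg_right h3 h4.le]

end Exponents

end FracModular

end

/-! ### The fractional integral of a modular form as an exponential series -/

section

namespace FracModular

open Complex Filter MeasureTheory
open UpperHalfPlane hiding I

section Modular

variable {Γ : Subgroup SL(2, ℤ)} {r α s x A : ℝ} {f : ℍ → ℂ}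

/-- The constant term of the expansion of `f` at `∞`. -/
def constTerm (Γ : Subgroup SL(2, ℤ)) (f : ℍ → ℂ) : ℂ :=
  if 0 < cuspParam (dilate Γ f) then 0 else fourierCoef (dilate Γ f) 0

/-- The coefficients of the expansion of `f` at `∞`, without the constant term. -/
def posCoef (Γ : Subgroup SL(2, ℤ)) (f : ℍ → ℂ) (n : ℕ) : ℂ :=
  if 0 < (n : ℝ) + cuspParam (dilate Γ f) then fourierCoef (dilate Γ f) n else 0

/-- The function `f` without its constant term, on the upper half-plane in `ℂ`. -/
def subConst (Γ : Subgroup SL(2, ℤ)) (f : ℍ → ℂ) (z : ℂ) : ℂ := f (ofComplex z) - constTerm Γ f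

/-- Without its constant term the expansion has positive frequencies only, and a constant is
O(y^{-A}) for y ≤ 1. -/
theorem expSeries_subConst [Γ.FiniteIndex] (hr : 0 < r) (hf : IsModularForm Γ r f) (hf0 : f ≠ 0)
    (hA : 0 < A) (hb : ∃ C : ℝ, ∀ z : ℍ, z.im ≤ 1 → ‖f z‖ ≤ C * z.im ^ (-A)) :
    ExpSeries (posCoef Γ f) (cuspParam (dilate Γ f)) (width Γ 1) A (subConst Γ f) := by
  have hL := isCuspLift_dilate (Γ := Γ) hf
  have hm := hL.pos
  have hm' : ((width Γ 1 : ℝ) : ℂ) ≠ 0 := ofReal_ne_zero.2 hm.ne'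
  refine ⟨(cuspParam_mem hL.holo (hL.ne_zero hf0) (hL.norm_vadd hf)).1, hm, hA,
    fun n hn => if_neg hn, ?_, fun z hz => ?_, ?_⟩
  · exact (UpperHalfPlane.mdifferentiable_iff.1 hf.holo).sub_const _
  · have hw : 0 < (z / (width Γ 1 : ℝ)).im := by
      rw [div_ofReal_im]
      exact div_pos hz hm
    have h1 := hasSum_fourier_sub_const hL.holo (hL.ne_zero hf0) (hL.norm_vadd hf)
      (hL.growth hr hf) _ hw
    convert! h1 using 1
    · funext n
      simp only [posCoef, ex]
      congr 2
      push_cast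
      ring
    · simp only [subConst, constTerm, dilate]
      congr 3
      rw [ofComplex_apply_of_im_pos hw]
      show z = (width Γ 1 : ℂ) * (z / (width Γ 1 : ℝ))
      rw [← ofReal_natCast]
      field_simp
  · obtain ⟨C, hC⟩ := hb
    refine ⟨|C| + ‖constTerm Γ f‖, fun z hz hz1 => ?_⟩
    have h1 := hC ⟨z, hz⟩ hz1
    have h2 : (1 : ℝ) ≤ z.im ^ (-A) :=
      Real.one_le_rpow_of_pos_of_le_one_of_nonpos hz hz1 (by linarith)
    rw [subConst, ofComplex_apply_of_im_pos hz]
    refine (norm_sub_le _ _).trans ?_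
    rw [add_mul]
    refine add_le_add (h1.trans ?_) (le_mul_of_one_le_right (norm_nonneg _) h2)
    exact mul_le_mul_of_nonneg_right (le_abs_self C) (by positivity)

theorem fracPartialSum_eq (Γ : Subgroup SL(2, ℤ)) (f : ℍ → ℂ) (α : ℝ) (N : ℕ) (x : ℝ) :
    fracPartialSum Γ f α N x =
      fracSeries (posCoef Γ f) (cuspParam (dilate Γ f)) (width Γ 1) α N x := by
  refine Finset.sum_congr rfl fun n _ => ?_
  rw [fracTerm, posCoef, ex]
  split_ifs
  · congr 2
    push_cast
    ring
  · simp

theorem fracIntegral_eq (Γ : Subgroup SL(2, ℤ)) (f : ℍ → ℂ) (α x : ℝ) :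
    fracIntegral Γ f α x = fracLim (posCoef Γ f) (cuspParam (dilate Γ f)) (width Γ 1) α x := by
  simp only [fracIntegral, fracLim, fracPartialSum_eq]

theorem exists_le_norm_subConst (Γ : Subgroup SL(2, ℤ)) (f : ℍ → ℂ) {ρ c : ℝ} (hρ : 0 < ρ)
    (hc : 0 < c) : ∃ ε : ℝ, 0 < ε ∧ ∀ z : ℍ, z.im < ε → c * z.im ^ (-ρ) ≤ ‖f z‖ →
      c / 2 * z.im ^ (-ρ) ≤ ‖subConst Γ f z‖ := by
  -- Below height M^{-1/ρ} the constant term is less than half of c y^{-ρ}.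
  set M := 2 * (‖constTerm Γ f‖ + 1) / c with hM
  have hM0 : 0 < M := by positivity
  refine ⟨M ^ (-(1 / ρ)), by positivity, fun z hz h => ?_⟩
  have h1 : M ≤ z.im ^ (-ρ) := by
    calc M = (M ^ (-(1 / ρ))) ^ (-ρ) := by
          rw [← Real.rpow_mul hM0.le, neg_mul_neg, one_div_mul_cancel hρ.ne', Real.rpow_one]
      _ ≤ _ := Real.rpow_le_rpow_of_nonpos z.im_pos hz.le (by linarith)
  rw [hM, div_le_iff₀ hc] at h1
  rw [subConst, ofComplex_apply]
  have h2 := norm_sub_norm_le (f z) (constTerm Γ f)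
  linarith

/-- From y ≤ |z-x| ≤ 1 and B ≤ r it follows that y^{-r}|z-x|^B ≥ 1, so the constant term is
harmless. -/
theorem exists_norm_subConst_le (Γ : Subgroup SL(2, ℤ)) {B : ℝ} (hB : 0 ≤ B) (hBr : B ≤ r)
    (h : ∃ C : ℝ, ∀ z : ℍ, ‖(z : ℂ) - x‖ ≤ 1 → ‖f z‖ ≤ C * z.im ^ (-r) * ‖(z : ℂ) - x‖ ^ B) :
    ∃ C : ℝ, ∀ z : ℂ, 0 < z.im → ‖z - x‖ ≤ 1 →
      ‖subConst Γ f z‖ ≤ C * (z.im ^ (-r) * ‖z - x‖ ^ B) := by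
  obtain ⟨C, hC⟩ := h
  refine ⟨C + ‖constTerm Γ f‖, fun z hz hz1 => ?_⟩
  have h1 := hC ⟨z, hz⟩ hz1
  have him : z.im ≤ ‖z - x‖ := by
    have := abs_im_le_norm (z - x)
    simp only [sub_im, ofReal_im, sub_zero] at this
    exact (le_abs_self _).trans this
  have h0 : 0 < ‖z - x‖ := hz.trans_le him
  have h2 : 1 ≤ z.im ^ (-r) * ‖z - x‖ ^ B := by
    have h3 : 1 ≤ z.im ^ (-B) * ‖z - x‖ ^ B := by
      rw [Real.rpow_neg hz.le, inv_mul_eq_div, one_le_div (Real.rpow_pos_of_pos hz B)]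
      exact Real.rpow_le_rpow hz.le him hB
    refine h3.trans ?_
    gcongr 1
    exact Real.rpow_le_rpow_of_exponent_ge hz (him.trans hz1) (by linarith)
  rw [subConst, ofComplex_apply_of_im_pos hz, add_mul]
  refine (norm_sub_le _ _).trans (add_le_add (by rw [← mul_assoc]; exact h1) ?_)
  exact le_mul_of_one_le_right (norm_nonneg _) h2

end Modular

end FracModular

end

/-! ### Upper bounds for the exponents of a modular form -/

section

namespace FracModular

open Complex Filter MeasureTheory
open UpperHalfPlane hiding I

section Upper

variable {Γ : Subgroup SL(2, ℤ)} {r α s x A : ℝ} {f : ℍ → ℂ} {L : ℂ →L[ℝ] ℂ} {a a' : ℂ}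

theorem ofComplex_add_mul_I (x : ℝ) {v : ℝ} (hv : 0 < v) :
    ∃ z : ℍ, (z : ℂ) = x + v * I ∧ z.re = x ∧ z.im = v :=
  ⟨⟨x + v * I, by simpa using hv⟩, rfl, by
    rw [← UpperHalfPlane.coe_re]; simp, by rw [← UpperHalfPlane.coe_im]; simp⟩

variable [Γ.FiniteIndex] (hr : 0 < r) (hf : IsModularForm Γ r f) (hf0 : f ≠ 0)
  (h : ExpSeries (posCoef Γ f) (cuspParam (dilate Γ f)) (width Γ 1) A (subConst Γ f))
  (hα : A < α) (ha : a ≠ 0) (hL : ∀ w, L w = a * w + a' * (starRingEnd ℂ) w)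

-- The recurrent points lie in a cone at x and there |f| ≥ C⁻¹ y^{-r/2}. Cuspidality plays no part,
-- so the bound also serves non-cuspidal forms when τ_x = 2.
include hr hf hf0 h hα ha hL in
theorem le_sub_half_of_memPointwise (hrα : r / 2 ≤ α) (hx : Irrational x)
    (hg : MemPointwise (fun y => L (fracIntegral Γ f α y)) s x) : s ≤ α - r / 2 := by
  simp only [fracIntegral_eq] at hg
  obtain ⟨C, hC1, hC⟩ := exists_recurrent hf hf0 hx
  have hC0 : 0 < C := by linarith
  obtain ⟨ε₀, hε₀, hF⟩ := exists_le_norm_subConst Γ f (half_pos hr) (inv_pos.2 hC0)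
  refine h.le_of_memPointwise hα ha hL hg (half_pos hr) hrα hC0.le (half_pos (inv_pos.2 hC0))
    fun ε hε => ?_
  obtain ⟨z, hz1, hz2, hz3⟩ := hC (min ε ε₀) (lt_min hε hε₀)
  have him : z.im ≤ ‖(z : ℂ) - x‖ := by
    have := abs_im_le_norm ((z : ℂ) - x)
    simp only [sub_im, ofReal_im, sub_zero, UpperHalfPlane.coe_im] at this
    exact (le_abs_self _).trans this
  have hre : |z.re - x| ≤ ‖(z : ℂ) - x‖ := by
    simpa using abs_re_le_norm ((z : ℂ) - x)
  refine ⟨z.re, z.im, z.im_pos, (him.trans_lt hz1).trans_le (min_le_left _ _), hre.trans hz2, ?_⟩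
  rw [UpperHalfPlane.re_add_im]
  refine hF z ((him.trans_lt hz1).trans_le (min_le_right _ _)) ?_
  rw [inv_mul_le_iff₀ hC0, Real.rpow_neg z.im_pos.le, inv_le_iff_one_le_mul₀
    (Real.rpow_pos_of_pos z.im_pos _), mul_assoc]
  exact hz3

include hr hf hf0 in
theorem exists_le_norm_subConst_above_rat {q : ℚ}
    (hq : ¬ IsCuspidalAt Γ r f (q : OnePoint ℚ)) : ∃ c : ℝ, 0 < c ∧ ∀ ε : ℝ, 0 < ε →
      ∃ v : ℝ, 0 < v ∧ v < ε ∧ c * v ^ (-r) ≤ ‖subConst Γ f ((q : ℝ) + v * I)‖ := by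
  obtain ⟨C, hC1, hC⟩ := exists_le_norm_above_rat hr hf hf0
  have hC0 : 0 < C := by linarith
  have hd : (0 : ℝ) < q.den := by exact_mod_cast q.den_pos
  set c := C⁻¹ * (q.den : ℝ) ^ (-r) with hc
  have hc0 : 0 < c := by positivity
  obtain ⟨ε₀, hε₀, hF⟩ := exists_le_norm_subConst Γ f hr hc0
  refine ⟨c / 2, half_pos hc0, fun ε hε => ?_⟩
  set v := min (ε / 2) (min (ε₀ / 2) (1 / (C * (q.den : ℝ) ^ 2))) with hv
  have hv0 : 0 < v := lt_min (half_pos hε) (lt_min (half_pos hε₀) (by positivity))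
  obtain ⟨z, hz, hzre, hzim⟩ := ofComplex_add_mul_I q hv0
  refine ⟨v, hv0, (min_le_left _ _).trans_lt (half_lt_self hε), ?_⟩
  have h1 := hC q hq z hzre (by
    have : v ≤ 1 / (C * (q.den : ℝ) ^ 2) := (min_le_right _ _).trans (min_le_right _ _)
    rw [le_div_iff₀ (by positivity)] at this
    rw [hzim]
    linarith)
  have h2 := hF z (by
    rw [hzim]
    exact ((min_le_right _ _).trans (min_le_left _ _)).trans_lt (half_lt_self hε₀)) (by
    rw [hzim] at h1 ⊢
    rw [Real.mul_rpow hd.le hv0.le] at h1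
    rw [hc, mul_assoc, inv_mul_le_iff₀ hC0]
    exact h1)
  rwa [hz, hzim] at h2

include hr hf hf0 h hα ha hL in
theorem le_sub_of_memPointwise_rat (hrα : r ≤ α) {q : ℚ}
    (hq : ¬ IsCuspidalAt Γ r f (q : OnePoint ℚ))
    (hg : MemPointwise (fun y => L (fracIntegral Γ f α y)) s q) : s ≤ α - r := by
  simp only [fracIntegral_eq] at hg
  obtain ⟨c, hc, hF⟩ := exists_le_norm_subConst_above_rat hr hf hf0 hq
  refine h.le_of_memPointwise hα ha hL hg hr hrα le_rfl hc fun ε hε => ?_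
  obtain ⟨v, hv, hvε, hvF⟩ := hF ε hε
  exact ⟨q, v, hv, hvε, by simp, hvF⟩

include hr hf hf0 h hα ha hL in
theorem not_memRestricted_rat {k : ℕ} (hk : α - r = k) {q : ℚ}
    (hq : ¬ IsCuspidalAt Γ r f (q : OnePoint ℚ)) :
    ¬ MemRestricted (fun y => L (fracIntegral Γ f α y)) k s q := by
  simp only [fracIntegral_eq]
  obtain ⟨c, hc, hF⟩ := exists_le_norm_subConst_above_rat hr hf hf0 hq
  exact h.not_memRestricted hα ha hL hr hk hc hF

theorem finite_rat_den_le (x C : ℝ) (N : ℕ) : {q : ℚ | q.den ≤ N ∧ |x - q| ≤ C}.Finite := by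
  have hfin : (Set.Icc (-⌈(|x| + C) * N⌉) ⌈(|x| + C) * N⌉ ×ˢ Set.Iic N).Finite :=
    (Set.finite_Icc _ _).prod (Set.finite_Iic N)
  refine Set.Finite.of_injOn (f := fun q : ℚ => (q.num, q.den)) (fun q hq => ?_)
    (fun q _ q' _ hqq => Rat.ext (Prod.ext_iff.1 hqq).1 (Prod.ext_iff.1 hqq).2) hfin
  obtain ⟨h1, h2⟩ := hq
  have hd : (0 : ℝ) < q.den := by exact_mod_cast q.den_pos
  have h3 : |(q : ℝ)| ≤ |x| + C := by
    have := abs_sub_abs_le_abs_sub (q : ℝ) x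
    rw [abs_sub_comm] at this
    linarith
  have h4 : |(q.num : ℝ)| ≤ (|x| + C) * N := by
    have e : (q.num : ℝ) = q * q.den := by exact_mod_cast (Rat.mul_den_eq_num q).symm
    rw [e, abs_mul, abs_of_pos hd]
    have : (q.den : ℝ) ≤ N := by exact_mod_cast h1
    have := (abs_nonneg (q : ℝ)).trans h3
    gcongr
  have h5 : |q.num| ≤ ⌈(|x| + C) * N⌉ := by
    have := h4.trans (Int.le_ceil _)
    exact_mod_cast this
  exact ⟨⟨by linarith [(abs_le.1 h5).1], (abs_le.1 h5).2⟩, h1⟩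

-- The test point lies above q at height v = |x-q|, hence in a fixed cone at x. There |f| is at
-- least of order (dv)^{-r}, and v ≤ C₀d^{-τ} bounds d by (C₀/v)^{1/τ}, so that |f| is at least of
-- order v^{-(r-r/τ)}.
include hr hf hf0 h hα ha hL in
theorem le_of_memPointwise_of_approx {τ C₀ : ℝ} (hrα : r ≤ α) (hx : Irrational x) (hτ : 2 < τ)
    (hinf : {q : ℚ | ¬ IsCuspidalAt Γ r f (q : OnePoint ℚ) ∧
      |x - (q : ℝ)| ≤ C₀ / (q.den : ℝ) ^ τ}.Infinite)
    (hg : MemPointwise (fun y => L (fracIntegral Γ f α y)) s x) : s ≤ α - (r - r / τ) := by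
  simp only [fracIntegral_eq] at hg
  obtain ⟨C, hC1, hC⟩ := exists_le_norm_above_rat hr hf hf0
  have hC' : 0 < C := by linarith
  have hτ0 : 0 < τ := by linarith
  have hxq : ∀ q : ℚ, 0 < |x - q| := fun q =>
    abs_pos.2 (sub_ne_zero.2 (hx.ne_rat q))
  have hC₀ : 0 < C₀ := by
    obtain ⟨q, -, hq⟩ := hinf.nonempty
    have hd : (0 : ℝ) < q.den := by exact_mod_cast q.den_pos
    have := (hxq q).trans_le hq
    exact (div_pos_iff_of_pos_right (Real.rpow_pos_of_pos hd τ)).1 this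
  have hρ : 0 < r - r / τ := by
    have : r / τ < r := div_lt_self hr (by linarith)
    linarith
  set c := C⁻¹ * C₀ ^ (-(r / τ)) with hc
  have hc0 : 0 < c := by positivity
  obtain ⟨ε₀, hε₀, hF⟩ := exists_le_norm_subConst Γ f hρ hc0
  refine h.le_of_memPointwise hα ha hL hg hρ (by have : 0 < r / τ := by positivity
                                                 linarith) zero_le_one (half_pos hc0)
    fun ε hε => ?_
  have ht1 : ∀ᶠ n : ℕ in atTop, C₀ * (n : ℝ) ^ (-τ) < min ε ε₀ := by
    have := ((tendsto_rpow_neg_atTop hτ0).comp tendsto_natCast_atTop_atTop).const_mul C₀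
    rw [mul_zero] at this
    exact this.eventually (gt_mem_nhds (lt_min hε hε₀))
  -- The lower bound for f above q holds only for heights up to a multiple of d^{-2}. Since v is
  -- O(d^{-τ}), the assumption τ > 2 ensures this for large d.
  have ht2 : ∀ᶠ n : ℕ in atTop, C * C₀ * (n : ℝ) ^ (-(τ - 2)) < 1 := by
    have := ((tendsto_rpow_neg_atTop (sub_pos.2 hτ)).comp
      tendsto_natCast_atTop_atTop).const_mul (C * C₀)
    rw [mul_zero] at this
    exact this.eventually (gt_mem_nhds one_pos)
  obtain ⟨N, hN⟩ := eventually_atTop.1 (ht1.and ht2)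
  obtain ⟨q, ⟨hq, hqC⟩, hqN⟩ : ∃ q : ℚ, (¬ IsCuspidalAt Γ r f (q : OnePoint ℚ) ∧
      |x - (q : ℝ)| ≤ C₀ / (q.den : ℝ) ^ τ) ∧ N < q.den := by
    by_contra! hcon
    refine hinf ((finite_rat_den_le x C₀ N).subset fun q hq => ⟨hcon q hq, hq.2.trans ?_⟩)
    have hd : (1 : ℝ) ≤ q.den := by exact_mod_cast q.den_pos
    exact div_le_self hC₀.le (Real.one_le_rpow hd hτ0.le)
  obtain ⟨hN1, hN2⟩ := hN q.den hqN.le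
  have hd : (0 : ℝ) < q.den := by exact_mod_cast q.den_pos
  set d : ℝ := (q.den : ℝ)
  set v := |x - q| with hv
  have hv0 : 0 < v := hxq q
  have hvC : v ≤ C₀ * d ^ (-τ) := by rwa [Real.rpow_neg hd.le, ← div_eq_mul_inv]
  obtain ⟨z, hz, hzre, hzim⟩ := ofComplex_add_mul_I q hv0
  refine ⟨q, v, hv0, (hvC.trans_lt hN1).trans_le (min_le_left _ _), by
    rw [one_mul, abs_sub_comm], ?_⟩
  have h1 := hC q hq z hzre (by
    rw [hzim]
    calc C * (v * d ^ 2) ≤ C * (C₀ * d ^ (-τ) * d ^ 2) := by gcongr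
      _ = C * C₀ * d ^ (-(τ - 2)) := by
        rw [neg_sub, sub_eq_add_neg, Real.rpow_add hd, Real.rpow_two]; ring
      _ ≤ 1 := hN2.le)
  have h2 := hF z (by
    rw [hzim]; exact (hvC.trans_lt hN1).trans_le (min_le_right _ _)) (by
    rw [hzim] at h1 ⊢
    rw [hc, mul_assoc, inv_mul_le_iff₀ hC']
    refine le_trans ?_ h1
    have h3 : d ^ τ * v ≤ C₀ := by
      rw [Real.rpow_neg hd.le, ← div_eq_mul_inv, le_div_iff₀ (Real.rpow_pos_of_pos hd τ)] at hvC
      linarith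
    have h4 : C₀ ^ (-(r / τ)) ≤ (d ^ τ * v) ^ (-(r / τ)) :=
      Real.rpow_le_rpow_of_nonpos (by positivity) h3 (by
        have : 0 < r / τ := by positivity
        linarith)
    have h5 : (d ^ τ * v) ^ (-(r / τ)) = d ^ (-r) * v ^ (-(r / τ)) := by
      rw [Real.mul_rpow (by positivity) hv0.le, ← Real.rpow_mul hd.le]
      congr 2
      field_simp
    rw [h5] at h4
    calc C₀ ^ (-(r / τ)) * v ^ (-(r - r / τ)) ≤ d ^ (-r) * v ^ (-(r / τ)) * v ^ (-(r - r / τ)) := by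
          gcongr
      _ = (d * v) ^ (-r) := by
          rw [mul_assoc, ← Real.rpow_add hv0, Real.mul_rpow hd.le hv0.le]
          congr 2
          ring)
  rwa [hz, hzim] at h2

include hr hf hf0 in
theorem exists_rat_not_cuspidal_mem_Ioo (hg : ∃ γ, GrowsAt r f γ) (hx : Irrational x) {u v : ℝ}
    (hu : u < x) (hv : x < v) : ∃ q : ℚ, ¬ IsCuspidalAt Γ r f (q : OnePoint ℚ) ∧
      (q : ℝ) ∈ Set.Ioo u v := by
  obtain ⟨C, hC1, hC⟩ := exists_rat_not_cuspidal_near hr hf hf0 hg hx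
  obtain ⟨δ, hδ, h⟩ := exists_closedBall_subset_Ioo hu hv
  obtain ⟨N, hN⟩ := exists_nat_gt (C / δ)
  obtain ⟨q, hqN, hq, hqC⟩ := hC N
  refine ⟨q, hq, h _ ?_⟩
  rw [abs_sub_comm]
  have hd : (1 : ℝ) ≤ q.den := by exact_mod_cast q.den_pos
  have hd' : (N : ℝ) < q.den := by exact_mod_cast hqN
  refine hqC.trans ?_
  rw [div_lt_iff₀ hδ] at hN
  rw [div_le_iff₀ (by positivity)]
  have hd2 : (q.den : ℝ) ≤ (q.den : ℝ) ^ 2 := by nlinarith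
  nlinarith [mul_lt_mul_of_pos_right hd' hδ, mul_le_mul_of_nonneg_left hd2 hδ.le]

include hr hf hf0 in
theorem two_le_approxExp (hg : ∃ γ, GrowsAt r f γ) (hx : Irrational x) :
    ((2 : ℝ) : EReal) ≤ approxExp Γ r f x := by
  obtain ⟨C, hC1, hC⟩ := exists_rat_not_cuspidal_near hr hf hf0 hg hx
  refine le_iSup_of_le 2 (le_iSup_of_le ⟨C, fun hfin => ?_⟩ le_rfl)
  obtain ⟨N, hN⟩ := (hfin.image fun q : ℚ => q.den).bddAbove
  obtain ⟨q, hqN, hq, hqC⟩ := hC N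
  exact absurd (hN ⟨q, ⟨hq, by rwa [Real.rpow_two]⟩, rfl⟩) (not_le.2 hqN)

end Upper

end FracModular

end

/-! ### The exponents of modular forms -/

section

namespace FracModular

open Complex Filter MeasureTheory
open UpperHalfPlane hiding I

section Exponents

variable {Γ : Subgroup SL(2, ℤ)} {r α s x A : ℝ} {f : ℍ → ℂ} {L : ℂ →L[ℝ] ℂ} {a a' : ℂ}

theorem exists_pos_le_of_finite {τ : ℝ} (hx : Irrational x)
    (hfin : {q : ℚ | ¬ IsCuspidalAt Γ r f (q : OnePoint ℚ) ∧
      |x - (q : ℝ)| ≤ 1 / (q.den : ℝ) ^ τ}.Finite) :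
    ∃ c₀ : ℝ, 0 < c₀ ∧ ∀ q : ℚ, ¬ IsCuspidalAt Γ r f (q : OnePoint ℚ) →
      c₀ ≤ |x - q| * (q.den : ℝ) ^ τ := by
  have hd : ∀ q : ℚ, (0 : ℝ) < (q.den : ℝ) ^ τ := fun q =>
    Real.rpow_pos_of_pos (by exact_mod_cast q.den_pos) τ
  have hpos : ∀ q : ℚ, 0 < |x - q| * (q.den : ℝ) ^ τ := fun q =>
    mul_pos (abs_pos.2 (sub_ne_zero.2 (hx.ne_rat q))) (hd q)
  obtain ⟨c, hc, hmin⟩ : ∃ c : ℝ, 0 < c ∧ ∀ q ∈ {q : ℚ | ¬ IsCuspidalAt Γ r f (q : OnePoint ℚ) ∧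
      |x - (q : ℝ)| ≤ 1 / (q.den : ℝ) ^ τ}, c ≤ |x - q| * (q.den : ℝ) ^ τ := by
    rcases Set.eq_empty_or_nonempty {q : ℚ | ¬ IsCuspidalAt Γ r f (q : OnePoint ℚ) ∧
      |x - (q : ℝ)| ≤ 1 / (q.den : ℝ) ^ τ} with he | hne
    · exact ⟨1, one_pos, fun q hq => by rw [he] at hq; exact hq.elim⟩
    · obtain ⟨q₀, -, h₀⟩ := Set.exists_min_image _
        (fun q : ℚ => |x - q| * (q.den : ℝ) ^ τ) hfin hne
      exact ⟨_, hpos q₀, h₀⟩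
  refine ⟨min c 1, lt_min hc one_pos, fun q hq => ?_⟩
  by_cases h : |x - (q : ℝ)| ≤ 1 / (q.den : ℝ) ^ τ
  · exact (min_le_left _ _).trans (hmin q ⟨hq, h⟩)
  · rw [not_le, div_lt_iff₀ (hd q)] at h
    exact (min_le_right _ _).trans h.le

variable [Γ.FiniteIndex]

section Lower

variable (hr : 0 < r) (hf : IsModularForm Γ r f) (hf0 : f ≠ 0)

include hr hf hf0 in
theorem memPointwise_fracIntegral_of_lt (hα : r < α) (hs0 : 0 ≤ s) (hs : s < α - r) :
    MemPointwise (fun y => fracIntegral Γ f α y) s x := by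
  obtain ⟨C, -, hC⟩ := exists_norm_le_im_rpow_neg hr hf hf0
  have h := expSeries_subConst hr hf hf0 hr ⟨C, hC⟩
  simp only [fracIntegral_eq]
  obtain ⟨C', -, hC'⟩ := h.exists_norm_le
  exact h.memPointwise_fracLim hα le_rfl hs0 (by linarith)
    ⟨C', fun z hz _ => by simpa using hC' z hz⟩

-- If τ_x < τ, only finitely many non-cuspidal p/q have |x-p/q| ≤ q^{-τ}, and none equals x. So
-- |x-p/q| q^τ has a positive lower bound, and f(z) = O(y^{-r}|z-x|^{r/τ}) follows.
include hr hf hf0 in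
theorem memPointwise_fracIntegral_of_approxExp_lt {τ : ℝ} (hx : Irrational x) (hτ2 : 2 ≤ τ)
    (hτ : approxExp Γ r f x < τ) (hα : r < α) (hs0 : 0 ≤ s) (hs : s < α - r + r / τ) :
    MemPointwise (fun y => fracIntegral Γ f α y) s x := by
  obtain ⟨C, -, hC⟩ := exists_norm_le_im_rpow_neg hr hf hf0
  have h := expSeries_subConst hr hf hf0 hr ⟨C, hC⟩
  have hfin : {q : ℚ | ¬ IsCuspidalAt Γ r f (q : OnePoint ℚ) ∧
      |x - (q : ℝ)| ≤ 1 / (q.den : ℝ) ^ τ}.Finite := by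
    by_contra hinf
    exact (not_le.2 hτ) (le_iSup_of_le τ (le_iSup_of_le ⟨1, hinf⟩ le_rfl))
  obtain ⟨c₀, hc₀, hc⟩ := exists_pos_le_of_finite hx hfin
  obtain ⟨C', -, hC'⟩ := exists_norm_le_near hr hf hf0 hτ2 hc₀ hc
  have hB : 0 ≤ r / τ := div_nonneg hr.le (by linarith)
  simp only [fracIntegral_eq]
  exact h.memPointwise_fracLim hα hB hs0 hs
    (exists_norm_subConst_le (f := f) Γ hB (div_le_self hr.le (by linarith)) ⟨C', hC'⟩)

omit [Γ.FiniteIndex] in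
/-- The reciprocal of `τ_x` as a real number. -/
theorem exists_inv_approxExp_eq (h2 : ((2 : ℝ) : EReal) ≤ approxExp Γ r f x) :
    ∃ w : ℝ, 0 ≤ w ∧ w ≤ 1 / 2 ∧ (approxExp Γ r f x)⁻¹ = (w : EReal) ∧
      (∀ τ : ℝ, 0 < τ → (approxExp Γ r f x < τ ↔ 1 / τ < w)) ∧
      (∀ τ : ℝ, 0 < τ → ((τ : EReal) < approxExp Γ r f x ↔ w < 1 / τ)) := by
  induction hT : approxExp Γ r f x with
  | bot => rw [hT] at h2; simp at h2
  | top =>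
    refine ⟨0, le_rfl, by norm_num, by simp, fun τ hτ => ?_, fun τ hτ => ?_⟩
    · simp [hτ.le]
    · simp [hτ]
  | coe t =>
    rw [hT, EReal.coe_le_coe_iff] at h2
    have ht : 0 < t := by linarith
    refine ⟨1 / t, by positivity, one_div_le_one_div_of_le two_pos h2, by
      rw [one_div, EReal.coe_inv], fun τ hτ => ?_, fun τ hτ => ?_⟩
    · rw [EReal.coe_lt_coe_iff, one_div_lt_one_div hτ ht]
    · rw [EReal.coe_lt_coe_iff, one_div_lt_one_div ht hτ]

end Lower

/-- The exponents in the cuspidal case. -/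
theorem holderExp_of_isCuspForm (hr : 0 < r) (hf : IsModularForm Γ r f) (hf0 : f ≠ 0)
    (ha : a ≠ 0) (hL : ∀ w, L w = a * w + a' * (starRingEnd ℂ) w) (hx : Irrational x)
    (hcusp : IsCuspForm Γ r f) (hα : r / 2 < α) :
    (∀ y, Tendsto (fun N => fracPartialSum Γ f α N y) atTop (𝓝 (fracIntegral Γ f α y))) ∧
    holderExp (fun y => L (fracIntegral Γ f α y)) x = ((α - r / 2 : ℝ) : EReal) ∧
    holderExpStar (fun y => L (fracIntegral Γ f α y)) x = ((α - r / 2 : ℝ) : EReal) ∧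
    holderExpStarStar (fun y => L (fracIntegral Γ f α y)) x = ((α - r / 2 : ℝ) : EReal) := by
  have hng : ∀ γ, ¬ GrowsAt r f γ := by
    by_contra! hg
    exact (not_isCuspForm_iff hr hf hf0).2 hg hcusp
  obtain ⟨C, -, hC⟩ := exists_norm_le_of_forall_not_growsAt hr hf hf0 hng
  have h := expSeries_subConst hr hf hf0 (half_pos hr) ⟨C, fun z _ => hC z⟩
  -- The chain α-r/2 ≤ β** ≤ β* ≤ β ≤ α-r/2 gives all three equalities.
  have hlow : ((α - r / 2 : ℝ) : EReal) ≤
      holderExpStarStar (fun y => L (fracIntegral Γ f α y)) x := by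
    simp only [fracIntegral_eq]
    exact h.le_holderExpStarStar L hα x
  have hup : holderExp (fun y => L (fracIntegral Γ f α y)) x ≤ ((α - r / 2 : ℝ) : EReal) :=
    iSup₂_le fun s hs => EReal.coe_le_coe_iff.2
      (le_sub_half_of_memPointwise hr hf hf0 h hα ha hL hα.le hx hs)
  have h1 := holderExpStarStar_le_holderExpStar (fun y => L (fracIntegral Γ f α y)) x
  have h2 := holderExpStar_le_holderExp (fun y => L (fracIntegral Γ f α y)) x
  refine ⟨fun y => ?_, le_antisymm hup (hlow.trans (h1.trans h2)),
    le_antisymm (h2.trans hup) (hlow.trans h1), le_antisymm (h1.trans (h2.trans hup)) hlow⟩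
  simp only [fracPartialSum_eq, fracIntegral_eq]
  exact h.tendsto_fracSeries hα (by simp)

/-- The exponents in the non-cuspidal case. -/
theorem holderExp_of_not_isCuspForm (hr : 0 < r) (hf : IsModularForm Γ r f) (hf0 : f ≠ 0)
    (ha : a ≠ 0) (hL : ∀ w, L w = a * w + a' * (starRingEnd ℂ) w) (hx : Irrational x)
    (hcusp : ¬ IsCuspForm Γ r f) (hα : r < α) :
    (∀ y, Tendsto (fun N => fracPartialSum Γ f α N y) atTop (𝓝 (fracIntegral Γ f α y))) ∧
    holderExp (fun y => L (fracIntegral Γ f α y)) x =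
      (α : EReal) - (1 - 1 / approxExp Γ r f x) * (r : EReal) ∧
    ((¬ ∃ k : ℤ, α - r = (k : ℝ)) → holderExpStar (fun y => L (fracIntegral Γ f α y)) x =
      ((⌊α - r⌋ : ℝ) : EReal) + min 1 (((Int.fract (α - r) : ℝ) : EReal) +
        (r : EReal) / approxExp Γ r f x)) ∧
    ((∃ k : ℤ, α - r = (k : ℝ)) → holderExpStar (fun y => L (fracIntegral Γ f α y)) x =
      ((α - r : ℝ) : EReal)) ∧
    holderExpStarStar (fun y => L (fracIntegral Γ f α y)) x = ((α - r : ℝ) : EReal) := by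
  have hg := (not_isCuspForm_iff hr hf hf0).1 hcusp
  obtain ⟨C, -, hC⟩ := exists_norm_le_im_rpow_neg hr hf hf0
  have h := expSeries_subConst hr hf hf0 hr ⟨C, hC⟩
  have hαr : 0 < α - r := sub_pos.2 hα
  obtain ⟨w, hw0, hw2, hw, hlt, hgt⟩ :=
    exists_inv_approxExp_eq (two_le_approxExp hr hf hf0 hg hx)
  set g : ℝ → ℂ := fun y => L (fracIntegral Γ f α y) with hgdef
  have hrw : 0 ≤ r * w := mul_nonneg hr.le hw0
  have hpt : ∀ {α' s : ℝ}, r < α' → 0 ≤ s → s < α' - r + r * w →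
      MemPointwise (fun y => fracIntegral Γ f α' y) s x := by
    intro α' s hα' hs0 hs
    by_cases hs' : s < α' - r
    · exact memPointwise_fracIntegral_of_lt hr hf hf0 hα' hs0 hs'
    · rw [not_lt] at hs'
      -- B lies strictly between s-(α'-r) and rw. Thus τ = r/B exceeds τ_x, while s < α'-r+B.
      set B := (s - (α' - r) + r * w) / 2 with hB
      have hB0 : 0 < B := by rw [hB]; linarith
      have hBw : B / r < w := by rw [div_lt_iff₀ hr, hB]; linarith
      have hτ : 1 / (r / B) = B / r := by rw [one_div_div]
      refine memPointwise_fracIntegral_of_approxExp_lt (τ := r / B) hr hf hf0 hx ?_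
        ((hlt _ (by positivity)).2 (by rwa [hτ])) hα' hs0 ?_
      · rw [le_div_iff₀ hB0]
        rw [div_lt_iff₀ hr] at hBw
        nlinarith
      · rw [div_div_cancel₀ hr.ne', hB]
        linarith
  have hup : ∀ {s : ℝ}, MemPointwise g s x → s ≤ α - r + r * w := by
    intro s hs
    by_contra! hcon
    -- For τ_x = 2 the claim is the general bound α-r/2. Otherwise there is room for u with 1/τ_x <
    -- u < 1/2, and approximations of exponent τ > 1/u > 2 exist, as the bound from approximation
    -- requires.
    rcases hw2.eq_or_lt with rfl | hw2
    · have := le_sub_half_of_memPointwise hr hf hf0 h hα ha hL (by linarith) hx hs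
      linarith
    · set e := s - (α - r) with he
      have he0 : 0 < e := by rw [he]; linarith
      have hwe : w < e / r := by rw [lt_div_iff₀ hr, he]; linarith
      obtain ⟨u, hwu, hu⟩ := exists_between (lt_min hw2 hwe)
      have hu0 : 0 < u := by linarith
      have h1 : (((1 / u : ℝ)) : EReal) < approxExp Γ r f x :=
        (hgt _ (by positivity)).2 (by rwa [one_div_one_div])
      obtain ⟨τ, hτ⟩ := lt_iSup_iff.1 h1
      obtain ⟨⟨C₀, hinf⟩, hτu⟩ := lt_iSup_iff.1 hτ
      rw [EReal.coe_lt_coe_iff] at hτu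
      have hu2 : 2 < 1 / u := by
        rw [lt_div_iff₀ hu0]; linarith [hu.trans_le (min_le_left _ _)]
      have h2 := le_of_memPointwise_of_approx hr hf hf0 h hα ha hL hα.le hx
        (hu2.trans hτu) hinf hs
      have h3 : r / τ < r * u := by
        rw [div_lt_iff₀ (by linarith)]
        rw [div_lt_iff₀ hu0] at hτu
        nlinarith
      have h4 : u < e / r := hu.trans_le (min_le_right _ _)
      rw [lt_div_iff₀ hr] at h4
      linarith
  have hlow : ((α - r : ℝ) : EReal) ≤ holderExpStarStar g x := by
    simp only [hgdef, fracIntegral_eq]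
    exact h.le_holderExpStarStar L hα x
  -- Continuity of the k-th derivative around x reaches a non-cuspidal rational, where the pointwise
  -- exponent is at most α-r and where equality k = α-r is also excluded.
  have hstar : ∀ {k : ℕ} {s : ℝ}, MemRestricted g k s x → (k : ℝ) ≤ α - r ∧ α - r ≠ k := by
    intro k s hk
    obtain ⟨u, v, hu, hv, hks⟩ := hk.exists_Ioo
    obtain ⟨q, hq, hqm⟩ := exists_rat_not_cuspidal_mem_Ioo hr hf hf0 hg hx hu hv
    have h1 := hks q hqm
    refine ⟨?_, fun hke => not_memRestricted_rat hr hf hf0 h hα ha hL hke hq h1⟩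
    have h2 := h1.memPointwise
    rw [add_zero] at h2
    exact le_sub_of_memPointwise_rat hr hf hf0 h hα ha hL hα.le hq h2
  refine ⟨fun y => ?_, ?_, fun hint => ?_, fun hint => ?_, ?_⟩
  · simp only [fracPartialSum_eq, fracIntegral_eq]
    exact h.tendsto_fracSeries hα (by simp)
  · have e : (α : EReal) - (1 - 1 / approxExp Γ r f x) * (r : EReal) =
        ((α - r + r * w : ℝ) : EReal) := by
      rw [one_div, hw]
      have : α - r + r * w = α - (1 - w) * r := by ring
      rw [this]
      push_cast
      rfl
    rw [e]
    refine le_antisymm (iSup₂_le fun s hs => EReal.coe_le_coe_iff.2 (hup hs))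
      (coe_le_of_forall_lt (by linarith) fun s hs0 hs => ⟨s, le_rfl, ?_⟩)
    exact le_iSup₂_of_le s ((hpt hα hs0 hs).comp_continuousLinearMap L) le_rfl
  · have e : ((⌊α - r⌋ : ℝ) : EReal) + min 1 (((Int.fract (α - r) : ℝ) : EReal) +
        (r : EReal) / approxExp Γ r f x) =
        ((⌊α - r⌋ + min 1 (Int.fract (α - r) + r * w) : ℝ) : EReal) := by
      rw [div_eq_mul_inv, hw, EReal.coe_add, EReal.coe_strictMono.monotone.map_min]
      push_cast
      rfl
    rw [e]
    have hfr : 0 < Int.fract (α - r) :=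
      (Int.fract_nonneg _).lt_of_ne fun h0 => hint ⟨⌊α - r⌋, by
        have := Int.floor_add_fract (α - r)
        rw [← h0, add_zero] at this
        exact this.symm⟩
    have hfl := Int.floor_add_fract (α - r)
    obtain ⟨k, hk⟩ := Int.eq_ofNat_of_zero_le (Int.floor_nonneg.2 hαr.le)
    have hk' : ((⌊α - r⌋ : ℤ) : ℝ) = k := by rw [hk]; simp
    rw [hk'] at hfl ⊢
    have hmin : 0 < min 1 (Int.fract (α - r) + r * w) := lt_min one_pos (by linarith)
    refine le_antisymm (iSup_le fun j => iSup₂_le fun s hs => EReal.coe_le_coe_iff.2 ?_)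
      (coe_le_of_forall_lt (add_pos_of_nonneg_of_pos (Nat.cast_nonneg k) hmin)
        fun s hs0 hs => ?_)
    · have h1 := (hstar hs).1
      have h2 := hup hs.memPointwise
      have h3 : j ≤ k := by
        have : (j : ℤ) ≤ ⌊α - r⌋ := Int.le_floor.2 (by exact_mod_cast h1)
        rw [hk] at this
        exact_mod_cast this
      have hs1 := hs.2.1
      rcases h3.eq_or_lt with rfl | h3
      · have : s ≤ min 1 (Int.fract (α - r) + r * w) := le_min hs1 (by linarith)
        linarith
      · have : (j : ℝ) + 1 ≤ k := by exact_mod_cast h3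
        linarith
    · set s' := max (s - k) (min 1 (Int.fract (α - r) + r * w) / 2) with hs'
      have hs'0 : 0 < s' := lt_max_of_lt_right (half_pos hmin)
      have hs'1 : s' < min 1 (Int.fract (α - r) + r * w) :=
        max_lt (by linarith) (half_lt_self hmin)
      have hkα : r < α - k := by linarith
      -- With k = [α-r] and α-r not an integer, α-k is still larger than r, so the pointwise result
      -- at x applies to the k-th derivative.
      have h1 := hpt (α' := α - k) hkα hs'0.le (by
        have := hs'1.trans_le (min_le_right _ _)
        linarith)
      simp only [fracIntegral_eq] at h1
      have h2 : MemRestricted g k s' x := by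
        simp only [hgdef, fracIntegral_eq]
        exact h.memRestricted_map_fracLim L hkα hs'0 (hs'1.le.trans (min_le_left _ _)) h1
      refine ⟨k + s', by linarith [le_max_left (s - k) (min 1 (Int.fract (α - r) + r * w) / 2)], ?_⟩
      exact le_iSup_of_le k (le_iSup₂_of_le s' h2 le_rfl)
  · refine le_antisymm (iSup_le fun j => iSup₂_le fun s hs => EReal.coe_le_coe_iff.2 ?_)
      (hlow.trans (holderExpStarStar_le_holderExpStar g x))
    obtain ⟨h1, h2⟩ := hstar hs
    obtain ⟨k, hk⟩ := hint
    -- Here j and α-r are integers with j < α-r, so even the full Hölder order s ≤ 1 gives j+s ≤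
    -- α-r.
    have h3 : (j : ℝ) < α - r := h1.lt_of_ne' h2
    rw [hk] at h3 ⊢
    have h4 : (j : ℤ) + 1 ≤ k := by exact_mod_cast h3
    have h5 : (j : ℝ) + 1 ≤ k := by exact_mod_cast h4
    linarith [hs.2.1]
  · refine le_antisymm (iSup_le fun u => iSup_le fun v => iSup_le fun hu => iSup_le fun hv =>
      iSup_le fun j => iSup₂_le fun s hs => EReal.coe_le_coe_iff.2 ?_) hlow
    obtain ⟨q, hq, hqm⟩ := exists_rat_not_cuspidal_mem_Ioo hr hf hf0 hg hx hu hv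
    exact le_sub_of_memPointwise_rat hr hf hf0 h hα ha hL hα.le hq
      (hs.memRestricted hqm.1 hqm.2).memPointwise

end Exponents

end FracModular

end

end

theorem theorem2p3 (Γ : Subgroup SL(2, ℤ)) (hΓ : Γ.FiniteIndex)
    (r : ℝ) (hr : 0 < r)
    (f : UpperHalfPlane → ℂ) (hf : FracModular.IsModularForm Γ r f) (hf0 : f ≠ 0)
    (hκ : FracModular.RationalCuspParams Γ r f)
    (α : ℝ) (hα : FracModular.alphaZero Γ r f < α)
    (x : ℝ) (hx : Irrational x) :
    (∀ y : ℝ, Filter.Tendsto (fun N : ℕ => FracModular.fracPartialSum Γ f α N y) Filter.atTop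
      (𝓝 (FracModular.fracIntegral Γ f α y))) ∧
    ∀ g : ℝ → ℂ,
      (g = (fun y => FracModular.fracIntegral Γ f α y) ∨
        g = (fun y => (((FracModular.fracIntegral Γ f α y).re : ℝ) : ℂ)) ∨
        g = (fun y => (((FracModular.fracIntegral Γ f α y).im : ℝ) : ℂ))) →
      (FracModular.IsCuspForm Γ r f →
        FracModular.holderExp g x = ((α - r / 2 : ℝ) : EReal) ∧
        FracModular.holderExpStar g x = ((α - r / 2 : ℝ) : EReal) ∧
        FracModular.holderExpStarStar g x = ((α - r / 2 : ℝ) : EReal)) ∧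
      (¬ FracModular.IsCuspForm Γ r f →
        FracModular.holderExp g x =
          (α : EReal) - (1 - 1 / FracModular.approxExp Γ r f x) * (r : EReal) ∧
        ((¬ ∃ k : ℤ, α - r = (k : ℝ)) →
          FracModular.holderExpStar g x =
            ((⌊α - r⌋ : ℝ) : EReal) +
              min 1 (((Int.fract (α - r) : ℝ) : EReal) +
                (r : EReal) / FracModular.approxExp Γ r f x)) ∧
        ((∃ k : ℤ, α - r = (k : ℝ)) →
          FracModular.holderExpStar g x = ((α - r : ℝ) : EReal)) ∧
        FracModular.holderExpStarStar g x = ((α - r : ℝ) : EReal)) := by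
  -- The identity, the real part and the imaginary part all have the form w ↦ aw + a' conj(w) with a
  -- ≠ 0.
  have key : ∀ (L : ℂ →L[ℝ] ℂ) (a a' : ℂ), a ≠ 0 →
      (∀ w, L w = a * w + a' * (starRingEnd ℂ) w) → _ := fun L a a' ha hL =>
    And.intro (fun h : FracModular.IsCuspForm Γ r f =>
      FracModular.holderExp_of_isCuspForm (x := x) hr hf hf0 ha hL hx h
        (by rwa [FracModular.alphaZero, if_pos h] at hα))
      (fun h : ¬ FracModular.IsCuspForm Γ r f =>
      FracModular.holderExp_of_not_isCuspForm (x := x) hr hf hf0 ha hL hx h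
        (by rwa [FracModular.alphaZero, if_neg h] at hα))
  have hid := key (ContinuousLinearMap.id ℝ ℂ) 1 0 one_ne_zero (fun w => by simp)
  refine ⟨?_, ?_⟩
  · by_cases h : FracModular.IsCuspForm Γ r f
    · exact (hid.1 h).1
    · exact (hid.2 h).1
  · rintro g (rfl | rfl | rfl)
    · exact ⟨fun h => (hid.1 h).2, fun h => (hid.2 h).2⟩
    · have hre := key (Complex.ofRealCLM.comp Complex.reCLM) (1 / 2) (1 / 2) (by norm_num)
        (fun w => by
          rw [← mul_add, Complex.add_conj]
          simp)
      exact ⟨fun h => (hre.1 h).2, fun h => (hre.2 h).2⟩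
    · have him := key (Complex.ofRealCLM.comp Complex.imCLM) (-Complex.I / 2) (Complex.I / 2)
        (by simp [Complex.I_ne_zero])
        (fun w => by
          have h := Complex.sub_conj w
          have h2 : -Complex.I / 2 * w + Complex.I / 2 * (starRingEnd ℂ) w =
              -Complex.I / 2 * (w - (starRingEnd ℂ) w) := by ring
          rw [h2, h]
          have h3 := Complex.I_mul_I
          simp only [ContinuousLinearMap.comp_apply, Complex.imCLM_apply,
            Complex.ofRealCLM_apply]
          push_cast
          linear_combination (w.im : ℂ) * h3)
      exact ⟨fun h => (him.1 h).2, fun h => (him.2 h).2⟩
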